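/- **Setting.** All graphs are finite, simple and undirected. An instance of node-weighted Elem-SNDP consists of a graph $G=(V,E)$, a set $R\subseteq V$ of reliable nodes, weights $w:V\to\mathbb R_{\ge 0}$ and symmetric requirements $r(uv)\in\mathbb Z_{\ge0}$ that are nonzero only for pairs in $R$; a terminal is a node $u$ with $r(uv)>0$ for some $v\ne u$. A biset is a pair $\hat S=(S,S')$ with $S\subseteq S'\subseteq V$; its boundary is $\mathrm{bd}(\hat S)=S'\setminus S$. Bisets are ordered by inclusion of both parts, and $\hat S\cap\hat T=(S\cap T,S'\cap T')$, $\hat S\cup\hat T=(S\cup T,S'\cup T')$, $\hat S\setminus\hat T=(S\setminus T',S'\setminus T)$. For a graph $F$ on $V$, $\delta_F(\hat S)$ is the set of edges of $F$ between $S$ and $V\setminus S'$, and $\Gamma_F(\hat S)$ is the set of their endpoints in $V\setminus S'$. Let $\mathcal P$ be the set of bisets whose boundary contains no reliable node, let $r(\hat S)=\max\{r(uv):u\in S,\ v\in V\setminus S'\}$ ($0$ if there is no such pair), and let $f_m(\hat S)=\min\{m,r(\hat S)\}-|\mathrm{bd}(\hat S)|$. A graph $F$ covers a function $g$ on $\mathcal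 P$ if $|\delta_F(\hat S)|\ge g(\hat S)$ for all $\hat S\in\mathcal P$; a biset $\hat S \in \mathcal P$ with $|\delta_F(\hat S)|<g(\hat S)$ is violated. In phase $\ell\ge1$ of the augmentation framework a set $X\subseteq V$ is given that contains all terminals and for which $H=(V,E[X])$ covers $f_{\ell-1}$. Put $G_\ell=(V,E\setminus E(H))$ and, for $\hat S\in\mathcal P$, $h_\ell(\hat S)=\max\{0,f_\ell(\hat S)-|\delta_H(\hat S)|\}$. A set $Y\subseteq V$ is said to cover $h_\ell$ if $(V,E_{G_\ell}[Y])$ does; it is assumed that $V$ covers $h_\ell$. Let $w_\ell(v)=0$ for $v\in X$ and $w_\ell(v)=w(v)$ otherwise. The problem of phase $\ell$ is to find $A\subseteq V$ with $X\cup A$ covering $h_\ell$ and $w_\ell(A)$ minimum. Its LP relaxation is: minimize $\sum_v w_\ell(v)x(v)$ subject to $\sum_{v\in\Gamma_{G_\ell}(\hat S)}x(v)\ge h_\ell(\hat S)$ for all $\hat S\in\mathcal P$, and $x\ge0$; the dual LP has variables $y(\hat S)\ge0$ and the constraints $\sum_{\hat S\in\mathcal P:\,v\in\Gamma_{G_\ell}(\hat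 S)}y(\hat S)\le w_\ell(v)$ for $v\in V$. **The primal-dual algorithm with reverse delete**, started from a set $P_0$ with $X\subseteq P_0\subseteq\{v:w_\ell(v)=0\}$: put $P=P_0$ and $y=0$. While there are violated bisets of $h_\ell$ with respect to $(V,E_{G_\ell}[P])$, let $\mathcal C$ be the set of the minimal ones, raise all $y(\hat C)$, $\hat C\in\mathcal C$, by the same amount until the dual constraint of some $v\in\bigcup_{\hat C\in\mathcal C}\Gamma_{G_\ell}(\hat C)\setminus P$ becomes tight, with all dual constraints still satisfied, and add $v$ to $P$ (ties are broken arbitrarily). Then put $Q=P$, go through the added nodes in the reverse of the order of addition, and delete a node from $Q$ if the rest of $Q$ still covers $h_\ell$. Output $Q$. **Theorem.** 1. $\mathcal P$ is closed under unions, intersections and differences, and $h_\ell$ is a $\{0,1\}$-valued biuncrossable function on it: if $h_\ell(\hat S)=h_\ell(\hat T)=1$, then $h_\ell(\hat S\cap\hat T)+h_\ell(\hat S\cup\hat T)\ge2$ or $h_\ell(\hat S\setminus\hat T)+h_\ell(\hat T\setminus\hat S)\ge2$. 2. The algorithm never gets stuck, and its first stage ends after at most $|V|$ iterations. 3. For every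 proper minor-closed family $\mathcal G$ of graphs there is a constant $c$, depending only on $\mathcal G$, such that, whenever $G\in\mathcal G$, every output $Q$ of the algorithm contains $X$, covers $h_\ell$, and satisfies $w_\ell(Q)\le c\cdot\sum_v w_\ell(v)x(v)$ for every feasible solution $x$ of the LP relaxation, and $w_\ell(Q)\le c\cdot w_\ell(A)$ for every $A\subseteq V$ for which $X\cup A$ covers $h_\ell$. 4. There is a polynomial-time implementation: one fixed program of a random access machine and a polynomial $p$ such that for every graph $G$ on $n$ nodes and every phase as above the program, given $(G,R,r,w,X,\ell)$, halts after at most $p(n)$ steps with an output of the algorithm started from $P_0=\{v:w_\ell(v)=0\}$. (The machine has registers for natural numbers, with unit-cost addition, truncated subtraction, comparison and indirect addressing by pairs of indices, and registers for real numbers, with unit-cost addition, subtraction, comparison and division by natural numbers.) Consequently there is a polynomial-time $O(1)$-approximation algorithm, relative to the LP relaxation, for finding a minimum-weight node set that covers $h_\ell$ for graphs from a proper minor-closed family. -/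

import Mathlib

open Finset

/-! ### Minors and minor-closed families of finite graphs -/

/-- `H` is a minor of `G`: there are pairwise disjoint connected (hence nonempty) branch sets in `G`,
one for each vertex of `H`, with an edge of `G` between the branch sets of adjacent vertices. -/
def IsMinor {W V : Type*} (H : SimpleGraph W) (G : SimpleGraph V) : Prop :=
  ∃ B : W → Set V,
    (∀ a, (G.induce (B a)).Connected) ∧
    (∀ a b, a ≠ b → Disjoint (B a) (B b)) ∧
    (∀ a b, H.Adj a b → ∃ u ∈ B a, ∃ v ∈ B b, G.Adj u v)

/-- A family of finite graphs, the vertices of each graph being numbered `0, …, n - 1`. -/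
abbrev GraphFamily := ∀ n : ℕ, Set (SimpleGraph (Fin n))

/-- Closed under taking minors (in particular under isomorphism). -/
def GraphFamily.MinorClosed (𝒢 : GraphFamily) : Prop :=
  ∀ (n m : ℕ) (G : SimpleGraph (Fin n)) (H : SimpleGraph (Fin m)),
    G ∈ 𝒢 n → IsMinor H G → H ∈ 𝒢 m

/-- Not the family of all finite graphs. -/
def GraphFamily.Proper (𝒢 : GraphFamily) : Prop :=
  ∃ (n : ℕ) (G : SimpleGraph (Fin n)), G ∉ 𝒢 n

/-! ### Bisets -/

/-- A biset: a pair of vertex sets `inner ⊆ outer`. -/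
@[ext] structure Biset (V : Type*) where
  inner : Finset V
  outer : Finset V
  sub : inner ⊆ outer

namespace Biset

variable {V : Type*}

theorem pair_injective :
    Function.Injective (fun S : Biset V => ((S.inner, S.outer) : Finset V × Finset V)) := by
  intro S T h
  have h' := Prod.mk.inj h
  exact Biset.ext h'.1 h'.2

/-- `S ≤ T` iff the inner part of `S` is contained in that of `T`, and likewise for outer parts. -/
instance : PartialOrder (Biset V) :=
  PartialOrder.lift (fun S : Biset V => ((S.inner, S.outer) : Finset V × Finset V)) pair_injective

noncomputable instance [Fintype V] : Fintype (Biset V) :=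
  Fintype.ofInjective _ (pair_injective (V := V))

variable [DecidableEq V]

/-- The boundary of a biset. -/
def bd (S : Biset V) : Finset V := S.outer \ S.inner

def inter (S T : Biset V) : Biset V :=
  ⟨S.inner ∩ T.inner, S.outer ∩ T.outer, Finset.inter_subset_inter S.sub T.sub⟩

def union (S T : Biset V) : Biset V :=
  ⟨S.inner ∪ T.inner, S.outer ∪ T.outer, Finset.union_subset_union S.sub T.sub⟩

def diff (S T : Biset V) : Biset V :=
  ⟨S.inner \ T.outer, S.outer \ T.inner, Finset.sdiff_subset_sdiff S.sub T.sub⟩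

/-- A crossing bifamily: closed under union, intersection and differences. -/
def IsCrossing (𝓑 : Set (Biset V)) : Prop :=
  ∀ S ∈ 𝓑, ∀ T ∈ 𝓑, S.union T ∈ 𝓑 ∧ S.inter T ∈ 𝓑 ∧ S.diff T ∈ 𝓑 ∧ T.diff S ∈ 𝓑

/-- `f` is biuncrossable on the bifamily `𝓑`. -/
def IsBiuncrossable (𝓑 : Set (Biset V)) (f : Biset V → ℤ) : Prop :=
  ∀ S ∈ 𝓑, ∀ T ∈ 𝓑, 0 < f S → 0 < f T →
    f S + f T ≤ f (S.inter T) + f (S.union T) ∨ f S + f T ≤ f (S.diff T) + f (T.diff S)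

variable [Fintype V]

open scoped Classical in
/-- The edges of `F` crossing `S` (one endpoint in the inner part, the other outside the outer
part). Every such edge is listed once, as the pair (endpoint inside, endpoint outside). -/
noncomputable def cut (F : SimpleGraph V) (S : Biset V) : Finset (V × V) :=
  univ.filter fun e => e.1 ∈ S.inner ∧ e.2 ∉ S.outer ∧ F.Adj e.1 e.2

open scoped Classical in
/-- `Γ_F(S)`: the endpoints outside the outer part of the edges of `F` crossing `S`. -/
noncomputable def nbr (F : SimpleGraph V) (S : Biset V) : Finset V :=
  univ.filter fun v => v ∉ S.outer ∧ ∃ u ∈ S.inner, F.Adj u v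

/-- The edge set of `F` is a feasible cover of the function `f` on `𝓑`. -/
def IsCover (𝓑 : Set (Biset V)) (f : Biset V → ℤ) (F : SimpleGraph V) : Prop :=
  ∀ S ∈ 𝓑, f S ≤ ((S.cut F).card : ℤ)

/-- `S` is violated with respect to `F`. -/
def IsViolated (𝓑 : Set (Biset V)) (f : Biset V → ℤ) (F : SimpleGraph V) (S : Biset V) : Prop :=
  S ∈ 𝓑 ∧ ((S.cut F).card : ℤ) < f S

open scoped Classical in
/-- All (inclusion-wise) minimal violated bisets with respect to `F`. -/
noncomputable def minViolated (𝓑 : Set (Biset V)) (f : Biset V → ℤ) (F : SimpleGraph V) :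
    Finset (Biset V) :=
  univ.filter fun S => Minimal (IsViolated 𝓑 f F) S

end Biset

/-- The spanning subgraph `(V, E_F[Y])`: the edges of `F` with both endpoints in `Y`. -/
def edgesWithin {V : Type*} (F : SimpleGraph V) (Y : Finset V) : SimpleGraph V where
  Adj u v := F.Adj u v ∧ u ∈ Y ∧ v ∈ Y
  symm := ⟨fun _ _ h => ⟨h.1.symm, h.2.2, h.2.1⟩⟩
  loopless := ⟨fun _ h => h.1.ne rfl⟩

/-! ### Node-weighted element-connectivity network design and its augmentation phases -/

/-- An instance of node-weighted Elem-SNDP: a graph, the set of reliable nodes, integer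
requirements between reliable nodes, and non-negative node weights. -/
structure ElemSNDP (V : Type*) where
  G : SimpleGraph V
  R : Finset V
  r : V → V → ℕ
  r_symm : ∀ u v, r u v = r v u
  r_reliable : ∀ u v, r u v ≠ 0 → u ∈ R ∧ v ∈ R
  w : V → ℝ
  w_nonneg : ∀ v, 0 ≤ w v

/-- Phase `ℓ` of the augmentation framework; `X` is the set `X_{ℓ-1}` of the nodes selected in the
previous phases. -/
structure Phase (V : Type*) extends ElemSNDP V where
  ℓ : ℕ
  X : Finset V

namespace Phase

variable {V : Type*} [Fintype V] [DecidableEq V]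

/-- The terminals: the nodes that take part in a pair with positive requirement. -/
def IsTerminal (I : Phase V) (u : V) : Prop := ∃ v, v ≠ u ∧ 0 < I.r u v

/-- `𝓑_elem`: the bisets whose boundary contains only non-reliable nodes. -/
def family (I : Phase V) : Set (Biset V) := {S | Disjoint S.bd I.R}

/-- `r_elem S`: the maximum requirement of a pair separated by `S` (`0` if there is none). -/
def rElem (I : Phase V) (S : Biset V) : ℕ :=
  (S.inner ×ˢ S.outerᶜ).sup fun p => I.r p.1 p.2

/-- `f_m S = min {m, r_elem S} - |bd S|`. -/
def f (I : Phase V) (m : ℕ) (S : Biset V) : ℤ :=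
  ((min m (I.rElem S) : ℕ) : ℤ) - (S.bd.card : ℤ)

/-- `H_{ℓ-1} = (V, E[X_{ℓ-1}])`. -/
def H (I : Phase V) : SimpleGraph V := edgesWithin I.G I.X

/-- `G_ℓ = (V, E(G) \ E(H_{ℓ-1}))`. -/
def Gℓ (I : Phase V) : SimpleGraph V := I.G \ I.H

/-- The requirement function `h_ℓ` of the phase. -/
noncomputable def h (I : Phase V) (S : Biset V) : ℤ :=
  max 0 (I.f I.ℓ S - ((S.cut I.H).card : ℤ))

/-- `Y` covers `h_ℓ`: the graph `(V, E_{G_ℓ}[Y])` is a feasible cover of `h_ℓ`. -/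
def Covers (I : Phase V) (Y : Finset V) : Prop :=
  Biset.IsCover I.family I.h (edgesWithin I.Gℓ Y)

/-- What it means that `I` is a phase of the augmentation framework: `X_{ℓ-1}` contains the
terminals, `H_{ℓ-1}` covers `f_{ℓ-1}`, and the covering problem of the phase has a solution. -/
structure Valid (I : Phase V) : Prop where
  one_le : 1 ≤ I.ℓ
  terminals : ∀ u, I.IsTerminal u → u ∈ I.X
  covers_prev : Biset.IsCover I.family (I.f (I.ℓ - 1)) I.H
  feasible : I.Covers univ

/-- The node weights in the phase: the nodes of `X_{ℓ-1}` have already been paid for. -/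
def wt (I : Phase V) (v : V) : ℝ := if v ∈ I.X then 0 else I.w v

/-- The weight of a set of nodes in the phase. -/
def weight (I : Phase V) (Y : Finset V) : ℝ := ∑ v ∈ Y, I.wt v

/-- `x` is a feasible solution of the LP relaxation
`min ∑ w(v) x(v)` subject to `∑_{v ∈ Γ(S)} x(v) ≥ h_ℓ(S)` for `S ∈ 𝓑_elem`, `x ≥ 0`,
for the graph `G_ℓ`. -/
def LPFeasible (I : Phase V) (x : V → ℝ) : Prop :=
  (∀ v, 0 ≤ x v) ∧ ∀ S ∈ I.family, (I.h S : ℝ) ≤ ∑ v ∈ S.nbr I.Gℓ, x v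

/-- The objective function of the LP relaxation. -/
def lpValue (I : Phase V) (x : V → ℝ) : ℝ := ∑ v, I.wt v * x v

/-! ### The primal-dual algorithm with reverse delete -/

/-- The minimal violated bisets of `h_ℓ` with respect to `(V, E_{G_ℓ}[Y])`. -/
noncomputable def violatedBisets (I : Phase V) (Y : Finset V) : Finset (Biset V) :=
  Biset.minViolated I.family I.h (edgesWithin I.Gℓ Y)

open scoped Classical in
/-- The left-hand side `∑_{S ∈ 𝓑_elem : v ∈ Γ(S)} y(S)` of the constraint of `v` in the dual LP. -/
noncomputable def load (I : Phase V) (y : Biset V → ℝ) (v : V) : ℝ :=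
  ∑ S ∈ univ.filter (fun S : Biset V => S ∈ I.family ∧ v ∈ S.nbr I.Gℓ), y S

/-- A state of the first stage: the nodes added so far, most recent first, and the dual
variables. -/
structure State (V : Type*) where
  added : List V
  y : Biset V → ℝ

/-- The set `P` of all nodes selected so far, when the algorithm starts from `P₀`. -/
def State.P (P₀ : Finset V) (s : State V) : Finset V := P₀ ∪ s.added.toFinset

/-- The state before the first iteration. -/
def State.init : State V := ⟨[], fun _ => 0⟩

open scoped Classical in
/-- One iteration of the first stage. The dual variables of all minimal violated bisets are
increased by the same amount `ε`, until the dual constraint of some node `v` becomes tight (all dual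
constraints being still satisfied); then `v` is selected. Ties may be broken in any way. -/
def Step (I : Phase V) (P₀ : Finset V) (s s' : State V) : Prop :=
  ∃ ε : ℝ, ∃ v : V, 0 ≤ ε ∧
    (v ∉ s.P P₀ ∧ ∃ C ∈ I.violatedBisets (s.P P₀), v ∈ C.nbr I.Gℓ) ∧
    (s'.y = fun S => if S ∈ I.violatedBisets (s.P P₀) then s.y S + ε else s.y S) ∧
    (∀ u, I.load s'.y u ≤ I.wt u) ∧
    I.load s'.y v = I.wt v ∧
    s'.added = v :: s.added

/-- The states that the first stage can reach from `P₀`. -/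
def Reachable (I : Phase V) (P₀ : Finset V) (s : State V) : Prop :=
  Relation.ReflTransGen (I.Step P₀) State.init s

open scoped Classical in
/-- Reverse delete: go through the list and delete each node whose deletion leaves no violated
biset. -/
noncomputable def reverseDelete (I : Phase V) : List V → Finset V → Finset V
  | [], Q => Q
  | v :: L, Q =>
      reverseDelete I L (if I.violatedBisets (Q.erase v) = ∅ then Q.erase v else Q)

/-- `Q` is an output of the primal-dual algorithm started from `P₀`: the first stage arrives at a
state without violated bisets, and the second stage treats the added nodes in the reverse of the
order in which they were added. -/
def IsOutput (I : Phase V) (P₀ Q : Finset V) : Prop :=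
  ∃ s : State V, I.Reachable P₀ s ∧ I.violatedBisets (s.P P₀) = ∅ ∧
    Q = I.reverseDelete s.added (s.P P₀)

open scoped Classical in
/-- The nodes of weight zero (in the phase). -/
noncomputable def zeroSet (I : Phase V) : Finset V := univ.filter fun v => I.wt v = 0

end Phase

/-! ### A machine model with a step count

A random access machine whose memory consists of arrays of natural numbers and arrays of real
numbers. Array names are fixed in the program; the two indices of an entry are computed. Natural
numbers can be added, subtracted and compared. Real numbers can be added, subtracted, compared and
divided by natural numbers; in particular no information about a real number is available except
through comparisons. There is no multiplication, so that the numbers have polynomially many bits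
after polynomially many steps if the real inputs are rational. -/

namespace RAM

structure Store where
  nat : ℕ → ℕ → ℕ → ℕ
  real : ℕ → ℕ → ℕ → ℝ

/-- Write `x` at entry `(i, j)` of the array `a`. -/
def write {α : Type*} (m : ℕ → ℕ → ℕ → α) (a i j : ℕ) (x : α) : ℕ → ℕ → ℕ → α :=
  fun a' i' j' => if a' = a ∧ i' = i ∧ j' = j then x else m a' i' j'

inductive NExp where
  | const (k : ℕ)
  | get (a : ℕ) (i j : NExp)
  | plus (e₁ e₂ : NExp)
  | minus (e₁ e₂ : NExp)

/-- Subtraction is truncated at `0`. -/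
def NExp.eval (s : Store) : NExp → ℕ
  | .const k => k
  | .get a i j => s.nat a (i.eval s) (j.eval s)
  | .plus e₁ e₂ => e₁.eval s + e₂.eval s
  | .minus e₁ e₂ => e₁.eval s - e₂.eval s

inductive RExp where
  | zero
  | get (a : ℕ) (i j : NExp)
  | plus (e₁ e₂ : RExp)
  | minus (e₁ e₂ : RExp)
  | divNat (e : RExp) (k : NExp)

noncomputable def RExp.eval (s : Store) : RExp → ℝ
  | .zero => 0
  | .get a i j => s.real a (i.eval s) (j.eval s)
  | .plus e₁ e₂ => e₁.eval s + e₂.eval s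
  | .minus e₁ e₂ => e₁.eval s - e₂.eval s
  | .divNat e k => e.eval s / ((k.eval s : ℕ) : ℝ)

inductive Test where
  | natLe (e₁ e₂ : NExp)
  | realLe (e₁ e₂ : RExp)
  | neg (b : Test)
  | conj (b₁ b₂ : Test)

def Test.holds (s : Store) : Test → Prop
  | .natLe e₁ e₂ => e₁.eval s ≤ e₂.eval s
  | .realLe e₁ e₂ => e₁.eval s ≤ e₂.eval s
  | .neg b => ¬ b.holds s
  | .conj b₁ b₂ => b₁.holds s ∧ b₂.holds s

inductive Program where
  | skip
  | setNat (a : ℕ) (i j e : NExp)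
  | setReal (a : ℕ) (i j : NExp) (e : RExp)
  | seq (c₁ c₂ : Program)
  | branch (b : Test) (c₁ c₂ : Program)
  | loop (b : Test) (c : Program)

/-- `Run c s s' t`: started with memory `s`, the program `c` halts with memory `s'` after `t` steps.
Every assignment and every test is one step (the expressions in a program have constant size). -/
inductive Run : Program → Store → Store → ℕ → Prop
  | skip (s : Store) : Run .skip s s 1
  | setNat (a : ℕ) (i j e : NExp) (s : Store) :
      Run (.setNat a i j e) s ⟨write s.nat a (i.eval s) (j.eval s) (e.eval s), s.real⟩ 1
  | setReal (a : ℕ) (i j : NExp) (e : RExp) (s : Store) :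
      Run (.setReal a i j e) s ⟨s.nat, write s.real a (i.eval s) (j.eval s) (e.eval s)⟩ 1
  | seq {c₁ c₂ : Program} {s₁ s₂ s₃ : Store} {t₁ t₂ : ℕ} :
      Run c₁ s₁ s₂ t₁ → Run c₂ s₂ s₃ t₂ → Run (.seq c₁ c₂) s₁ s₃ (t₁ + t₂)
  | branchTrue {b : Test} {c₁ c₂ : Program} {s s' : Store} {t : ℕ} :
      b.holds s → Run c₁ s s' t → Run (.branch b c₁ c₂) s s' (t + 1)
  | branchFalse {b : Test} {c₁ c₂ : Program} {s s' : Store} {t : ℕ} :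
      ¬ b.holds s → Run c₂ s s' t → Run (.branch b c₁ c₂) s s' (t + 1)
  | loopTrue {b : Test} {c : Program} {s₁ s₂ s₃ : Store} {t₁ t₂ : ℕ} :
      b.holds s₁ → Run c s₁ s₂ t₁ → Run (.loop b c) s₂ s₃ t₂ →
      Run (.loop b c) s₁ s₃ (t₁ + t₂ + 1)
  | loopFalse {b : Test} {c : Program} {s : Store} :
      ¬ b.holds s → Run (.loop b c) s s 1

open scoped Classical in
/-- The table of a function on pairs of nodes, continued by `0`. -/
noncomputable def table {α : Type*} [Zero α] {n : ℕ} (g : Fin n → Fin n → α) (i j : ℕ) : α :=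
  if h : i < n ∧ j < n then g ⟨i, h.1⟩ ⟨j, h.2⟩ else 0

open scoped Classical in
/-- The list of the values of a function on nodes, as column `0` of an array. -/
noncomputable def column {α : Type*} [Zero α] {n : ℕ} (g : Fin n → α) (i j : ℕ) : α :=
  if h : i < n ∧ j = 0 then g ⟨i, h.1⟩ else 0

open scoped Classical in
/-- The memory at the start. Arrays of natural numbers: `0` holds `n` and `ℓ`, `1` the adjacency
matrix of the graph, `2` the reliable nodes, `3` the requirements, `4` the nodes of `X_{ℓ-1}`.
Array `0` of real numbers: the weights. Everything else is `0`. -/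
noncomputable def input {n : ℕ} (I : Phase (Fin n)) : Store where
  nat a := match a with
    | 0 => fun i j => if i = 0 ∧ j = 0 then n else if i = 0 ∧ j = 1 then I.ℓ else 0
    | 1 => table fun u v => if I.G.Adj u v then 1 else 0
    | 2 => column fun u => if u ∈ I.R then 1 else 0
    | 3 => table I.r
    | 4 => column fun u => if u ∈ I.X then 1 else 0
    | _ => fun _ _ => 0
  real a := match a with
    | 0 => column I.w
    | _ => fun _ _ => 0

/-- The set of nodes that is read off from the memory at the end: array `5` of natural numbers. -/
def output (n : ℕ) (s : Store) : Finset (Fin n) := univ.filter fun v => s.nat 5 (v : ℕ) 0 = 1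

end RAM

set_option linter.unusedSectionVars false

/-! ### Counting functions of bisets -/

namespace Biset

variable {V : Type*}

/-! Uncrossing. For X ⊆ Y put g(S) = |bd S| + |δ(S)|, the cut being taken in G[Y]. Because the
previous phase covers f_{ℓ-1}, every biset of the family with requirement at least ℓ has g(S) ≥ ℓ-1
(`Valid.le_card`), and the violated bisets are exactly those that attain ℓ-1 (`isViolated_iff`). The
function g is submodular for intersection and union, and the analogous inequality holds for the two
differences. As no reliable node lies on a boundary, two separated demand pairs always supply
requirement ℓ to both bisets of one of these two corner pairs (`rElem_uncross`). So violated bisets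
uncross in the way minimisers do (`Deficient.uncross`), and h_ℓ is biuncrossable with values in
{0,1}.

Approximation. Added nodes have tight dual constraints, and weak duality bounds the sum of y by the
LP value. It therefore suffices that in each iteration, with P the selected set, 𝒞 the minimal
violated bisets and B the part of the output outside P, the sum of |Γ(C) ∩ B| over C in 𝒞 is at most
c|𝒞| (`Chargeable`, `sum_y_le`). Reverse delete makes B an inclusion-minimal completion of P in
every iteration (`reverseDelete_spec`). The inner parts of the members of 𝒞 are disjoint and
connected, so contracting them exhibits the incidence graph between 𝒞 and the nodes of B next to it
as a minor of G. Graphs without a K_t minor have linearly many edges (`exists_card_adjPairs_le`),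
which leaves the number of these nodes to be bounded by 4|𝒞| (`card_boundaryNodes_le`). Each node of
B has a witness, a biset that only this node saves from being violated. Witnesses of minimum total
size are laminar (`Completion.laminar`), and so are the sets of members of 𝒞 below them. A laminar
family on 𝒞 has at most 2|𝒞| members, and each member arises from at most two of the nodes
(`not_between`).

Polynomial time. Splitting every node into an entry and an exit turns bisets into cuts of a network:
cuts of capacity below ℓ are the bisets of the family with g < ℓ. The least minimum cut that
separates a demand pair u, v is the smallest deficient biset for that pair, and every minimal
violated biset is the smallest one for each u of a demand pair it separates
(`IsSmallest.candidates`). Hence n² flow computations find 𝒞. The programs are written in a language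
with bounded loops whose semantics is a total function, so that running time and correctness are
separate matters (`run_compile`, `exec_forTo`). -/

theorem le_iff {S T : Biset V} : S ≤ T ↔ S.inner ⊆ T.inner ∧ S.outer ⊆ T.outer := Iff.rfl

theorem mem_cases (S : Biset V) (v : V) :
    (v ∈ S.inner ∧ v ∈ S.outer) ∨ (v ∉ S.inner ∧ v ∈ S.outer) ∨ (v ∉ S.inner ∧ v ∉ S.outer) := by
  have := @S.sub v
  tauto

variable [DecidableEq V]

theorem mem_bd {S : Biset V} {v : V} : v ∈ S.bd ↔ v ∈ S.outer ∧ v ∉ S.inner := mem_sdiff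

/-- Remove a node from both parts of a biset. -/
def erase (S : Biset V) (u : V) : Biset V :=
  ⟨S.inner.erase u, S.outer.erase u, Finset.erase_subset_erase u S.sub⟩

theorem erase_le (S : Biset V) (u : V) : S.erase u ≤ S :=
  ⟨Finset.erase_subset _ _, Finset.erase_subset _ _⟩

variable [Fintype V]

theorem mem_cut {F : SimpleGraph V} {S : Biset V} {e : V × V} :
    e ∈ S.cut F ↔ e.1 ∈ S.inner ∧ e.2 ∉ S.outer ∧ F.Adj e.1 e.2 := by
  simp [cut]

theorem mem_nbr {F : SimpleGraph V} {S : Biset V} {v : V} :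
    v ∈ S.nbr F ↔ v ∉ S.outer ∧ ∃ u ∈ S.inner, F.Adj u v := by
  simp [nbr]

theorem cut_mono {F F' : SimpleGraph V} (h : F ≤ F') (S : Biset V) : S.cut F ⊆ S.cut F' := by
  intro e he
  rw [mem_cut] at he ⊢
  exact ⟨he.1, he.2.1, h he.2.2⟩

theorem card_bd_eq (S : Biset V) :
    #S.bd = ∑ v : V, if v ∈ S.outer ∧ v ∉ S.inner then 1 else 0 := by
  rw [← card_filter]
  congr 1
  ext v
  simp [mem_bd]

open scoped Classical in
theorem card_cut_eq (F : SimpleGraph V) (S : Biset V) :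
    #(S.cut F) = ∑ e : V × V, if e.1 ∈ S.inner ∧ e.2 ∉ S.outer ∧ F.Adj e.1 e.2 then 1 else 0 := by
  rw [← card_filter]
  congr 1

/-- The inequality holds for the contribution of each single node, whatever its position (inner,
boundary, outside) in the two bisets. The boundary and cut inequalities below follow the same
pattern. -/
theorem card_bd_inter_union (S T : Biset V) :
    #(S.inter T).bd + #(S.union T).bd ≤ #S.bd + #T.bd := by
  simp only [card_bd_eq, ← sum_add_distrib]
  refine sum_le_sum fun v _ => ?_
  have h1 := @S.sub v
  have h2 := @T.sub v
  simp only [inter, union, Finset.mem_inter, Finset.mem_union]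
  by_cases a : v ∈ S.inner <;> by_cases b : v ∈ T.inner <;> by_cases c : v ∈ S.outer <;>
    by_cases d : v ∈ T.outer <;> simp_all

theorem card_bd_diff (S T : Biset V) :
    #(S.diff T).bd + #(T.diff S).bd ≤ #S.bd + #T.bd := by
  simp only [card_bd_eq, ← sum_add_distrib]
  refine sum_le_sum fun v _ => ?_
  have h1 := @S.sub v
  have h2 := @T.sub v
  simp only [diff, Finset.mem_sdiff]
  by_cases a : v ∈ S.inner <;> by_cases b : v ∈ T.inner <;> by_cases c : v ∈ S.outer <;>
    by_cases d : v ∈ T.outer <;> simp_all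

theorem card_cut_inter_union (F : SimpleGraph V) (S T : Biset V) :
    #((S.inter T).cut F) + #((S.union T).cut F) ≤ #(S.cut F) + #(T.cut F) := by
  simp only [card_cut_eq, ← sum_add_distrib]
  refine sum_le_sum fun e _ => ?_
  have h1 := @S.sub e.1
  have h2 := @T.sub e.1
  have h3 := @S.sub e.2
  have h4 := @T.sub e.2
  simp only [inter, union, Finset.mem_inter, Finset.mem_union]
  by_cases hF : F.Adj e.1 e.2
  · by_cases a : e.1 ∈ S.inner <;> by_cases b : e.1 ∈ T.inner <;> by_cases c : e.2 ∈ S.outer <;>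
      by_cases d : e.2 ∈ T.outer <;> simp_all
  · simp [hF]

open scoped Classical in
-- An edge leaving `S.diff T` may enter `T`, that is, it may leave `T` only when read backwards. The
-- inequality for differences is thus false for a single ordered pair and becomes pointwise once
-- both orientations are summed.
theorem two_mul_card_cut_eq (F : SimpleGraph V) (S : Biset V) :
    2 * #(S.cut F) = ∑ e : V × V,
      ((if e.1 ∈ S.inner ∧ e.2 ∉ S.outer ∧ F.Adj e.1 e.2 then 1 else 0) +
       (if e.2 ∈ S.inner ∧ e.1 ∉ S.outer ∧ F.Adj e.1 e.2 then 1 else 0)) := by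
  rw [sum_add_distrib, two_mul]
  congr 1
  · exact card_cut_eq F S
  · rw [card_cut_eq]
    refine (Fintype.sum_equiv (Equiv.prodComm V V) _ _ fun e => ?_)
    simp [F.adj_comm]

theorem card_cut_diff (F : SimpleGraph V) (S T : Biset V) :
    #((S.diff T).cut F) + #((T.diff S).cut F) ≤ #(S.cut F) + #(T.cut F) := by
  suffices 2 * #((S.diff T).cut F) + 2 * #((T.diff S).cut F) ≤ 2 * #(S.cut F) + 2 * #(T.cut F) by
    omega
  simp only [two_mul_card_cut_eq, ← sum_add_distrib]
  refine sum_le_sum fun e _ => ?_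
  simp only [diff, Finset.mem_sdiff]
  by_cases hF : F.Adj e.1 e.2
  · rcases S.mem_cases e.1 with ⟨a, a'⟩ | ⟨a, a'⟩ | ⟨a, a'⟩ <;>
      rcases S.mem_cases e.2 with ⟨b, b'⟩ | ⟨b, b'⟩ | ⟨b, b'⟩ <;>
      rcases T.mem_cases e.1 with ⟨c, c'⟩ | ⟨c, c'⟩ | ⟨c, c'⟩ <;>
      rcases T.mem_cases e.2 with ⟨d, d'⟩ | ⟨d, d'⟩ | ⟨d, d'⟩ <;>
      simp [a, a', b, b', c, c', d, d', hF]
  · simp [hF]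

end Biset

theorem edgesWithin_mono {V : Type*} (F : SimpleGraph V) {Y Y' : Finset V} (h : Y ⊆ Y') :
    edgesWithin F Y ≤ edgesWithin F Y' :=
  fun _ _ ha => ⟨ha.1, h ha.2.1, h ha.2.2⟩

/-! ### Deficient bisets -/

namespace Phase

variable {V : Type*} [Fintype V] [DecidableEq V] {I : Phase V} {X Y Y' : Finset V} {S T : Biset V}

theorem mem_family : S ∈ I.family ↔ ∀ v ∈ S.outer, v ∉ S.inner → v ∉ I.R := by
  simp only [family, Set.mem_ofPred_eq, Finset.disjoint_left, Biset.mem_bd]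
  tauto

theorem family_isCrossing (I : Phase V) : Biset.IsCrossing I.family := by
  intro S hS T hT
  rw [mem_family] at hS hT
  have h1 := S.sub
  have h2 := T.sub
  refine ⟨?_, ?_, ?_, ?_⟩ <;> rw [mem_family] <;> intro v <;> have := @h1 v <;> have := @h2 v <;>
    have := hS v <;> have := hT v <;>
    simp only [Biset.inter, Biset.union, Biset.diff, mem_inter, mem_union, mem_sdiff] <;> tauto

theorem le_rElem_iff {m : ℕ} (hm : 1 ≤ m) :
    m ≤ I.rElem S ↔ ∃ u ∈ S.inner, ∃ v, v ∉ S.outer ∧ m ≤ I.r u v := by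
  rw [rElem, Finset.le_sup_iff (by simpa using Nat.lt_of_lt_of_le Nat.zero_lt_one hm)]
  simp only [mem_product, mem_compl, Prod.exists]
  grind

/-- The bisets that need another edge when the nodes of `Y` are selected. -/
def Deficient (I : Phase V) (Y : Finset V) (S : Biset V) : Prop :=
  S ∈ I.family ∧ I.ℓ ≤ I.rElem S ∧ #S.bd + #(S.cut (edgesWithin I.G Y)) < I.ℓ

theorem Deficient.anti (h : Y ⊆ Y') (hS : I.Deficient Y' S) : I.Deficient Y S :=
  ⟨hS.1, hS.2.1, by
    have := card_le_card (S.cut_mono (edgesWithin_mono I.G h))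
    have := hS.2.2
    omega⟩

theorem Deficient.exists_pair (hI : I.Valid) (hS : I.Deficient Y S) :
    ∃ u ∈ S.inner, ∃ v, v ∉ S.outer ∧ I.ℓ ≤ I.r u v :=
  (le_rElem_iff hI.one_le).1 hS.2.1

theorem Valid.mem_R (hI : I.Valid) {u v : V} (h : I.ℓ ≤ I.r u v) : u ∈ I.R ∧ v ∈ I.R :=
  I.r_reliable u v (by have := hI.one_le; omega)

theorem Valid.mem_X (hI : I.Valid) {u v : V} (h : I.ℓ ≤ I.r u v) (huv : u ≠ v) :
    u ∈ I.X ∧ v ∈ I.X := by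
  have := hI.one_le
  exact ⟨hI.terminals u ⟨v, huv.symm, by omega⟩, hI.terminals v ⟨u, huv, by
    rw [I.r_symm]; omega⟩⟩

/-- Coverage of f_{ℓ-1} leaves at most one unit missing. A deficient biset therefore has value
exactly ℓ-1, the least possible. -/
theorem Valid.le_card (hI : I.Valid) (hX : I.X ⊆ Y) (hS : S ∈ I.family) (hr : I.ℓ ≤ I.rElem S) :
    I.ℓ ≤ #S.bd + #(S.cut (edgesWithin I.G Y)) + 1 := by
  have h1 := hI.covers_prev S hS
  have h2 : #(S.cut I.H) ≤ #(S.cut (edgesWithin I.G Y)) :=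
    card_le_card (S.cut_mono (edgesWithin_mono I.G hX))
  rw [f, min_eq_left (by omega)] at h1
  omega

theorem cut_card_add (hX : I.X ⊆ Y) (S : Biset V) :
    #(S.cut I.H) + #(S.cut (edgesWithin I.Gℓ Y)) = #(S.cut (edgesWithin I.G Y)) := by
  rw [← card_union_of_disjoint]
  · congr 1
    ext e
    have h1 := @hX e.1
    have h2 := @hX e.2
    simp only [mem_union, Biset.mem_cut, edgesWithin, H, Gℓ, SimpleGraph.sdiff_adj]
    tauto
  · rw [Finset.disjoint_left]
    intro e
    simp only [Biset.mem_cut, edgesWithin, H, Gℓ, SimpleGraph.sdiff_adj]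
    tauto

theorem isViolated_iff (hI : I.Valid) (hX : I.X ⊆ Y) :
    Biset.IsViolated I.family I.h (edgesWithin I.Gℓ Y) S ↔ I.Deficient Y S := by
  have hadd := cut_card_add hX S
  constructor
  · rintro ⟨hS, hv⟩
    have h1 := hI.covers_prev S hS
    have hl := hI.one_le
    unfold h f at *
    -- With a smaller requirement, truncating it at ℓ or at ℓ-1 gives the same number, and `I.H`
    -- already covers the biset.
    have : I.ℓ ≤ I.rElem S := by
      by_contra hr
      rw [min_eq_right (by omega)] at h1 hv
      omega
    refine ⟨hS, this, ?_⟩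
    rw [min_eq_left this] at hv
    omega
  · rintro ⟨hS, hr, hd⟩
    refine ⟨hS, ?_⟩
    unfold h f
    rw [min_eq_left hr]
    omega

theorem h_le_one (hI : I.Valid) (hS : S ∈ I.family) : I.h S ≤ 1 := by
  have h1 := hI.covers_prev S hS
  have hl := hI.one_le
  unfold h f at *
  omega

theorem h_nonneg : 0 ≤ I.h S := le_max_left _ _

theorem cut_Gℓ_X (I : Phase V) (S : Biset V) : S.cut (edgesWithin I.Gℓ I.X) = ∅ := by
  rw [Finset.eq_empty_iff_forall_notMem]
  intro e
  simp only [Biset.mem_cut, edgesWithin, H, Gℓ, SimpleGraph.sdiff_adj]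
  tauto

theorem h_pos_iff (hI : I.Valid) (hS : S ∈ I.family) : 0 < I.h S ↔ I.Deficient I.X S := by
  rw [← isViolated_iff hI subset_rfl, Biset.IsViolated, cut_Gℓ_X]
  simp [hS]

theorem h_eq_one (hI : I.Valid) (hS : I.Deficient I.X S) : I.h S = 1 := by
  have := (h_pos_iff hI hS.1).2 hS
  have := h_le_one hI hS.1
  omega

/-- The ends of a pair with positive requirement are reliable, hence never on a boundary: each is
inside or outside of each biset. Of the sixteen placements of the two pairs, every one lets the
pairs, reversed if necessary, be separated by intersection and union or by the two differences. -/
theorem rElem_uncross (hI : I.Valid) (hS : S ∈ I.family) (hT : T ∈ I.family)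
    (hSr : I.ℓ ≤ I.rElem S) (hTr : I.ℓ ≤ I.rElem T) :
    (I.ℓ ≤ I.rElem (S.inter T) ∧ I.ℓ ≤ I.rElem (S.union T)) ∨
    (I.ℓ ≤ I.rElem (S.diff T) ∧ I.ℓ ≤ I.rElem (T.diff S)) := by
  simp only [le_rElem_iff hI.one_le] at *
  obtain ⟨s, hs, s', hs', hr⟩ := hSr
  obtain ⟨t, ht, t', ht', hr'⟩ := hTr
  rw [mem_family] at hS hT
  have R1 := hI.mem_R hr
  have R2 := hI.mem_R hr'
  have key : ∀ (S : Biset V), (∀ v ∈ S.outer, v ∉ S.inner → v ∉ I.R) → ∀ v ∈ I.R,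
      (v ∈ S.inner ∧ v ∈ S.outer) ∨ (v ∉ S.inner ∧ v ∉ S.outer) := by
    intro S hS v hv
    have h1 := hS v
    have h2 := @S.sub v
    tauto
  have hs2 := S.sub hs
  have hs2' : s' ∉ S.inner := fun h => hs' (S.sub h)
  have ht2 := T.sub ht
  have ht2' : t' ∉ T.inner := fun h => ht' (T.sub h)
  have hr2 := hr
  have hr2' := hr'
  rw [I.r_symm] at hr2 hr2'
  simp only [Biset.inter, Biset.union, Biset.diff, mem_inter, mem_union, mem_sdiff]
  rcases key T hT s R1.1 with ⟨a, a'⟩ | ⟨a, a'⟩ <;> rcases key T hT s' R1.2 with ⟨b, b'⟩ | ⟨b, b'⟩ <;>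
    rcases key S hS t R2.1 with ⟨c, c'⟩ | ⟨c, c'⟩ <;>
    rcases key S hS t' R2.2 with ⟨d, d'⟩ | ⟨d, d'⟩
  all_goals
    first
    | (left; constructor <;>
         first
         | (refine ⟨s, ?_, s', ?_, hr⟩ <;> simp [*] <;> done)
         | (refine ⟨t, ?_, t', ?_, hr'⟩ <;> simp [*] <;> done))
    | (right; constructor <;>
         first
         | (refine ⟨s, ?_, s', ?_, hr⟩ <;> simp [*] <;> done)
         | (refine ⟨t', ?_, t, ?_, hr2'⟩ <;> simp [*] <;> done)
         | (refine ⟨s', ?_, s, ?_, hr2⟩ <;> simp [*] <;> done)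
         | (refine ⟨t, ?_, t', ?_, hr'⟩ <;> simp [*]))

/-- Both corner bisets have value at least ℓ-1, while their sum is at most that of two minimisers,
2(ℓ-1). So both attain ℓ-1. -/
theorem Deficient.uncross (hI : I.Valid) (hX : I.X ⊆ Y)
    (hS : I.Deficient Y S) (hT : I.Deficient Y T) :
    (I.Deficient Y (S.inter T) ∧ I.Deficient Y (S.union T)) ∨
    (I.Deficient Y (S.diff T) ∧ I.Deficient Y (T.diff S)) := by
  obtain ⟨f1, f2, f3, f4⟩ := family_isCrossing I S hS.1 T hT.1
  have h1 := Biset.card_bd_inter_union S T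
  have h2 := Biset.card_bd_diff S T
  have h3 := Biset.card_cut_inter_union (edgesWithin I.G Y) S T
  have h4 := Biset.card_cut_diff (edgesWithin I.G Y) S T
  have h5 := hS.2.2
  have h6 := hT.2.2
  rcases rElem_uncross hI hS.1 hT.1 hS.2.1 hT.2.1 with ⟨r1, r2⟩ | ⟨r1, r2⟩
  · have := hI.le_card hX f1 r2
    have := hI.le_card hX f2 r1
    exact Or.inl ⟨⟨f2, r1, by omega⟩, ⟨f1, r2, by omega⟩⟩
  · have := hI.le_card hX f3 r1
    have := hI.le_card hX f4 r2
    exact Or.inr ⟨⟨f3, r1, by omega⟩, ⟨f4, r2, by omega⟩⟩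

theorem h_isBiuncrossable (hI : I.Valid) : Biset.IsBiuncrossable I.family I.h := by
  intro S hS T hT hS0 hT0
  rw [h_pos_iff hI hS] at hS0
  rw [h_pos_iff hI hT] at hT0
  rcases hS0.uncross hI subset_rfl hT0 with ⟨a, b⟩ | ⟨a, b⟩
  · left
    rw [h_eq_one hI a, h_eq_one hI b, h_eq_one hI hS0, h_eq_one hI hT0]
  · right
    rw [h_eq_one hI a, h_eq_one hI b, h_eq_one hI hS0, h_eq_one hI hT0]

/-! ### Erasing unselected nodes from deficient bisets -/

theorem erase_family (hS : S ∈ I.family) (u : V) : S.erase u ∈ I.family := by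
  rw [mem_family] at *
  intro v
  simp only [Biset.erase, mem_erase]
  have := hS v
  tauto

theorem erase_rElem (hI : I.Valid) (hr : I.ℓ ≤ I.rElem S) {u : V} (hu : u ∉ I.X) :
    I.ℓ ≤ I.rElem (S.erase u) := by
  rw [le_rElem_iff hI.one_le] at *
  obtain ⟨s, hs, s', hs', hr⟩ := hr
  have hne : s ≠ s' := by rintro rfl; exact hs' (S.sub hs)
  obtain ⟨h1, h2⟩ := hI.mem_X hr hne
  refine ⟨s, ?_, s', ?_, hr⟩ <;> simp only [Biset.erase, mem_erase]
  · exact ⟨by rintro rfl; exact hu h1, hs⟩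
  · tauto

theorem erase_cut {u : V} (hu : u ∉ Y) :
    (S.erase u).cut (edgesWithin I.G Y) ⊆ S.cut (edgesWithin I.G Y) := by
  intro e
  simp only [Biset.mem_cut, Biset.erase, mem_erase, edgesWithin]
  rintro ⟨h1, h2, h3⟩
  refine ⟨h1.2, fun h => h2 ⟨?_, h⟩, h3⟩
  rintro rfl
  exact hu h3.2.2

theorem erase_bd (u : V) : (S.erase u).bd ⊆ S.bd := by
  intro v
  simp only [Biset.mem_bd, Biset.erase, mem_erase]
  tauto

/-- A node outside Y is no terminal and meets no edge of G[Y]. Removing it keeps the separated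
demand pair and increases neither boundary nor cut. -/
theorem Deficient.erase (hI : I.Valid) (hX : I.X ⊆ Y) (hS : I.Deficient Y S) {u : V}
    (hu : u ∉ Y) : I.Deficient Y (S.erase u) := by
  refine ⟨erase_family hS.1 u, erase_rElem hI hS.2.1 (fun h => hu (hX h)), ?_⟩
  have h1 := card_le_card (erase_cut (S := S) (I := I) hu)
  have h2 := card_le_card (erase_bd (S := S) u)
  have := hS.2.2
  omega

/-- Erasing a boundary node outside X would lower the value to ℓ-2, below the minimum. -/
theorem Deficient.bd_subset (hI : I.Valid) (hX : I.X ⊆ Y) (hS : I.Deficient Y S) :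
    S.bd ⊆ I.X := by
  intro u hu
  by_contra hux
  have hS := hS.anti hX
  have h1 := card_le_card (erase_cut (S := S) (I := I) hux)
  have h2 : #(S.erase u).bd < #S.bd := by
    refine card_lt_card ⟨erase_bd u, fun h => ?_⟩
    have := h hu
    simp [Biset.mem_bd, Biset.erase] at this
  have h3 := hI.le_card subset_rfl (erase_family hS.1 u) (erase_rElem hI hS.2.1 hux)
  have := hS.2.2
  omega

theorem Deficient.inner_nonempty (hI : I.Valid) (hS : I.Deficient Y S) : S.inner.Nonempty := by
  obtain ⟨u, hu, -⟩ := hS.exists_pair hI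
  exact ⟨u, hu⟩

theorem mem_violatedBisets (hI : I.Valid) (hX : I.X ⊆ Y) :
    S ∈ I.violatedBisets Y ↔ Minimal (I.Deficient Y) S := by
  have : Biset.IsViolated I.family I.h (edgesWithin I.Gℓ Y) = I.Deficient Y := by
    ext S
    exact isViolated_iff hI hX
  simp only [violatedBisets, Biset.minViolated, mem_filter, this, mem_univ, true_and]

theorem Deficient.exists_minimal (hI : I.Valid) (hX : I.X ⊆ Y) (hS : I.Deficient Y S) :
    ∃ C ∈ I.violatedBisets Y, C ≤ S := by
  obtain ⟨C, h1, h2⟩ := (Set.toFinite {T | I.Deficient Y T}).exists_le_minimal hS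
  exact ⟨C, (mem_violatedBisets hI hX).2 h2, h1⟩

theorem violatedBisets_eq_empty_iff (hI : I.Valid) (hX : I.X ⊆ Y) :
    I.violatedBisets Y = ∅ ↔ ∀ S, ¬ I.Deficient Y S := by
  constructor
  · intro h S hS
    obtain ⟨C, hC, -⟩ := hS.exists_minimal hI hX
    simp [h] at hC
  · intro h
    rw [Finset.eq_empty_iff_forall_notMem]
    intro C hC
    exact h C ((mem_violatedBisets hI hX).1 hC).1

theorem covers_iff (hI : I.Valid) (hX : I.X ⊆ Y) : I.Covers Y ↔ ∀ S, ¬ I.Deficient Y S := by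
  constructor
  · intro h S hS
    have := ((isViolated_iff hI hX).2 hS).2
    have := h S hS.1
    omega
  · intro h S hS
    by_contra hlt
    exact h S ((isViolated_iff hI hX).1 ⟨hS, not_le.1 hlt⟩)

/-- The edges inside X alone bring the value to ℓ-1, so a single further edge between selected nodes
would satisfy the biset. -/
theorem Deficient.not_adj (hI : I.Valid) (hX : I.X ⊆ Y) (hS : I.Deficient Y S) {a b : V}
    (ha : a ∈ S.inner) (hb : b ∉ S.outer) (haY : a ∈ Y) (hbY : b ∈ Y) : ¬ I.Gℓ.Adj a b := by
  intro hab
  have h1 := hI.le_card subset_rfl hS.1 hS.2.1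
  have h2 := hS.2.2
  have h3 := cut_card_add hX S
  have : (a, b) ∈ S.cut (edgesWithin I.Gℓ Y) := by
    rw [Biset.mem_cut]
    exact ⟨ha, hb, hab, haY, hbY⟩
  have := card_pos.2 ⟨_, this⟩
  have : S.cut (edgesWithin I.G I.X) = S.cut I.H := rfl
  rw [this] at h1
  omega

theorem Covers.exists_adj (hI : I.Valid) (hc : I.Covers Y)
    (hS : I.Deficient I.X S) : ∃ a ∈ S.inner, ∃ b, b ∉ S.outer ∧ a ∈ Y ∧ b ∈ Y ∧ I.Gℓ.Adj a b := by
  have h1 := hc S hS.1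
  rw [h_eq_one hI hS] at h1
  have : 0 < #(S.cut (edgesWithin I.Gℓ Y)) := by omega
  obtain ⟨e, he⟩ := card_pos.1 this
  rw [Biset.mem_cut] at he
  exact ⟨e.1, he.1, e.2, he.2.1, he.2.2.2.1, he.2.2.2.2, he.2.2.1⟩

/-- A deficient biset that is crossed by no edge between selected nodes remains deficient. -/
theorem deficient_of_not_adj (hI : I.Valid) (hX : I.X ⊆ Y) (hS : I.Deficient I.X S)
    (h : ∀ a ∈ S.inner, ∀ b, b ∉ S.outer → a ∈ Y → b ∈ Y → ¬ I.Gℓ.Adj a b) :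
    I.Deficient Y S := by
  rw [← isViolated_iff hI hX]
  refine ⟨hS.1, ?_⟩
  rw [h_eq_one hI hS]
  have : S.cut (edgesWithin I.Gℓ Y) = ∅ := by
    rw [Finset.eq_empty_iff_forall_notMem]
    intro e he
    rw [Biset.mem_cut] at he
    exact h e.1 he.1 e.2 he.2.1 he.2.2.2.1 he.2.2.2.2 he.2.2.1
  simp [this]

end Phase

/-! ### Graphs without a complete minor are sparse -/

namespace IsMinor

theorem of_le {W V : Type*} {H H' : SimpleGraph W} {G : SimpleGraph V} (h : H ≤ H')
    (hm : IsMinor H' G) : IsMinor H G := by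
  obtain ⟨B, h1, h2, h3⟩ := hm
  exact ⟨B, h1, h2, fun a b hab => h3 a b (h hab)⟩

theorem of_iso {W W' V : Type*} {H : SimpleGraph W} {G : SimpleGraph V} (e : W' ≃ W)
    (hm : IsMinor H G) : IsMinor (H.comap e) G := by
  obtain ⟨B, h1, h2, h3⟩ := hm
  exact ⟨fun a => B (e a), fun a => h1 _, fun a b hab => h2 _ _ (e.injective.ne hab),
    fun a b hab => h3 _ _ hab⟩

/-- The node v is adjacent to its whole neighbourhood and serves as the additional branch set. -/
theorem succ_of_neighborSet {V : Type*} {t : ℕ} {G : SimpleGraph V} (v : V)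
    (hm : IsMinor (⊤ : SimpleGraph (Fin t)) (G.induce {x | G.Adj v x})) :
    IsMinor (⊤ : SimpleGraph (Fin (t + 1))) G := by
  obtain ⟨B, h1, h2, h3⟩ := hm
  refine ⟨Fin.cons {v} fun i => Subtype.val '' B i, fun a => ?_, ?_, ?_⟩
  · refine Fin.cases ?_ (fun i => ?_) a
    · rw [Fin.cons_zero]
      have : Nonempty ({v} : Set V) := ⟨⟨v, rfl⟩⟩
      refine ⟨fun x y => ?_⟩
      rw [Subsingleton.elim x y]
    · rw [Fin.cons_succ]
      let f : (G.induce {x | G.Adj v x}).induce (B i) →g G.induce (Subtype.val '' B i) :=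
        ⟨fun x => ⟨x.1.1, x.1, x.2, rfl⟩, fun h => h⟩
      refine (h1 i).map f ?_
      rintro ⟨_, x, hx, rfl⟩
      exact ⟨⟨x, hx⟩, rfl⟩
  · intro a b
    refine Fin.cases ?_ (fun i => ?_) a <;> refine Fin.cases ?_ (fun j => ?_) b
    · simp
    · intro _
      simp only [Fin.cons_zero, Fin.cons_succ, Set.disjoint_singleton_left]
      rintro ⟨x, -, hxv⟩
      exact G.ne_of_adj x.2 hxv.symm
    · intro _
      simp only [Fin.cons_zero, Fin.cons_succ, Set.disjoint_singleton_right]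
      rintro ⟨x, -, hxv⟩
      exact G.ne_of_adj x.2 hxv.symm
    · intro h
      simp only [Fin.cons_succ]
      exact (Set.disjoint_image_iff Subtype.val_injective).2 (h2 i j fun hij => h (by rw [hij]))
  · intro a b
    refine Fin.cases ?_ (fun i => ?_) a <;> refine Fin.cases ?_ (fun j => ?_) b
    · simp
    · intro _
      obtain ⟨⟨x, hx⟩⟩ := (h1 j).nonempty
      exact ⟨v, by simp, x.1, by rw [Fin.cons_succ]; exact ⟨x, hx, rfl⟩, x.2⟩
    · intro _
      obtain ⟨⟨x, hx⟩⟩ := (h1 i).nonempty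
      exact ⟨x.1, by rw [Fin.cons_succ]; exact ⟨x, hx, rfl⟩, v, by simp, G.symm.symm _ _ x.2⟩
    · intro h
      obtain ⟨x, hx, y, hy, hxy⟩ := h3 i j (by simpa using h)
      exact ⟨x.1, by rw [Fin.cons_succ]; exact ⟨x, hx, rfl⟩, y.1, by
        rw [Fin.cons_succ]; exact ⟨y, hy, rfl⟩, hxy⟩

end IsMinor

/-- Contract the pair `u, v` of nodes into `u`. -/
def contractPair {V : Type*} (G : SimpleGraph V) (u v : V) : SimpleGraph {x : V // x ≠ v} where
  Adj a b := a ≠ b ∧ (G.Adj a b ∨ (a.1 = u ∧ G.Adj v b) ∨ (b.1 = u ∧ G.Adj v a))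
  symm := ⟨fun _ _ h => ⟨h.1.symm, by rw [G.adj_comm]; tauto⟩⟩
  loopless := ⟨fun _ h => h.1 rfl⟩

open scoped Classical in
-- Branch sets are pulled back along the contraction. A contracted edge at u that comes from an edge
-- at v becomes a detour through v, which stays in the branch set because u and v have the same
-- image.
theorem IsMinor.of_contractPair {V W : Type*} {H : SimpleGraph W} {G : SimpleGraph V} {u v : V}
    (huv : G.Adj u v) (hm : IsMinor H (contractPair G u v)) : IsMinor H G := by
  obtain ⟨B, h1, h2, h3⟩ := hm
  let π : V → {x : V // x ≠ v} := fun x => if h : x = v then ⟨u, huv.ne⟩ else ⟨x, h⟩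
  have πv : π v = ⟨u, huv.ne⟩ := by simp [π]
  have πx : ∀ x : {x : V // x ≠ v}, π x = x := fun x => by simp [π, x.2]
  have key : ∀ S : Set {x : V // x ≠ v}, ∀ a b : S,
      ((contractPair G u v).induce S).Reachable a b →
      (G.induce (π ⁻¹' S)).Reachable ⟨a.1.1, by simp [πx]⟩ ⟨b.1.1, by simp [πx]⟩ := by
    intro S a b ⟨p⟩
    induction p with
    | nil => exact SimpleGraph.Reachable.refl _
    | @cons a b c hab _ ih =>
      refine SimpleGraph.Reachable.trans ?_ ih
      obtain ⟨-, h | ⟨h, h'⟩ | ⟨h, h'⟩⟩ := hab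
      · exact SimpleGraph.Adj.reachable h
      · have hv : v ∈ π ⁻¹' S := by
          have : a.1 = π v := by rw [πv]; exact Subtype.ext h
          rw [Set.mem_preimage, ← this]
          exact a.2
        have e1 : (G.induce (π ⁻¹' S)).Adj ⟨a.1.1, by simp [πx]⟩ ⟨v, hv⟩ := by
          change G.Adj a.1.1 v
          rw [show a.1.1 = u from h]
          exact huv
        have e2 : (G.induce (π ⁻¹' S)).Adj ⟨v, hv⟩ ⟨b.1.1, by simp [πx]⟩ := h'
        exact e1.reachable.trans e2.reachable
      · have hv : v ∈ π ⁻¹' S := by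
          have : b.1 = π v := by rw [πv]; exact Subtype.ext h
          rw [Set.mem_preimage, ← this]
          exact b.2
        have e1 : (G.induce (π ⁻¹' S)).Adj ⟨b.1.1, by simp [πx]⟩ ⟨v, hv⟩ := by
          change G.Adj b.1.1 v
          rw [show b.1.1 = u from h]
          exact huv
        have e2 : (G.induce (π ⁻¹' S)).Adj ⟨v, hv⟩ ⟨a.1.1, by simp [πx]⟩ := h'
        exact (e1.reachable.trans e2.reachable).symm
  refine ⟨fun a => π ⁻¹' B a, fun a => ?_, fun a b hab => (h2 a b hab).preimage π, ?_⟩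
  · have hc := h1 a
    have toπ : ∀ x : π ⁻¹' B a, (G.induce (π ⁻¹' B a)).Reachable x ⟨(π x.1).1, by
        rw [Set.mem_preimage, πx]; exact x.2⟩ := by
      rintro ⟨x, hx⟩
      by_cases hxv : x = v
      · subst hxv
        refine SimpleGraph.Adj.reachable ?_
        change G.Adj x (π x).1
        rw [πv]
        exact huv.symm
      · have : x = (π x).1 := by simp [π, hxv]
        convert SimpleGraph.Reachable.refl _
        exact this.symm
    have : Nonempty (π ⁻¹' B a) := by
      obtain ⟨x⟩ := hc.nonempty
      exact ⟨⟨x.1.1, by simp [πx]⟩⟩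
    refine ⟨fun x y => ?_⟩
    exact ((toπ x).trans (key (B a) ⟨π x.1, x.2⟩ ⟨π y.1, y.2⟩ (hc.preconnected _ _))).trans
      (toπ y).symm
  · intro a b hab
    obtain ⟨x, hx, y, hy, -, h | ⟨h, h'⟩ | ⟨h, h'⟩⟩ := h3 a b hab
    · exact ⟨x, by simpa [πx] using hx, y, by simpa [πx] using hy, h⟩
    · refine ⟨v, ?_, y, by simpa [πx] using hy, h'⟩
      have : x = π v := by rw [πv]; exact Subtype.ext h
      rw [Set.mem_preimage, ← this]
      exact hx
    · refine ⟨x, by simpa [πx] using hx, v, ?_, h'.symm⟩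
      have : y = π v := by rw [πv]; exact Subtype.ext h
      rw [Set.mem_preimage, ← this]
      exact hy

open scoped Classical in
/-- The ordered pairs of adjacent nodes. -/
noncomputable def adjPairs {V : Type*} [Fintype V] (G : SimpleGraph V) : Finset (V × V) :=
  univ.filter fun p => G.Adj p.1 p.2

open scoped Classical in
theorem card_adjPairs_eq_sum {V : Type*} [Fintype V] (G : SimpleGraph V) :
    #(adjPairs G) = ∑ x, #(univ.filter fun y => G.Adj x y) := by
  simp only [adjPairs, card_filter, Fintype.sum_prod_type]

open scoped Classical in
-- Contracting uv loses the edge uv and, for each common neighbour, one of two edges that become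
-- parallel. Each loss counts twice among ordered pairs. Off the set `bad` of these pairs the
-- contraction is injective on adjacent pairs.
theorem card_adjPairs_le_contractPair {V : Type*} [Fintype V] {G : SimpleGraph V} {u v : V}
    (huv : G.Adj u v) :
    #(adjPairs G) ≤ #(adjPairs (contractPair G u v)) +
      2 * (#(univ.filter fun x => G.Adj u x ∧ G.Adj v x) + 1) := by
  set N := univ.filter fun x => G.Adj u x ∧ G.Adj v x with hN
  set M := insert u N
  set bad := M.image (fun x => (v, x)) ∪ M.image (fun x => (x, v)) with hbad
  have hM : #M ≤ #N + 1 := card_insert_le _ _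
  have hb : #bad ≤ 2 * (#N + 1) := by
    refine (card_union_le _ _).trans ?_
    have := card_image_le (s := M) (f := fun x => (v, x))
    have := card_image_le (s := M) (f := fun x => (x, v))
    omega
  let π : V → {x : V // x ≠ v} := fun x => if h : x = v then ⟨u, huv.ne⟩ else ⟨x, h⟩
  have πv : (π v).1 = u := by simp [π]
  have πx : ∀ x, x ≠ v → (π x).1 = x := fun x hx => by simp [π, hx]
  have hsub : #(adjPairs G \ bad) ≤ #(adjPairs (contractPair G u v)) := by
    refine card_le_card_of_injOn (fun p => (π p.1, π p.2)) ?_ ?_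
    · rintro ⟨a, b⟩ hp
      simp only [adjPairs, hbad, M, hN, coe_sdiff, coe_filter, mem_univ, true_and, Set.mem_sdiff,
        Set.mem_ofPred_eq, mem_coe, mem_union, mem_image, mem_insert, mem_filter, Prod.mk.injEq,
        not_or, not_exists, not_and, contractPair, ne_eq, Subtype.ext_iff] at hp ⊢
      by_cases ha : a = v
      · subst ha
        have hbv : b ≠ a := hp.1.ne'
        have hbu : b ≠ u := fun h => hp.2.1 b (Or.inl h) rfl rfl
        rw [πv, πx b hbv]
        exact ⟨hbu.symm, Or.inr (Or.inl ⟨rfl, hp.1⟩)⟩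
      · by_cases hb : b = v
        · subst hb
          have hau : a ≠ u := fun h => hp.2.2 a (Or.inl h) rfl rfl
          rw [πv, πx a ha]
          exact ⟨hau, Or.inr (Or.inr ⟨rfl, hp.1.symm⟩)⟩
        · rw [πx a ha, πx b hb]
          exact ⟨hp.1.ne, Or.inl hp.1⟩
    · rintro ⟨a, b⟩ hp ⟨c, d⟩ hq h
      simp only [adjPairs, hbad, M, hN, coe_sdiff, coe_filter, mem_univ, true_and, Set.mem_sdiff,
        Set.mem_ofPred_eq, mem_coe, mem_union, mem_image, mem_insert, mem_filter, Prod.mk.injEq,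
        not_or, not_exists, not_and, Subtype.ext_iff] at hp hq h
      obtain ⟨e1, e2⟩ := h
      have n1 := hp.1.ne
      have n2 := hq.1.ne
      have s1 := hp.1.symm
      have s2 := hq.1.symm
      by_cases ha : a = v <;> by_cases hb : b = v <;> by_cases hc : c = v <;>
        by_cases hd : d = v <;> simp only [ha, hb, hc, hd, πv, πx, ne_eq, not_false_eq_true] at * <;>
        grind
  have := card_le_card_sdiff_add_card (t := bad) (s := adjPairs G)
  omega

open scoped Classical in
-- Induction on t. If some edge has at most c common neighbours, contracting it loses at most 2c+2
-- ordered pairs and one node. Otherwise the neighbourhood of any non-isolated node has minimum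
-- degree above c, too dense to exclude K_t, and adding that node yields K_{t+1}.
theorem exists_card_adjPairs_le (t : ℕ) : ∃ c : ℕ, ∀ (V : Type) [Fintype V] (G : SimpleGraph V),
    ¬ IsMinor (⊤ : SimpleGraph (Fin t)) G → #(adjPairs G) ≤ c * Fintype.card V := by
  induction t with
  | zero => exact ⟨0, fun V _ G h => (h ⟨fun a => a.elim0, fun a => a.elim0, fun a => a.elim0,
      fun a => a.elim0⟩).elim⟩
  | succ t ih =>
    obtain ⟨c, hc⟩ := ih
    refine ⟨2 * c + 2, ?_⟩
    suffices ∀ n : ℕ, ∀ (V : Type) [Fintype V] (G : SimpleGraph V), Fintype.card V = n →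
        ¬ IsMinor (⊤ : SimpleGraph (Fin (t + 1))) G → #(adjPairs G) ≤ (2 * c + 2) * n from
      fun V _ G h => this _ V G rfl h
    intro n
    induction n with
    | zero =>
      intro V _ G hV _
      have := Fintype.card_eq_zero_iff.1 hV
      simp [adjPairs]
    | succ n ih =>
      intro V _ G hV hG
      by_cases hex : ∃ u v, G.Adj u v ∧ #(univ.filter fun x => G.Adj u x ∧ G.Adj v x) ≤ c
      · obtain ⟨u, v, huv, hle⟩ := hex
        have h1 := card_adjPairs_le_contractPair huv
        have h2 := ih {x : V // x ≠ v} (contractPair G u v)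
          (by rw [Fintype.card_subtype_compl, Fintype.card_subtype_eq, hV]; rfl)
          (fun hm => hG (hm.of_contractPair huv))
        rw [mul_add]
        omega
      · push Not at hex
        by_cases hne : ∃ v w, G.Adj v w
        · exfalso
          obtain ⟨v, w, hvw⟩ := hne
          have h1 := hc _ (G.induce {x | G.Adj v x}) (fun hm => hG hm.succ_of_neighborSet)
          have h2 : ∑ x : {x | G.Adj v x}, (c + 1) ≤ #(adjPairs (G.induce {x | G.Adj v x})) := by
            rw [card_adjPairs_eq_sum]
            refine sum_le_sum fun x _ => ?_
            refine (Nat.succ_le_of_lt (hex v x.1 x.2)).trans (card_le_card_of_surjOn Subtype.val ?_)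
            intro y hy
            simp only [coe_filter, mem_univ, true_and, Set.mem_ofPred_eq] at hy
            exact ⟨⟨y, hy.1⟩, by simpa using hy.2, rfl⟩
          rw [sum_const, card_univ, smul_eq_mul] at h2
          have : Nonempty {x | G.Adj v x} := ⟨⟨w, hvw⟩⟩
          have h3 : 0 < Fintype.card {x | G.Adj v x} := Fintype.card_pos
          nlinarith
        · push Not at hne
          have : adjPairs G = ∅ := by
            simp [adjPairs, hne]
          simp [this]

/-- An excluded graph on t nodes is a subgraph of K_t, so no member of the family has a K_t minor.
The bound is needed for minors of G because it will be applied after contracting inner parts. -/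
theorem GraphFamily.MinorClosed.exists_card_adjPairs_le {𝒢 : GraphFamily} (hc : 𝒢.MinorClosed)
    (hp : 𝒢.Proper) : ∃ c : ℕ, ∀ (n : ℕ) (G : SimpleGraph (Fin n)), G ∈ 𝒢 n →
      ∀ (W : Type) [Fintype W] (K : SimpleGraph W), IsMinor K G →
        #(adjPairs K) ≤ c * Fintype.card W := by
  obtain ⟨t, H, hH⟩ := hp
  obtain ⟨c, hcc⟩ := _root_.exists_card_adjPairs_le t
  refine ⟨c, fun n G hG W _ K hK => hcc W K fun hm => hH ?_⟩
  let e : Fin (Fintype.card W) ≃ W := (Fintype.equivFin W).symm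
  have h1 : K.comap e ∈ 𝒢 (Fintype.card W) := hc _ _ _ _ hG (hK.of_iso e)
  refine hc _ _ _ _ h1 (IsMinor.of_le le_top ?_)
  obtain ⟨B, b1, b2, b3⟩ := hm
  refine ⟨fun a => e ⁻¹' B a, fun a => ?_, fun a b hab => (b2 a b hab).preimage e,
    fun a b hab => ?_⟩
  · let f : K.induce (B a) →g (K.comap e).induce (e ⁻¹' B a) :=
      ⟨fun x => ⟨e.symm x.1, by simp⟩, fun {x y} h => by
        change K.Adj (e (e.symm x.1)) (e (e.symm y.1))
        simpa using h⟩
    refine (b1 a).map f ?_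
    rintro ⟨x, hx⟩
    exact ⟨⟨e x, hx⟩, Subtype.ext (e.symm_apply_apply x)⟩
  · obtain ⟨x, hx, y, hy, hxy⟩ := b3 a b hab
    exact ⟨e.symm x, by simpa using hx, e.symm y, by simpa using hy, by simpa using hxy⟩

/-! ### The first stage of the algorithm -/

namespace Phase

variable {V : Type*} [Fintype V] [DecidableEq V] {I : Phase V} {P₀ Y Y' : Finset V} {S C : Biset V}

theorem Covers.mono (hI : I.Valid) (hX : I.X ⊆ Y) (h : Y ⊆ Y') (hc : I.Covers Y) : I.Covers Y' := by
  rw [covers_iff hI (hX.trans h)]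
  rw [covers_iff hI hX] at hc
  exact fun S hS => hc S (hS.anti h)

theorem covers_iff_violatedBisets (hI : I.Valid) (hX : I.X ⊆ Y) :
    I.Covers Y ↔ I.violatedBisets Y = ∅ := by
  rw [covers_iff hI hX, violatedBisets_eq_empty_iff hI hX]

theorem wt_nonneg (I : Phase V) (v : V) : 0 ≤ I.wt v := by
  unfold wt
  split_ifs
  · exact le_rfl
  · exact I.w_nonneg v

section Violated

variable (hI : I.Valid) (hX : I.X ⊆ Y) (hC : C ∈ I.violatedBisets Y)
include hI hX hC

theorem deficient_of_mem_violatedBisets : I.Deficient Y C :=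
  ((mem_violatedBisets hI hX).1 hC).1

theorem inner_subset_of_mem_violatedBisets : C.inner ⊆ Y := by
  intro u hu
  by_contra huY
  obtain ⟨h1, h2⟩ := (mem_violatedBisets hI hX).1 hC
  have := (h2 (h1.erase hI hX huY) (C.erase_le u)).1 hu
  simp [Biset.erase] at this

/-- By minimality the inner part consists of selected nodes. A selected neighbour would thus provide
an edge that satisfies the biset. -/
theorem notMem_of_mem_nbr {v : V} (hv : v ∈ C.nbr I.Gℓ) : v ∉ Y := by
  intro hvY
  obtain ⟨h1, u, hu, huv⟩ := Biset.mem_nbr.1 hv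
  exact (deficient_of_mem_violatedBisets hI hX hC).not_adj hI hX hu h1
    (inner_subset_of_mem_violatedBisets hI hX hC hu) hvY huv

theorem nbr_nonempty_of_mem_violatedBisets : (C.nbr I.Gℓ).Nonempty := by
  obtain ⟨a, ha, b, hb, -, -, hab⟩ :=
    hI.feasible.exists_adj hI ((deficient_of_mem_violatedBisets hI hX hC).anti hX)
  exact ⟨b, Biset.mem_nbr.2 ⟨hb, a, ha, hab⟩⟩

end Violated

open scoped Classical in
theorem load_add (hI : I.Valid) (hX : I.X ⊆ Y) (y : Biset V → ℝ) (ε : ℝ) (v : V) :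
    I.load (fun S => if S ∈ I.violatedBisets Y then y S + ε else y S) v =
      I.load y v + ε * #((I.violatedBisets Y).filter fun C => v ∈ C.nbr I.Gℓ) := by
  have : (I.violatedBisets Y).filter (fun C => v ∈ C.nbr I.Gℓ) =
      (univ.filter fun S : Biset V => S ∈ I.family ∧ v ∈ S.nbr I.Gℓ).filter
        (fun S => S ∈ I.violatedBisets Y) := by
    ext C
    simp only [mem_filter, mem_univ, true_and]
    constructor
    · rintro ⟨h1, h2⟩
      exact ⟨⟨(deficient_of_mem_violatedBisets hI hX h1).1, h2⟩, h1⟩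
    · rintro ⟨⟨-, h1⟩, h2⟩
      exact ⟨h2, h1⟩
  rw [this, load, load, card_filter, Nat.cast_sum, mul_sum, ← sum_add_distrib]
  refine sum_congr rfl fun S _ => ?_
  split_ifs <;> simp

theorem subset_P (s : State V) : P₀ ⊆ s.P P₀ := subset_union_left

theorem exists_step (hI : I.Valid) (hX : I.X ⊆ P₀) {s : State V}
    (hl : ∀ u, I.load s.y u ≤ I.wt u) (hv : I.violatedBisets (s.P P₀) ≠ ∅) :
    ∃ s' : State V, I.Step P₀ s s' := by
  classical
  have hXs : I.X ⊆ s.P P₀ := hX.trans (subset_P s)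
  let cnt : V → ℕ := fun v => #((I.violatedBisets (s.P P₀)).filter fun C => v ∈ C.nbr I.Gℓ)
  let K := univ.filter fun v => 0 < cnt v
  have hK : K.Nonempty := by
    obtain ⟨C, hC⟩ := nonempty_iff_ne_empty.2 hv
    obtain ⟨v, hv⟩ := nbr_nonempty_of_mem_violatedBisets hI hXs hC
    exact ⟨v, by simp only [K, cnt, mem_filter, mem_univ, true_and]; exact card_pos.2 ⟨C, by simp [hC, hv]⟩⟩
  -- Ratio test: a uniform increase by ε adds ε times its count to the load of a node, so the least
  -- quotient of slack and count is the largest admissible ε.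
  obtain ⟨v, hvK, hmin⟩ := K.exists_min_image (fun v => (I.wt v - I.load s.y v) / cnt v) hK
  have hpos : (0 : ℝ) < cnt v := by simpa [K] using hvK
  set ε := (I.wt v - I.load s.y v) / cnt v with hε
  refine ⟨⟨v :: s.added, fun S => if S ∈ I.violatedBisets (s.P P₀) then s.y S + ε else s.y S⟩,
    ε, v, div_nonneg (sub_nonneg.2 (hl v)) hpos.le, ?_, rfl, fun u => ?_, ?_, rfl⟩
  · have : 0 < cnt v := by exact_mod_cast hpos
    obtain ⟨C, hC⟩ := card_pos.1 this
    rw [mem_filter] at hC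
    exact ⟨notMem_of_mem_nbr hI hXs hC.1 hC.2, C, hC.1, hC.2⟩
  · rw [load_add hI hXs]
    change I.load s.y u + ε * cnt u ≤ I.wt u
    by_cases hu : 0 < cnt u
    · have h1 := hmin u (by simpa [K] using hu)
      rw [le_div_iff₀ (by exact_mod_cast hu)] at h1
      linarith
    · have : cnt u = 0 := by omega
      simpa [this] using hl u
  · rw [load_add hI hXs]
    change I.load s.y v + ε * cnt v = I.wt v
    rw [hε, div_mul_cancel₀ _ hpos.ne']
    ring

/-- What the first stage maintains. -/
structure Invariant (I : Phase V) (P₀ : Finset V) (s : State V) : Prop where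
  nodup : s.added.Nodup
  notMem : ∀ v ∈ s.added, v ∉ P₀
  load_le : ∀ u, I.load s.y u ≤ I.wt u
  load_eq : ∀ v ∈ s.added, I.load s.y v = I.wt v
  y_nonneg : ∀ S, 0 ≤ s.y S
  deficient : ∀ S, s.y S ≠ 0 → I.Deficient I.X S

theorem Reachable.invariant (hI : I.Valid) (hX : I.X ⊆ P₀) {s : State V}
    (h : I.Reachable P₀ s) : I.Invariant P₀ s := by
  classical
  induction h with
  | refl =>
    refine ⟨by simp [State.init], by simp [State.init], fun u => ?_, by simp [State.init],
      by simp [State.init], by simp [State.init]⟩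
    simpa [State.init, load] using I.wt_nonneg u
  | @tail s s' _ hstep ih =>
    obtain ⟨ε, v, hε, ⟨hv, -⟩, hy, hle, heq, hadd⟩ := hstep
    have hXs : I.X ⊆ s.P P₀ := hX.trans (subset_P s)
    simp only [State.P, mem_union, List.mem_toFinset, not_or] at hv
    refine ⟨?_, ?_, hle, ?_, ?_, ?_⟩
    · rw [hadd, List.nodup_cons]
      exact ⟨hv.2, ih.nodup⟩
    · rw [hadd]
      simp only [List.mem_cons, forall_eq_or_imp]
      exact ⟨hv.1, ih.notMem⟩
    · rw [hadd]
      simp only [List.mem_cons, forall_eq_or_imp]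
      refine ⟨heq, fun u hu => ?_⟩
      -- A node selected earlier is no neighbour of a current minimal violated biset, so its load
      -- stays at the tight value.
      have : (I.violatedBisets (s.P P₀)).filter (fun C => u ∈ C.nbr I.Gℓ) = ∅ := by
        rw [filter_eq_empty_iff]
        intro C hC huC
        exact notMem_of_mem_nbr hI hXs hC huC (by simp [State.P, hu])
      have h2 := load_add hI hXs s.y ε u
      rw [this, card_empty, Nat.cast_zero, mul_zero, add_zero, ih.load_eq u hu] at h2
      rw [hy, ← h2]
    · intro S
      rw [hy]
      have := ih.y_nonneg S
      dsimp only
      split_ifs <;> linarith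
    · intro S
      rw [hy]
      dsimp only
      split_ifs with hS
      · exact fun _ => (deficient_of_mem_violatedBisets hI hXs hS).anti hXs
      · exact ih.deficient S

theorem Reachable.length_le (hI : I.Valid) (hX : I.X ⊆ P₀) {s : State V}
    (h : I.Reachable P₀ s) : s.added.length ≤ Fintype.card V :=
  (h.invariant hI hX).nodup.length_le_card

/-! ### Reverse delete -/

open scoped Classical in
-- The list has the most recent node first, so a suffix `L'` is what had been added at some earlier
-- moment. When a kept node v outside `L'` was examined, the current set contained `L'` and the
-- whole final output, yet v could not be spared. By monotonicity it cannot be spared from the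
-- smaller set either.
theorem reverseDelete_spec (hI : I.Valid) (hX : I.X ⊆ P₀) (L : List V) :
    ∀ Q : Finset V, L.Nodup → (∀ v ∈ L, v ∉ P₀) → P₀ ∪ L.toFinset ⊆ Q → I.Covers Q →
      I.reverseDelete L Q ⊆ Q ∧ P₀ ⊆ I.reverseDelete L Q ∧ I.Covers (I.reverseDelete L Q) ∧
      ∀ L', L' <:+ L → ∀ v ∈ I.reverseDelete L Q, v ∈ L → v ∉ L' →
        ¬ I.Covers ((P₀ ∪ L'.toFinset ∪ I.reverseDelete L Q).erase v) := by
  induction L with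
  | nil =>
    intro Q _ _ hQ hc
    simp only [reverseDelete]
    exact ⟨subset_rfl, subset_union_left.trans hQ, hc, by simp⟩
  | cons a L ih =>
    intro Q hnd hL hQ hc
    rw [List.nodup_cons] at hnd
    have haP : a ∉ P₀ := hL a (by simp)
    simp only [reverseDelete]
    set Q₁ := if I.violatedBisets (Q.erase a) = ∅ then Q.erase a else Q with hQ₁
    have hPQ : P₀ ∪ L.toFinset ⊆ Q.erase a := by
      intro x hx
      rw [mem_erase]
      refine ⟨?_, hQ ?_⟩
      · rintro rfl
        rw [mem_union, List.mem_toFinset] at hx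
        tauto
      · simp only [mem_union, List.mem_toFinset, List.mem_cons] at hx ⊢
        tauto
    have hXe : I.X ⊆ Q.erase a := hX.trans (subset_union_left.trans hPQ)
    have hQ₁Q : Q₁ ⊆ Q := by
      rw [hQ₁]
      split_ifs
      · exact erase_subset _ _
      · exact subset_rfl
    obtain ⟨h1, h2, h3, h4⟩ := ih Q₁ hnd.2 (fun v hv => hL v (by simp [hv]))
      (by rw [hQ₁]; split_ifs; exacts [hPQ, hPQ.trans (erase_subset _ _)])
      (by
        rw [hQ₁]
        split_ifs with hv
        · exact (covers_iff_violatedBisets hI hXe).2 hv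
        · exact hc)
    refine ⟨h1.trans hQ₁Q, h2, h3, fun L' hL' v hv hvL hvL' => ?_⟩
    rw [List.mem_cons] at hvL
    by_cases hva : v = a
    · subst hva
      have hne : I.violatedBisets (Q.erase v) ≠ ∅ := by
        intro he
        have := h1 hv
        rw [hQ₁, if_pos he] at this
        simp at this
      intro hcov
      refine hne ((covers_iff_violatedBisets hI hXe).1 (hcov.mono hI ?_ (erase_subset_erase v ?_)))
      · intro x hx
        rw [mem_erase, mem_union, mem_union]
        exact ⟨fun h => haP (h ▸ hX hx), Or.inl (Or.inl (hX hx))⟩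
      · refine union_subset (union_subset (subset_union_left.trans hQ) ?_) (h1.trans hQ₁Q)
        intro x hx
        rw [List.mem_toFinset] at hx
        exact hQ (mem_union_right _ (List.mem_toFinset.2 (hL'.subset hx)))
    · rw [List.suffix_cons_iff] at hL'
      rcases hL' with rfl | hL'
      · exact absurd (List.mem_cons.2 hvL) hvL'
      · exact h4 L' hL' v hv (by tauto) hvL'

/-! ### The analysis of the algorithm -/

/-- The nodes of `B` can be bought at the expense of the minimal violated bisets. -/
def Chargeable (I : Phase V) (c : ℝ) : Prop :=
  ∀ P B : Finset V, I.X ⊆ P → Disjoint P B → I.Covers (P ∪ B) →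
    (∀ v ∈ B, ¬ I.Covers ((P ∪ B).erase v)) →
    ((∑ C ∈ I.violatedBisets P, #(C.nbr I.Gℓ ∩ B) : ℕ) : ℝ) ≤ c * #(I.violatedBisets P)

/-- Induction over the iterations with the final Q held fixed. An iteration adds ε times the sum of
|Γ(C) ∩ B| on the left and cε times the number of minimal violated bisets on the right. The
minimality of B comes from the suffix of nodes added before the iteration. -/
theorem sum_y_le {c : ℝ} (hI : I.Valid) (hX : I.X ⊆ P₀) (hc : I.Chargeable c) {Q : Finset V}
    {s : State V} (h : I.Reachable P₀ s) (hPQ : P₀ ⊆ Q) (hQ : I.Covers Q)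
    (hmin : ∀ L', L' <:+ s.added → ∀ v ∈ Q, v ∉ P₀ → v ∉ L' →
      ¬ I.Covers ((P₀ ∪ L'.toFinset ∪ Q).erase v)) :
    ∑ S, s.y S * #(S.nbr I.Gℓ ∩ (Q \ P₀)) ≤ c * ∑ S, s.y S := by
  classical
  induction h with
  | refl => simp [State.init]
  | @tail s s' _ hstep ih =>
    obtain ⟨ε, v, hε, -, hy, -, -, hadd⟩ := hstep
    have hXs : I.X ⊆ s.P P₀ := hX.trans (subset_P s)
    have ih := ih fun L' hL' => hmin L' (hL'.trans (by rw [hadd]; exact List.suffix_cons _ _))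
    have hcB := hc (s.P P₀) (Q \ s.P P₀) hXs disjoint_sdiff (by
      rw [union_sdiff_self_eq_union]
      exact hQ.mono hI (hX.trans hPQ) subset_union_right) (by
      intro v hv
      rw [mem_sdiff] at hv
      rw [union_sdiff_self_eq_union]
      refine hmin s.added (by rw [hadd]; exact List.suffix_cons _ _) v hv.1
        (fun h => hv.2 (subset_P s h)) (fun h => hv.2 ?_)
      simp [State.P, h])
    have heq : ∀ C ∈ I.violatedBisets (s.P P₀),
        C.nbr I.Gℓ ∩ (Q \ P₀) = C.nbr I.Gℓ ∩ (Q \ s.P P₀) := by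
      intro C hC
      ext u
      simp only [mem_inter, mem_sdiff]
      constructor
      · rintro ⟨h1, h2, -⟩
        exact ⟨h1, h2, notMem_of_mem_nbr hI hXs hC h1⟩
      · rintro ⟨h1, h2, h3⟩
        exact ⟨h1, h2, fun h => h3 (subset_P s h)⟩
    have key : ∀ g : Biset V → ℝ, ∑ S, s'.y S * g S =
        ∑ S, s.y S * g S + ε * ∑ C ∈ I.violatedBisets (s.P P₀), g C := by
      intro g
      rw [hy, mul_sum, ← Finset.sum_filter_add_sum_filter_not univ
        (fun S => S ∈ I.violatedBisets (s.P P₀)) (fun S => s.y S * g S),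
        ← Finset.sum_filter_add_sum_filter_not univ (fun S => S ∈ I.violatedBisets (s.P P₀))]
      rw [add_right_comm]
      congr 1
      · rw [filter_mem_eq_inter, univ_inter, ← sum_add_distrib]
        refine sum_congr rfl fun S hS => ?_
        simp only [if_pos hS]
        ring
      · refine sum_congr rfl fun S hS => ?_
        simp only [if_neg (mem_filter.1 hS).2]
    have k1 := key fun S => (#(S.nbr I.Gℓ ∩ (Q \ P₀)) : ℝ)
    have k2 := key fun _ => 1
    simp only [mul_one, sum_const, nsmul_eq_mul] at k2
    rw [k1, k2]
    have : ∑ C ∈ I.violatedBisets (s.P P₀), (#(C.nbr I.Gℓ ∩ (Q \ P₀)) : ℝ) =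
        ((∑ C ∈ I.violatedBisets (s.P P₀), #(C.nbr I.Gℓ ∩ (Q \ s.P P₀)) : ℕ) : ℝ) := by
      rw [Nat.cast_sum]
      exact sum_congr rfl fun C hC => by rw [heq C hC]
    rw [this]
    nlinarith [mul_le_mul_of_nonneg_left hcB hε]

/-- Weak duality: the dual is supported on bisets with h = 1, and exchanging the summations turns
the primal constraints into loads. -/
theorem sum_y_le_lpValue (hI : I.Valid) {s : State V} (h : I.Invariant P₀ s)
    {x : V → ℝ} (hx : I.LPFeasible x) : ∑ S, s.y S ≤ I.lpValue x := by
  classical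
  have h1 : ∀ S, s.y S ≤ ∑ v, if S ∈ I.family ∧ v ∈ S.nbr I.Gℓ then s.y S * x v else 0 := by
    intro S
    by_cases hS : s.y S = 0
    · simp [hS]
    · have hd := h.deficient S hS
      have := hx.2 S hd.1
      rw [h_eq_one hI hd, Int.cast_one] at this
      simp only [hd.1, true_and]
      rw [← sum_filter, filter_mem_eq_inter, univ_inter, ← mul_sum]
      exact le_mul_of_one_le_right (h.y_nonneg S) this
  calc ∑ S, s.y S ≤ ∑ S, ∑ v, if S ∈ I.family ∧ v ∈ S.nbr I.Gℓ then s.y S * x v else 0 :=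
        sum_le_sum fun S _ => h1 S
    _ = ∑ v, I.load s.y v * x v := by
        rw [sum_comm]
        refine sum_congr rfl fun v _ => ?_
        rw [load, sum_mul, sum_filter]
    _ ≤ I.lpValue x := sum_le_sum fun v _ => mul_le_mul_of_nonneg_right (h.load_le v) (hx.1 v)

/-- Nodes of P₀ cost nothing, and every other selected node is paid for exactly by its tight dual
constraint. -/
theorem weight_eq_sum_y {s : State V} (h : I.Invariant P₀ s)
    (hw : ∀ v ∈ P₀, I.wt v = 0) {Q : Finset V} (hQ : Q ⊆ s.P P₀) :
    I.weight Q = ∑ S, s.y S * #(S.nbr I.Gℓ ∩ (Q \ P₀)) := by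
  classical
  have h1 : I.weight Q = ∑ v ∈ Q \ P₀, I.load s.y v := by
    rw [weight, ← sum_subset (sdiff_subset (s := Q) (t := P₀))]
    · refine sum_congr rfl fun v hv => (h.load_eq v ?_).symm
      rw [mem_sdiff] at hv
      have := hQ hv.1
      simp only [State.P, mem_union, List.mem_toFinset] at this
      tauto
    · intro v hv hv'
      rw [mem_sdiff, not_and_not_right] at hv'
      exact hw v (hv' hv)
  rw [h1]
  simp only [load, sum_filter]
  rw [sum_comm]
  refine sum_congr rfl fun S _ => ?_
  by_cases hS : s.y S = 0
  · simp [hS]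
  · simp only [(h.deficient S hS).1, true_and]
    rw [← sum_filter, sum_const, nsmul_eq_mul, mul_comm, filter_mem_eq_inter, inter_comm]

theorem lpFeasible_of_covers (hI : I.Valid) {A : Finset V} (hA : I.Covers (I.X ∪ A)) :
    I.LPFeasible fun v => if v ∈ I.X ∪ A then 1 else 0 := by
  refine ⟨fun v => by dsimp only; split_ifs <;> norm_num, fun S hS => ?_⟩
  by_cases h0 : 0 < I.h S
  · have hd := (h_pos_iff hI hS).1 h0
    rw [h_eq_one hI hd]
    obtain ⟨a, ha, b, hb, -, hbA, hab⟩ := hA.exists_adj hI hd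
    have hb' : b ∈ S.nbr I.Gℓ := Biset.mem_nbr.2 ⟨hb, a, ha, hab⟩
    refine le_trans ?_ (single_le_sum (f := fun v => if v ∈ I.X ∪ A then (1 : ℝ) else 0)
      (fun v _ => ?_) hb')
    · simp only [if_pos hbA, Int.cast_one, le_refl]
    · split_ifs <;> norm_num
  · have h1 : (I.h S : ℝ) ≤ 0 := by exact_mod_cast not_lt.1 h0
    refine h1.trans (sum_nonneg fun v _ => ?_)
    split_ifs <;> norm_num

theorem lpValue_of_covers (I : Phase V) (A : Finset V) :
    I.lpValue (fun v => if v ∈ I.X ∪ A then 1 else 0) = I.weight A := by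
  simp only [lpValue, mul_ite, mul_one, mul_zero]
  rw [← sum_filter, filter_mem_eq_inter, univ_inter, weight]
  refine (sum_subset subset_union_right fun v hv hvA => ?_).symm
  rw [mem_union] at hv
  simp [wt, hv.resolve_right hvA]

theorem IsOutput.approx {c : ℝ} (hI : I.Valid) (hX : I.X ⊆ P₀) (hw : ∀ v ∈ P₀, I.wt v = 0)
    (hc0 : 0 ≤ c) (hc : I.Chargeable c) {Q : Finset V} (hQ : I.IsOutput P₀ Q) :
    I.X ⊆ Q ∧ I.Covers Q ∧ (∀ x : V → ℝ, I.LPFeasible x → I.weight Q ≤ c * I.lpValue x) ∧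
      (∀ A : Finset V, I.Covers (I.X ∪ A) → I.weight Q ≤ c * I.weight A) := by
  classical
  obtain ⟨s, hs, hv, rfl⟩ := hQ
  have inv := hs.invariant hI hX
  obtain ⟨h1, h2, h3, h4⟩ := reverseDelete_spec hI hX s.added (s.P P₀) inv.nodup inv.notMem
    subset_rfl ((covers_iff_violatedBisets hI (hX.trans (subset_P s))).2 hv)
  have key : ∀ x : V → ℝ, I.LPFeasible x →
      I.weight (I.reverseDelete s.added (s.P P₀)) ≤ c * I.lpValue x := by
    intro x hx
    rw [weight_eq_sum_y inv hw h1]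
    refine (sum_y_le hI hX hc hs h2 h3 ?_).trans
      (mul_le_mul_of_nonneg_left (sum_y_le_lpValue hI inv hx) hc0)
    intro L' hL' v hv hvP hvL'
    refine h4 L' hL' v hv ?_ hvL'
    have := h1 hv
    simp only [State.P, mem_union, List.mem_toFinset] at this
    tauto
  refine ⟨hX.trans h2, h3, key, fun A hA => ?_⟩
  rw [← lpValue_of_covers I A]
  exact key _ (lpFeasible_of_covers hI hA)

end Phase

/-! ### Laminar families of sets -/

/-- Induction on the ground set: delete a point x from all members. At most two members are lost,
namely {x} and one A for which A without x is also a member. There is only one such A: for two of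
them, A ⊂ B, laminarity of A and B without x would fail. -/
theorem card_le_two_mul_of_laminar {α : Type*} [DecidableEq α] (s : Finset α) :
    ∀ 𝓕 : Finset (Finset α), (∀ A ∈ 𝓕, A.Nonempty ∧ A ⊆ s) →
      (∀ A ∈ 𝓕, ∀ B ∈ 𝓕, A ⊆ B ∨ B ⊆ A ∨ Disjoint A B) → #𝓕 ≤ 2 * #s := by
  induction s using Finset.induction_on with
  | empty =>
    intro 𝓕 h _
    have : 𝓕 = ∅ := by
      rw [eq_empty_iff_forall_notMem]
      intro A hA
      obtain ⟨⟨x, hx⟩, h2⟩ := h A hA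
      simpa using h2 hx
    simp [this]
  | @insert x s hx ih =>
    intro 𝓕 h hl
    rw [card_insert_of_notMem hx]
    set 𝓔 := (𝓕.image fun A => A.erase x).erase ∅ with h𝓔
    have h1 : #𝓔 ≤ 2 * #s := by
      refine ih 𝓔 ?_ ?_
      · intro A hA
        simp only [h𝓔, mem_erase, mem_image] at hA
        obtain ⟨hne, A, hA, rfl⟩ := hA
        exact ⟨nonempty_iff_ne_empty.2 hne, by
          rw [← subset_insert_iff]
          exact (h A hA).2⟩
      · intro A hA B hB
        simp only [h𝓔, mem_erase, mem_image] at hA hB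
        obtain ⟨-, A, hA, rfl⟩ := hA
        obtain ⟨-, B, hB, rfl⟩ := hB
        rcases hl A hA B hB with h | h | h
        · exact Or.inl (erase_subset_erase _ h)
        · exact Or.inr (Or.inl (erase_subset_erase _ h))
        · exact Or.inr (Or.inr (h.mono (erase_subset _ _) (erase_subset _ _)))
    -- the members of `𝓕` that are identified with another one or vanish
    set 𝓓 := 𝓕.filter fun A => x ∈ A ∧ (A = {x} ∨ A.erase x ∈ 𝓕) with h𝓓
    have h2 : #𝓓 ≤ 2 := by
      have : #(𝓓.erase {x}) ≤ 1 := by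
        rw [card_le_one]
        have key : ∀ A ∈ 𝓓.erase {x}, ∀ B ∈ 𝓓.erase {x}, A ⊆ B → A = B := by
          intro A hA B hB hAB
          simp only [h𝓓, mem_erase, mem_filter] at hA hB
          obtain ⟨hA1, hA2, hA3, hA4⟩ := hA
          obtain ⟨hB1, hB2, hB3, hB4⟩ := hB
          have hA5 := hA4.resolve_left hA1
          have hB5 := hB4.resolve_left hB1
          refine hAB.antisymm ?_
          rcases hl A hA2 _ hB5 with h' | h' | h'
          · exact absurd (h' hA3) (notMem_erase _ _)
          · intro y hy
            by_cases hyx : y = x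
            · rw [hyx]; exact hA3
            · exact h' (mem_erase.2 ⟨hyx, hy⟩)
          · exfalso
            obtain ⟨y, hy⟩ := (h _ hA5).1
            exact disjoint_left.1 h' (mem_of_mem_erase hy) (erase_subset_erase _ hAB hy)
        intro A hA B hB
        have hA' := mem_filter.1 (mem_of_mem_erase hA)
        have hB' := mem_filter.1 (mem_of_mem_erase hB)
        rcases hl A hA'.1 B hB'.1 with h' | h' | h'
        · exact key A hA B hB h'
        · exact (key B hB A hA h').symm
        · exact absurd hB'.2.1 (disjoint_left.1 h' hA'.2.1)
      have := pred_card_le_card_erase (s := 𝓓) (a := {x})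
      omega
    have h3 : #(𝓕 \ 𝓓) ≤ #𝓔 := by
      refine card_le_card_of_injOn (fun A => A.erase x) ?_ ?_
      · intro A hA
        simp only [h𝓓, coe_sdiff, Set.mem_sdiff, mem_coe, mem_filter, not_and, not_or] at hA
        simp only [h𝓔, coe_erase, Set.mem_sdiff, mem_coe, mem_image, Set.mem_singleton_iff]
        refine ⟨⟨A, hA.1, rfl⟩, fun he => ?_⟩
        rw [erase_eq_empty_iff] at he
        rcases he with he | he
        · exact (h A hA.1).1.ne_empty he
        · exact (hA.2 hA.1 (by simp [he])).1 he
      · intro A hA B hB hAB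
        simp only [h𝓓, coe_sdiff, Set.mem_sdiff, mem_coe, mem_filter, not_and, not_or] at hA hB
        dsimp only at hAB
        by_cases hxA : x ∈ A <;> by_cases hxB : x ∈ B
        · rw [← insert_erase hxA, ← insert_erase hxB, hAB]
        · rw [erase_eq_of_notMem hxB] at hAB
          exact absurd (hAB ▸ hB.1) (hA.2 hA.1 hxA).2
        · rw [erase_eq_of_notMem hxA] at hAB
          exact absurd (hAB ▸ hA.1) (hB.2 hB.1 hxB).2
        · rwa [erase_eq_of_notMem hxA, erase_eq_of_notMem hxB] at hAB
    have := card_le_card_sdiff_add_card (s := 𝓕) (t := 𝓓)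
    omega

/-! ### Witnesses of the necessity of a node -/

namespace Biset

variable {V : Type*} [DecidableEq V]

/-- The inner part of each biset avoids the other biset. -/
def Avoids (S T : Biset V) : Prop := Disjoint S.inner T.outer ∧ Disjoint S.outer T.inner

/-- The size of a biset. -/
def size (S : Biset V) : ℕ := #S.inner + #S.outer

theorem size_mono {S T : Biset V} (h : S ≤ T) : S.size ≤ T.size :=
  add_le_add (card_le_card h.1) (card_le_card h.2)

theorem eq_of_le_of_size_le {S T : Biset V} (h : S ≤ T) (hs : T.size ≤ S.size) : S = T := by
  have h1 : #S.inner ≤ #T.inner := card_le_card h.1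
  have h2 : #S.outer ≤ #T.outer := card_le_card h.2
  unfold size at hs
  exact Biset.ext (eq_of_subset_of_card_le h.1 (by omega)) (eq_of_subset_of_card_le h.2 (by omega))

theorem inter_le_left (S T : Biset V) : S.inter T ≤ S := ⟨inter_subset_left, inter_subset_left⟩

theorem inter_le_right (S T : Biset V) : S.inter T ≤ T := ⟨inter_subset_right, inter_subset_right⟩

theorem diff_le (S T : Biset V) : S.diff T ≤ S := ⟨sdiff_subset, sdiff_subset⟩

theorem avoids_of_le_diff {S T : Biset V} (h : S ≤ S.diff T) : S.Avoids T :=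
  ⟨disjoint_left.2 fun _ hx => (mem_sdiff.1 (h.1 hx)).2,
    disjoint_left.2 fun _ hx => (mem_sdiff.1 (h.2 hx)).2⟩

theorem Avoids.symm {S T : Biset V} (h : S.Avoids T) : T.Avoids S := ⟨h.2.symm, h.1.symm⟩

end Biset

namespace Phase

section Witness

variable {V : Type*} [Fintype V] [DecidableEq V] {I : Phase V} {P B : Finset V} {S T C : Biset V}

/-- A biset that shows that the node `v` of `Y` is needed. -/
def IsWitness (I : Phase V) (Y : Finset V) (v : V) (S : Biset V) : Prop :=
  I.Deficient (Y.erase v) S ∧ v ∉ S.outer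

/-- Uncrossing makes the intersection or the difference deficient. Both lie below C, so minimality
makes that one equal to C. -/
theorem violated_le_or_avoids (hI : I.Valid) (hX : I.X ⊆ P) (hC : C ∈ I.violatedBisets P)
    (hS : I.Deficient P S) : C ≤ S ∨ C.Avoids S := by
  obtain ⟨h1, h2⟩ := (mem_violatedBisets hI hX).1 hC
  rcases h1.uncross hI hX hS with ⟨h, -⟩ | ⟨h, -⟩
  · exact Or.inl ((h2 h (C.inter_le_left S)).trans (C.inter_le_right S))
  · exact Or.inr (Biset.avoids_of_le_diff (h2 h (C.diff_le S)))

theorem exists_isWitness (hI : I.Valid) {Y : Finset V} (hX : I.X ⊆ Y) {v : V} (hvX : v ∉ I.X)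
    (hc : ¬ I.Covers (Y.erase v)) : ∃ S, I.IsWitness Y v S := by
  have hXe : I.X ⊆ Y.erase v := fun x hx => mem_erase.2 ⟨fun h => hvX (h ▸ hx), hX hx⟩
  rw [covers_iff hI hXe] at hc
  push Not at hc
  obtain ⟨S, hS⟩ := hc
  exact ⟨S.erase v, hS.erase hI hXe (notMem_erase _ _), by simp [Biset.erase]⟩

/-- The situation of the analysis: `P` has been selected before an iteration, and `B` is a minimal
set of nodes that completes `P` to a cover. -/
structure Completion (I : Phase V) (P B : Finset V) : Prop where
  valid : I.Valid
  subset : I.X ⊆ P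
  disjoint : Disjoint P B
  covers : I.Covers (P ∪ B)
  minimal : ∀ v ∈ B, ¬ I.Covers ((P ∪ B).erase v)

namespace Completion

variable (h : I.Completion P B) {u v : V}
include h

theorem notMem (hv : v ∈ B) : v ∉ P := fun hP => disjoint_left.1 h.disjoint hP hv

theorem subset_union : I.X ⊆ P ∪ B := h.subset.trans subset_union_left

theorem subset_erase (hv : v ∈ B) : P ⊆ (P ∪ B).erase v := fun _ hx =>
  mem_erase.2 ⟨fun hxv => h.notMem hv (hxv ▸ hx), mem_union_left _ hx⟩

theorem deficient (hv : v ∈ B) (hS : I.IsWitness (P ∪ B) v S) : I.Deficient P S :=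
  hS.1.anti (h.subset_erase hv)

/-- Every edge of `I.Gℓ` between nodes of P ∪ B that leaves the witness of v must end at v, since
the witness is still deficient without v. The whole structure of witnesses rests on this. -/
theorem eq_of_adj (hv : v ∈ B) (hS : I.IsWitness (P ∪ B) v S) {a b : V} (ha : a ∈ S.inner)
    (hb : b ∉ S.outer) (haY : a ∈ P ∪ B) (hbY : b ∈ P ∪ B) (hab : I.Gℓ.Adj a b) : b = v := by
  by_contra hbv
  refine hS.1.not_adj h.valid (h.subset.trans (h.subset_erase hv)) ha hb
    (mem_erase.2 ⟨?_, haY⟩) (mem_erase.2 ⟨hbv, hbY⟩) hab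
  rintro rfl
  exact hS.2 (S.sub ha)

theorem exists_adj (hS : I.Deficient P S) : ∃ a ∈ S.inner, ∃ b, b ∉ S.outer ∧
    a ∈ P ∪ B ∧ b ∈ P ∪ B ∧ I.Gℓ.Adj a b :=
  h.covers.exists_adj h.valid (hS.anti h.subset)

theorem exists_adj_self (hv : v ∈ B) (hS : I.IsWitness (P ∪ B) v S) :
    ∃ a ∈ S.inner, a ∈ P ∪ B ∧ I.Gℓ.Adj a v := by
  obtain ⟨a, ha, b, hb, haY, hbY, hab⟩ := h.exists_adj (h.deficient hv hS)
  rw [h.eq_of_adj hv hS ha hb haY hbY hab] at hab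
  exact ⟨a, ha, haY, hab⟩

/-- If all crossing edges between selected nodes touch v, none survives the removal of v from the
selection. The biset is then deficient again, and v may be erased from it. -/
theorem isWitness_erase (hv : v ∈ B) (hS : I.Deficient P S)
    (hadj : ∀ a ∈ S.inner, ∀ b, b ∉ S.outer → a ∈ P ∪ B → b ∈ P ∪ B → I.Gℓ.Adj a b →
      a = v ∨ b = v) : I.IsWitness (P ∪ B) v (S.erase v) := by
  have hXe := h.subset.trans (h.subset_erase hv)
  refine ⟨Deficient.erase h.valid hXe ?_ (notMem_erase _ _), by simp [Biset.erase]⟩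
  refine deficient_of_not_adj h.valid hXe (hS.anti h.subset) fun a ha b hb haY hbY hab => ?_
  rw [mem_erase] at haY hbY
  have := hadj a ha b hb haY.2 hbY.2 hab
  tauto

theorem isWitness_of_adj (hv : v ∈ B) (hS : I.Deficient P S) (hvS : v ∉ S.outer)
    (hadj : ∀ a ∈ S.inner, ∀ b, b ∉ S.outer → a ∈ P ∪ B → b ∈ P ∪ B → I.Gℓ.Adj a b →
      a = v ∨ b = v) : I.IsWitness (P ∪ B) v S := by
  have := h.isWitness_erase hv hS hadj
  have hi : v ∉ S.inner := fun h => hvS (S.sub h)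
  rwa [show S.erase v = S from Biset.ext (erase_eq_of_notMem hi) (erase_eq_of_notMem hvS)] at this

/-- Boundaries lie in X, hence in P, and are thus disjoint from B. -/
theorem mem_inner (hv : v ∈ B) (hS : I.Deficient P S) (hvS : v ∈ S.outer) : v ∈ S.inner := by
  by_contra hi
  exact h.notMem hv (h.subset (hS.bd_subset h.valid h.subset (Biset.mem_bd.2 ⟨hvS, hi⟩)))

/-- A choice of witnesses of minimum total size. -/
theorem exists_witnesses : ∃ W : V → Biset V, (∀ v ∈ B, I.IsWitness (P ∪ B) v (W v)) ∧
    ∀ u ∈ B, ∀ v ∈ B, u ≠ v → ∀ S T, I.IsWitness (P ∪ B) u S → I.IsWitness (P ∪ B) v T →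
      (W u).size + (W v).size ≤ S.size + T.size := by
  have hex : ∀ v : V, ∃ S, v ∈ B → I.IsWitness (P ∪ B) v S := by
    intro v
    by_cases hv : v ∈ B
    · obtain ⟨S, hS⟩ := exists_isWitness h.valid h.subset_union
        (fun hx => h.notMem hv (h.subset hx)) (h.minimal v hv)
      exact ⟨S, fun _ => hS⟩
    · exact ⟨⟨∅, ∅, subset_rfl⟩, fun h => absurd h hv⟩
  choose W₀ hW₀ using hex
  obtain ⟨W, hW, hmin⟩ := WellFounded.has_min
    (measure fun W : V → Biset V => ∑ v ∈ B, (W v).size).wf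
    {W | ∀ v ∈ B, I.IsWitness (P ∪ B) v (W v)} ⟨W₀, hW₀⟩
  refine ⟨W, hW, fun u hu v hv huv S T hS hT => ?_⟩
  by_contra hlt
  rw [not_le] at hlt
  refine hmin (Function.update (Function.update W u S) v T) ?_ ?_
  · intro x hx
    by_cases hxv : x = v
    · subst hxv
      rwa [Function.update_self]
    · rw [Function.update_of_ne hxv]
      by_cases hxu : x = u
      · subst hxu
        rwa [Function.update_self]
      · rw [Function.update_of_ne hxu]
        exact hW x hx
  · change ∑ x ∈ B, (Function.update (Function.update W u S) v T x).size < ∑ x ∈ B, (W x).size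
    have hu' : u ∈ B.erase v := mem_erase.2 ⟨huv, hu⟩
    rw [← add_sum_erase B _ hv, ← add_sum_erase _ _ hu', ← add_sum_erase B _ hv,
      ← add_sum_erase _ _ hu']
    rw [Function.update_self, Function.update_of_ne huv, Function.update_self]
    have : ∑ x ∈ (B.erase v).erase u, (Function.update (Function.update W u S) v T x).size =
        ∑ x ∈ (B.erase v).erase u, (W x).size := by
      refine sum_congr rfl fun x hx => ?_
      simp only [mem_erase] at hx
      rw [Function.update_of_ne hx.2.1, Function.update_of_ne hx.1]
    omega

/-- An edge leaving the intersection leaves T and ends at v, or ends inside T and leaves S. In the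
latter case it ends at u, which is not in T. So the intersection is a witness for v, and T was a
smallest one. -/
theorem le_of_inter (hu : u ∈ B) (hv : v ∈ B) (hS : I.IsWitness (P ∪ B) u S) (hT : I.IsWitness (P ∪ B) v T)
    (hST : I.Deficient P (S.inter T)) (huT : u ∉ T.outer)
    (hmin : ∀ T', I.IsWitness (P ∪ B) v T' → T.size ≤ T'.size) : T ≤ S := by
  have : I.IsWitness (P ∪ B) v (S.inter T) := by
    refine h.isWitness_of_adj hv hST (fun hx => hT.2 (mem_inter.1 hx).2) ?_
    intro a ha b hb haY hbY hab
    simp only [Biset.inter, mem_inter, not_and] at ha hb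
    right
    by_cases hbT : b ∈ T.outer
    · have hbS : b ∉ S.outer := fun h => hb h hbT
      have := h.eq_of_adj hu hS ha.1 hbS haY hbY hab
      exact absurd (this ▸ hbT) huT
    · exact h.eq_of_adj hv hT ha.2 hbT haY hbY hab
  have he := Biset.eq_of_le_of_size_le (S.inter_le_right T) (hmin _ this)
  rw [← he]
  exact S.inter_le_left T

/-- An edge leaving the difference leaves S and ends at u, or goes into the inner part of T. Read
backwards, the latter leaves T and ends at v, which is not inside S. So the difference is a witness
for u, no smaller than S. -/
theorem avoids_of_diff (hu : u ∈ B) (hv : v ∈ B)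
    (hS : I.IsWitness (P ∪ B) u S) (hT : I.IsWitness (P ∪ B) v T)
    (hST : I.Deficient P (S.diff T)) (hvS : v ∉ S.inner)
    (hmin : ∀ S', I.IsWitness (P ∪ B) u S' → S.size ≤ S'.size) : S.Avoids T := by
  have : I.IsWitness (P ∪ B) u (S.diff T) := by
    refine h.isWitness_of_adj hu hST (fun hx => hS.2 (mem_sdiff.1 hx).1) ?_
    intro a ha b hb haY hbY hab
    simp only [Biset.diff, mem_sdiff, not_and, not_not] at ha hb
    right
    by_cases hbS : b ∈ S.outer
    · have := h.eq_of_adj hv hT (hb hbS) ha.2 hbY haY hab.symm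
      exact absurd (this ▸ ha.1) hvS
    · exact h.eq_of_adj hu hS ha.1 hbS haY hbY hab
  have he := Biset.eq_of_le_of_size_le (S.diff_le T) (hmin _ this)
  exact Biset.avoids_of_le_diff he.ge

/-- With u inside T, every edge leaving the difference goes into T and so starts at v: the
difference obtained from the witness of u serves the other node v. -/
theorem isWitness_diff_erase (hu : u ∈ B) (hv : v ∈ B)
    (hS : I.IsWitness (P ∪ B) u S) (hT : I.IsWitness (P ∪ B) v T)
    (hST : I.Deficient P (S.diff T)) (huT : u ∈ T.inner) :
    I.IsWitness (P ∪ B) v ((S.diff T).erase v) := by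
  refine h.isWitness_erase hv hST ?_
  intro a ha b hb haY hbY hab
  simp only [Biset.diff, mem_sdiff, not_and, not_not] at ha hb
  left
  have hbT : b ∈ T.inner := by
    by_cases hbS : b ∈ S.outer
    · exact hb hbS
    · rwa [h.eq_of_adj hu hS ha.1 hbS haY hbY hab]
  exact h.eq_of_adj hv hT hbT ha.2 hbY haY hab.symm

/-- If intersection and union are deficient, some edge between selected nodes leaves the union. It
leaves one of the witnesses and ends at that witness's node, which then lies outside the other, so
`le_of_inter` gives nesting. In the difference case the witnesses avoid each other unless each
contains the other's node. -/
theorem laminar {W : V → Biset V} (hW : ∀ v ∈ B, I.IsWitness (P ∪ B) v (W v))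
    (hmin : ∀ u ∈ B, ∀ v ∈ B, u ≠ v → ∀ S T, I.IsWitness (P ∪ B) u S → I.IsWitness (P ∪ B) v T →
      (W u).size + (W v).size ≤ S.size + T.size) (hu : u ∈ B) (hv : v ∈ B) (huv : u ≠ v) :
    W u ≤ W v ∨ W v ≤ W u ∨ (W u).Avoids (W v) := by
  have hU := hW u hu
  have hV := hW v hv
  have mU : ∀ S', I.IsWitness (P ∪ B) u S' → (W u).size ≤ S'.size := fun S' hS' => by
    have := hmin u hu v hv huv S' _ hS' hV
    omega
  have mV : ∀ S', I.IsWitness (P ∪ B) v S' → (W v).size ≤ S'.size := fun S' hS' => by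
    have := hmin u hu v hv huv _ S' hU hS'
    omega
  rcases (h.deficient hu hU).uncross h.valid h.subset (h.deficient hv hV) with
    ⟨h1, h2⟩ | ⟨h1, h2⟩
  · obtain ⟨c, hc, d, hd, hcY, hdY, hcd⟩ := h.exists_adj h2
    simp only [Biset.union, mem_union, not_or] at hc hd
    rcases hc with hc | hc
    · have hdu := h.eq_of_adj hu hU hc hd.1 hcY hdY hcd
      exact Or.inr (Or.inl (h.le_of_inter hu hv hU hV h1 (hdu ▸ hd.2) mV))
    · have hdv := h.eq_of_adj hv hV hc hd.2 hcY hdY hcd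
      refine Or.inl (h.le_of_inter hv hu hV hU ?_ (hdv ▸ hd.1) mU)
      have : (W v).inter (W u) = (W u).inter (W v) :=
        Biset.ext (inter_comm _ _) (inter_comm _ _)
      rwa [this]
  · right; right
    by_cases hvU : v ∈ (W u).inner
    · by_cases huV : u ∈ (W v).inner
      · exfalso
        -- The two nodes exchange witnesses. What decreases is the sum of the sizes, strictly
        -- because v is erased from the inner part of `W u`.
        have e1 := h.isWitness_diff_erase hu hv hU hV h1 huV
        have e2 := h.isWitness_diff_erase hv hu hV hU h2 hvU
        have e3 := hmin u hu v hv huv _ _ e2 e1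
        have s1 : (((W u).diff (W v)).erase v).size < (W u).size := by
          have : #(((W u).diff (W v)).erase v).inner < #(W u).inner := by
            refine card_lt_card ⟨(erase_subset _ _).trans sdiff_subset, fun hs => ?_⟩
            exact notMem_erase _ _ (hs hvU)
          have : #(((W u).diff (W v)).erase v).outer ≤ #(W u).outer :=
            card_le_card ((erase_subset _ _).trans sdiff_subset)
          unfold Biset.size
          omega
        have s2 := Biset.size_mono ((((W v).diff (W u)).erase_le u).trans ((W v).diff_le (W u)))
        omega
      · exact (h.avoids_of_diff hv hu hV hU h2 huV mV).symm
    · exact h.avoids_of_diff hu hv hU hV h1 hvU mU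

end Completion

end Witness

end Phase

/-! ### Charging the nodes to the minimal violated bisets -/

namespace Phase

/-- Take the component, inside the inner part, of an end of a separated pair, together with the old
boundary. No edge joins it to the rest of the inner part, so it is deficient, and minimality makes
it everything. -/
theorem inner_connected_of_mem_violatedBisets {V : Type*} [Fintype V] [DecidableEq V] {I : Phase V}
    {P : Finset V} {C : Biset V} (hI : I.Valid) (hX : I.X ⊆ P) (hC : C ∈ I.violatedBisets P) :
    (I.G.induce (C.inner : Set V)).Connected := by
  classical
  obtain ⟨hd, hmin⟩ := (mem_violatedBisets hI hX).1 hC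
  obtain ⟨u, hu, t, ht, hr⟩ := hd.exists_pair hI
  let A : Finset V := C.inner.filter fun x =>
    ∃ hx : x ∈ C.inner, (I.G.induce (C.inner : Set V)).Reachable ⟨u, hu⟩ ⟨x, hx⟩
  have hAC : A ⊆ C.inner := filter_subset _ _
  have huA : u ∈ A := mem_filter.2 ⟨hu, hu, SimpleGraph.Reachable.refl _⟩
  let D : Biset V := ⟨A, A ∪ C.bd, subset_union_left⟩
  have hDC : D ≤ C := ⟨hAC, union_subset (hAC.trans C.sub) sdiff_subset⟩
  have hbd : D.bd ⊆ C.bd := by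
    intro x hx
    rw [Biset.mem_bd] at hx
    exact (mem_union.1 hx.1).resolve_left hx.2
  have hcut : D.cut (edgesWithin I.G P) ⊆ C.cut (edgesWithin I.G P) := by
    rintro ⟨a, b⟩ he
    rw [Biset.mem_cut] at he ⊢
    obtain ⟨ha, hb, hab⟩ := he
    refine ⟨hAC ha, fun hbC => hb ?_, hab⟩
    by_cases hbi : b ∈ C.inner
    · obtain ⟨ha1, ha2, ha3⟩ := mem_filter.1 ha
      refine mem_union_left _ (mem_filter.2 ⟨hbi, hbi, ha3.trans (SimpleGraph.Adj.reachable ?_)⟩)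
      exact hab.1
    · exact mem_union_right _ (Biset.mem_bd.2 ⟨hbC, hbi⟩)
  have hD : I.Deficient P D := by
    refine ⟨?_, (le_rElem_iff hI.one_le).2 ⟨u, huA, t, fun h => ht (hDC.2 h), hr⟩, ?_⟩
    · have := hd.1
      exact Disjoint.mono_left hbd this
    · have := card_le_card hbd
      have := card_le_card hcut
      have := hd.2.2
      omega
  have hCA : C.inner ⊆ A := (hmin hD hDC).1
  have hreach : ∀ x : (C.inner : Set V), (I.G.induce (C.inner : Set V)).Reachable ⟨u, hu⟩ x := by
    rintro ⟨x, hx⟩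
    exact (mem_filter.1 (hCA hx)).2.2
  have : Nonempty (C.inner : Set V) := ⟨⟨u, hu⟩⟩
  exact ⟨fun x y => (hreach x).symm.trans (hreach y)⟩

theorem avoids_of_ne {V : Type*} [Fintype V] [DecidableEq V] {I : Phase V}
    {P : Finset V} {C D : Biset V} (hI : I.Valid) (hX : I.X ⊆ P) (hC : C ∈ I.violatedBisets P)
    (hD : D ∈ I.violatedBisets P) (h : C ≠ D) : C.Avoids D := by
  refine (violated_le_or_avoids hI hX hC
    (deficient_of_mem_violatedBisets hI hX hD)).resolve_left fun hle => h ?_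
  exact hle.antisymm (((mem_violatedBisets hI hX).1 hD).2
    (deficient_of_mem_violatedBisets hI hX hC) hle)

open scoped Classical in
/-- The nodes of `B` next to a minimal violated biset. -/
noncomputable def boundaryNodes {V : Type*} [Fintype V] [DecidableEq V] (I : Phase V)
    (P B : Finset V) : Finset V :=
  B.filter fun v => ∃ C ∈ I.violatedBisets P, v ∈ C.nbr I.Gℓ

namespace Completion

section

variable {V : Type*} [Fintype V] [DecidableEq V] {I : Phase V} {P B : Finset V} {W : V → Biset V}
variable (h : I.Completion P B) (hW : ∀ v ∈ B, I.IsWitness (P ∪ B) v (W v))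
include h hW

/-- Let C be a minimal violated biset next to v. If C lies below `W v`, it lies below `W u`, and its
edge to v leaves `W u`, forcing v = u. If not, C avoids `W z`. Unless v = z, the node v is inside `W
z`, and the edge from v back to C leaves `W z` and forces a node of P to be z. -/
theorem not_between {u v z : V} (hu : u ∈ B) (hv : v ∈ I.boundaryNodes P B) (hz : z ∈ B)
    (huv : u ≠ v) (hvz : v ≠ z) (h1 : W u ≤ W v) (h2 : W v ≤ W z)
    (h3 : ∀ C ∈ I.violatedBisets P, C ≤ W v → C ≤ W u)
    (h4 : ∀ C ∈ I.violatedBisets P, C ≤ W z → C ≤ W v) : False := by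
  obtain ⟨hvB, C, hC, hvC⟩ := mem_filter.1 hv
  obtain ⟨hvo, x, hx, hxv⟩ := Biset.mem_nbr.1 hvC
  have hxP := inner_subset_of_mem_violatedBisets h.valid h.subset hC hx
  have hxY : x ∈ P ∪ B := mem_union_left _ hxP
  have hvY : v ∈ P ∪ B := mem_union_right _ hvB
  have hvW := (hW v hvB).2
  by_cases hle : C ≤ W v
  · have := h.eq_of_adj hu (hW u hu) ((h3 C hC hle).1 hx) (fun h => hvW (h1.2 h)) hxY hvY hxv
    exact huv this.symm
  · have hav := (violated_le_or_avoids h.valid h.subset hC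
      (h.deficient hz (hW z hz))).resolve_left fun hz => hle (h4 C hC hz)
    have hvz' : v ∈ (W z).inner := by
      refine h.mem_inner hvB (h.deficient hz (hW z hz)) ?_
      by_contra hvo
      obtain ⟨a, ha, haY, hav⟩ := h.exists_adj_self hvB (hW v hvB)
      exact hvz (h.eq_of_adj hz (hW z hz) (h2.1 ha) hvo haY hvY hav)
    have := h.eq_of_adj hz (hW z hz) hvz' (disjoint_left.1 hav.1 hx) hvY hxY hxv.symm
    exact h.notMem hz (this ▸ hxP)

end

section

variable {V : Type*} [Fintype V] [DecidableEq V] {I : Phase V} {P B : Finset V}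

/-- Send v to the set `K v` of minimal violated bisets below its witness. These sets form a laminar
family of nonempty sets, hence take at most twice as many values as there are such bisets. Nodes
with equal `K` have nested witnesses, and `not_between` leaves no room for three. -/
theorem card_boundaryNodes_le (h : I.Completion P B) :
    #(I.boundaryNodes P B) ≤ 4 * #(I.violatedBisets P) := by
  classical
  obtain ⟨W, hW, hmin⟩ := h.exists_witnesses
  have hNB : I.boundaryNodes P B ⊆ B := filter_subset _ _
  let K : V → Finset (Biset V) := fun v => (I.violatedBisets P).filter fun C => C ≤ W v
  have hKn : ∀ v ∈ B, (K v).Nonempty := by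
    intro v hv
    obtain ⟨C, hC, hle⟩ := (h.deficient hv (hW v hv)).exists_minimal h.valid h.subset
    exact ⟨C, mem_filter.2 ⟨hC, hle⟩⟩
  have hKmono : ∀ u v, W u ≤ W v → K u ⊆ K v := by
    intro u v huv C hC
    rw [mem_filter] at hC ⊢
    exact ⟨hC.1, hC.2.trans huv⟩
  have hKdis : ∀ u v, (W u).Avoids (W v) → Disjoint (K u) (K v) := by
    intro u v huv
    rw [disjoint_left]
    intro C hC hC'
    rw [mem_filter] at hC hC'
    obtain ⟨x, hx⟩ :=
      (deficient_of_mem_violatedBisets h.valid h.subset hC.1).inner_nonempty h.valid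
    exact disjoint_left.1 huv.1 (hC.2.1 hx) ((W v).sub (hC'.2.1 hx))
  have hlam : #((I.boundaryNodes P B).image K) ≤ 2 * #(I.violatedBisets P) := by
    refine card_le_two_mul_of_laminar _ _ ?_ ?_
    · intro A hA
      obtain ⟨v, hv, rfl⟩ := mem_image.1 hA
      exact ⟨hKn v (hNB hv), filter_subset _ _⟩
    · intro A hA A' hA'
      obtain ⟨u, hu, rfl⟩ := mem_image.1 hA
      obtain ⟨v, hv, rfl⟩ := mem_image.1 hA'
      by_cases huv : u = v
      · subst huv
        exact Or.inl subset_rfl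
      · rcases h.laminar hW hmin (hNB hu) (hNB hv) huv with h' | h' | h'
        · exact Or.inl (hKmono _ _ h')
        · exact Or.inr (Or.inl (hKmono _ _ h'))
        · exact Or.inr (Or.inr (hKdis _ _ h'))
  have hclass : ∀ k ∈ (I.boundaryNodes P B).image K,
      #((I.boundaryNodes P B).filter fun v => K v = k) ≤ 2 := by
    intro k _
    by_contra hlt
    obtain ⟨a, ha, b, hb, c, hc, hab, hac, hbc⟩ := two_lt_card.1 (not_le.1 hlt)
    rw [mem_filter] at ha hb hc
    have comp : ∀ u v, u ∈ I.boundaryNodes P B → v ∈ I.boundaryNodes P B → u ≠ v → K u = k →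
        K v = k → W u ≤ W v ∨ W v ≤ W u := by
      intro u v hu hv huv hku hkv
      rcases h.laminar hW hmin (hNB hu) (hNB hv) huv with h' | h' | h'
      · exact Or.inl h'
      · exact Or.inr h'
      · have := hKdis _ _ h'
        rw [hku, hkv, disjoint_self_iff_empty] at this
        exact absurd (hku ▸ this) (hKn u (hNB hu)).ne_empty
    have chain : ∀ u v z, u ∈ I.boundaryNodes P B → v ∈ I.boundaryNodes P B →
        z ∈ I.boundaryNodes P B → u ≠ v → v ≠ z → K u = k → K v = k → K z = k →
        W u ≤ W v → W v ≤ W z → False := by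
      intro u v z hu hv hz huv hvz hku hkv hkz h1 h2
      refine h.not_between hW (hNB hu) hv (hNB hz) huv hvz h1 h2 (fun C hC hle => ?_)
        fun C hC hle => ?_
      · have : C ∈ K v := mem_filter.2 ⟨hC, hle⟩
        rw [hkv, ← hku] at this
        exact (mem_filter.1 this).2
      · have : C ∈ K z := mem_filter.2 ⟨hC, hle⟩
        rw [hkz, ← hkv] at this
        exact (mem_filter.1 this).2
    -- Of three pairwise comparable witnesses, one lies between the other two.
    rcases comp a b ha.1 hb.1 hab ha.2 hb.2 with h1 | h1 <;>
      rcases comp b c hb.1 hc.1 hbc hb.2 hc.2 with h2 | h2 <;>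
      rcases comp a c ha.1 hc.1 hac ha.2 hc.2 with h3 | h3
    · exact chain a b c ha.1 hb.1 hc.1 hab hbc ha.2 hb.2 hc.2 h1 h2
    · exact chain a b c ha.1 hb.1 hc.1 hab hbc ha.2 hb.2 hc.2 h1 h2
    · exact chain a c b ha.1 hc.1 hb.1 hac hbc.symm ha.2 hc.2 hb.2 h3 h2
    · exact chain c a b hc.1 ha.1 hb.1 hac.symm hab hc.2 ha.2 hb.2 h3 h1
    · exact chain b a c hb.1 ha.1 hc.1 hab.symm hac hb.2 ha.2 hc.2 h1 h3
    · exact chain b c a hb.1 hc.1 ha.1 hbc hac.symm hb.2 hc.2 ha.2 h2 h3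
    · exact chain c b a hc.1 hb.1 ha.1 hbc.symm hab.symm hc.2 hb.2 ha.2 h2 h1
    · exact chain c b a hc.1 hb.1 ha.1 hbc.symm hab.symm hc.2 hb.2 ha.2 h2 h1
  have := card_le_mul_card_image (f := K) (I.boundaryNodes P B) 2 hclass
  omega

end

open scoped Classical in
/-- The bipartite graph of the minimal violated bisets and the nodes of `B` next to them. -/
def incidenceGraph {V : Type*} [Fintype V] [DecidableEq V] (I : Phase V) (P B : Finset V) :
    SimpleGraph ({C // C ∈ I.violatedBisets P} ⊕ {v // v ∈ I.boundaryNodes P B}) where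
  Adj
    | .inl C, .inr v => v.1 ∈ C.1.nbr I.Gℓ
    | .inr v, .inl C => v.1 ∈ C.1.nbr I.Gℓ
    | _, _ => False
  symm := ⟨by rintro (C | v) (D | u) h <;> exact h⟩
  loopless := ⟨by rintro (C | v) h <;> exact h⟩

/-- The branch sets are the inner parts, which are connected, pairwise disjoint and contained in P,
and the single nodes of B, which lie outside P. -/
theorem incidenceGraph_isMinor {V : Type*} [Fintype V] [DecidableEq V] {I : Phase V}
    {P B : Finset V} (h : I.Completion P B) : IsMinor (incidenceGraph I P B) I.G := by
  have hN : ∀ v : {v // v ∈ I.boundaryNodes P B}, v.1 ∉ P := fun v =>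
    h.notMem (mem_filter.1 v.2).1
  have hin : ∀ C : {C // C ∈ I.violatedBisets P}, C.1.inner ⊆ P := fun C =>
    inner_subset_of_mem_violatedBisets h.valid h.subset C.2
  refine ⟨Sum.elim (fun C => (C.1.inner : Set V)) fun v => {v.1}, ?_, ?_, ?_⟩
  · rintro (C | v)
    · exact inner_connected_of_mem_violatedBisets h.valid h.subset C.2
    · simp only [Sum.elim_inr]
      have : Nonempty ({v.1} : Set V) := ⟨⟨v.1, rfl⟩⟩
      refine ⟨fun x y => ?_⟩
      rw [Subsingleton.elim x y]
  · rintro (C | v) (D | u) hne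
    · simp only [Sum.elim_inl, disjoint_coe]
      have hCD : C.1 ≠ D.1 := fun he => hne (by rw [Subtype.ext he])
      exact (avoids_of_ne h.valid h.subset C.2 D.2 hCD).1.mono_right D.1.sub
    · simp only [Sum.elim_inl, Sum.elim_inr, Set.disjoint_singleton_right, mem_coe]
      exact fun hu => hN u (hin C hu)
    · simp only [Sum.elim_inl, Sum.elim_inr, Set.disjoint_singleton_left, mem_coe]
      exact fun hv => hN v (hin D hv)
    · simp only [Sum.elim_inr, Set.disjoint_singleton]
      exact fun he => hne (by rw [Subtype.ext he])
  · rintro (C | v) (D | u) hab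
    · exact hab.elim
    · obtain ⟨-, x, hx, hxu⟩ := Biset.mem_nbr.1 hab
      exact ⟨x, hx, u.1, rfl, hxu.1⟩
    · obtain ⟨-, x, hx, hxu⟩ := Biset.mem_nbr.1 hab
      exact ⟨v.1, rfl, x, hx, hxu.1.symm⟩
    · exact hab.elim

end Completion

/-- The incidence graph has at most (1 + 4) times as many nodes as there are minimal violated
bisets, which is where the 5 comes from. The edges seen from the biset side are all the sum needs.
-/
theorem chargeable {V : Type} [Fintype V] [DecidableEq V] {I : Phase V} {c : ℕ} (hI : I.Valid)
    (hc : ∀ (W : Type) [Fintype W] (K : SimpleGraph W), IsMinor K I.G →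
      #(adjPairs K) ≤ c * Fintype.card W) : I.Chargeable (5 * c) := by
  classical
  intro P B hX hd hcov hmin
  have h : I.Completion P B := ⟨hI, hX, hd, hcov, hmin⟩
  have h1 := hc _ _ (Completion.incidenceGraph_isMinor h)
  rw [Fintype.card_sum, Fintype.card_coe, Fintype.card_coe, card_adjPairs_eq_sum,
    Fintype.sum_sum_type] at h1
  have h2 := h.card_boundaryNodes_le
  have h3 : ∑ C ∈ I.violatedBisets P, #(C.nbr I.Gℓ ∩ B) ≤
      ∑ C : {C // C ∈ I.violatedBisets P},
        #(univ.filter fun y => (Completion.incidenceGraph I P B).Adj (Sum.inl C) y) := by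
    rw [← sum_coe_sort]
    refine sum_le_sum fun C _ => ?_
    have hsub : ∀ v ∈ C.1.nbr I.Gℓ ∩ B, v ∈ I.boundaryNodes P B := fun v hv => by
      rw [mem_inter] at hv
      exact mem_filter.2 ⟨hv.2, C.1, C.2, hv.1⟩
    rw [← card_attach]
    refine card_le_card_of_injOn (fun v => Sum.inr ⟨v.1, hsub v.1 v.2⟩) ?_ ?_
    · intro v _
      simp only [coe_filter, mem_univ, true_and, Set.mem_ofPred_eq]
      exact (mem_inter.1 v.2).1
    · intro u _ v _ huv
      have := Sum.inr.inj huv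
      exact Subtype.ext (Subtype.mk.inj this)
  have h4 : ∑ C ∈ I.violatedBisets P, #(C.nbr I.Gℓ ∩ B) ≤ 5 * c * #(I.violatedBisets P) := by
    refine h3.trans ((Nat.le_add_right _ _).trans (h1.trans ?_))
    rw [mul_comm 5 c, mul_assoc]
    exact Nat.mul_le_mul_left c (by omega)
  exact_mod_cast h4

end Phase

/-! ### Programs with bounded loops

A structured sublanguage of the machine language in which every loop is repeated a fixed multiple of
`n` times. Its programs have a total semantics and run in polynomial time. -/

namespace RAM

/-- Write `x` at entry `(i, j)` of a two-dimensional array. -/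
def upd {α : Type*} (f : ℕ → ℕ → α) (i j : ℕ) (x : α) : ℕ → ℕ → α :=
  fun i' j' => if i' = i ∧ j' = j then x else f i' j'

@[simp] theorem upd_self {α : Type*} (f : ℕ → ℕ → α) (i j : ℕ) (x : α) : upd f i j x i j = x := by
  simp [upd]

def setN (s : Store) (a i j x : ℕ) : Store := ⟨write s.nat a i j x, s.real⟩

def setR (s : Store) (a i j : ℕ) (x : ℝ) : Store := ⟨s.nat, write s.real a i j x⟩

@[simp] theorem setN_real (s : Store) (a i j x : ℕ) : (setN s a i j x).real = s.real := rfl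

@[simp] theorem setR_nat (s : Store) (a i j : ℕ) (x : ℝ) : (setR s a i j x).nat = s.nat := rfl

@[simp] theorem setN_nat_self (s : Store) (a i j x : ℕ) :
    (setN s a i j x).nat a = upd (s.nat a) i j x := by
  funext i' j'
  simp [setN, write, upd]

theorem setN_nat_ne (s : Store) {a b : ℕ} (h : b ≠ a) (i j x : ℕ) :
    (setN s a i j x).nat b = s.nat b := by
  funext i' j'
  simp [setN, write, h]

@[simp] theorem setR_real_self (s : Store) (a i j : ℕ) (x : ℝ) :
    (setR s a i j x).real a = upd (s.real a) i j x := by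
  funext i' j'
  simp [setR, write, upd]

theorem setR_real_ne (s : Store) {a b : ℕ} (h : b ≠ a) (i j : ℕ) (x : ℝ) :
    (setR s a i j x).real b = s.real b := by
  funext i' j'
  simp [setR, write, h]

inductive Cmd where
  | skip
  | setNat (a : ℕ) (i j e : NExp)
  | setReal (a : ℕ) (i j : NExp) (e : RExp)
  | seq (c₁ c₂ : Cmd)
  | ite (b : Test) (c₁ c₂ : Cmd)
  /-- Repeat `c` for the values `0, …, k * n - 1` of the counter `(a, 0, 0)`. -/
  | forTo (a k : ℕ) (c : Cmd)

/-- The scalar variable stored in the array `a`. -/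
abbrev NExp.var (a : ℕ) : NExp := .get a (.const 0) (.const 0)

/-- The entry `i` of the list stored in the array `a`. -/
abbrev NExp.list (a : ℕ) (i : NExp) : NExp := .get a i (.const 0)

/-- The multiple `k * n` of the size of the graph. -/
def NExp.bound : ℕ → NExp
  | 0 => .const 0
  | k + 1 => .plus (bound k) (.var 0)

theorem NExp.eval_bound (s : Store) (k : ℕ) : (NExp.bound k).eval s = k * s.nat 0 0 0 := by
  induction k with
  | zero => simp [NExp.bound, NExp.eval]
  | succ k ih => simp [NExp.bound, NExp.eval, ih, Nat.succ_mul]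

namespace Cmd

/-- Set a scalar variable. -/
abbrev setVar (a : ℕ) (e : NExp) : Cmd := .setNat a (.const 0) (.const 0) e

def block : List Cmd → Cmd
  | [] => .skip
  | c :: l => .seq c (block l)

/-- Each test of a loop recomputes the bound k * n from the cell that holds n, by repeated addition
because the machine cannot multiply. Array 0 must therefore stay untouched. -/
def compile : Cmd → Program
  | skip => .skip
  | setNat a i j e => .setNat a i j e
  | setReal a i j e => .setReal a i j e
  | seq c₁ c₂ => .seq c₁.compile c₂.compile
  | ite b c₁ c₂ => .branch b c₁.compile c₂.compile
  | forTo a k c =>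
      .seq (.setNat a (.const 0) (.const 0) (.const 0))
        (.loop (.natLe (.plus (.var a) (.const 1)) (.bound k))
          (.seq c.compile (.setNat a (.const 0) (.const 0) (.plus (.var a) (.const 1)))))

open scoped Classical in
noncomputable def exec (n : ℕ) : Cmd → Store → Store
  | skip, s => s
  | setNat a i j e, s => setN s a (i.eval s) (j.eval s) (e.eval s)
  | setReal a i j e, s => setR s a (i.eval s) (j.eval s) (e.eval s)
  | seq c₁ c₂, s => c₂.exec n (c₁.exec n s)
  | ite b c₁ c₂, s => if b.holds s then c₁.exec n s else c₂.exec n s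
  | forTo a k c, s =>
      (fun s => setN (c.exec n s) a 0 0 ((c.exec n s).nat a 0 0 + 1))^[k * n] (setN s a 0 0 0)

/-- The arrays of natural numbers to which a program may write. -/
def nwrites : Cmd → ℕ → Bool
  | skip, _ => false
  | setNat a _ _ _, b => a == b
  | setReal _ _ _ _, _ => false
  | seq c₁ c₂, b => c₁.nwrites b || c₂.nwrites b
  | ite _ c₁ c₂, b => c₁.nwrites b || c₂.nwrites b
  | forTo a _ c, b => a == b || c.nwrites b

/-- The arrays of real numbers to which a program may write. -/
def rwrites : Cmd → ℕ → Bool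
  | skip, _ => false
  | setNat _ _ _ _, _ => false
  | setReal a _ _ _, b => a == b
  | seq c₁ c₂, b => c₁.rwrites b || c₂.rwrites b
  | ite _ c₁ c₂, b => c₁.rwrites b || c₂.rwrites b
  | forTo _ _ c, b => c.rwrites b

/-- No loop changes its own counter. -/
def wf : Cmd → Bool
  | skip => true
  | setNat _ _ _ _ => true
  | setReal _ _ _ _ => true
  | seq c₁ c₂ => c₁.wf && c₂.wf
  | ite _ c₁ c₂ => c₁.wf && c₂.wf
  | forTo a _ c => !c.nwrites a && c.wf

/-- A pass of a loop costs two steps besides its body, the test and the increment. The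
initialisation and the failing last test give the final 2. -/
noncomputable def time : Cmd → Polynomial ℕ
  | skip => 1
  | setNat _ _ _ _ => 1
  | setReal _ _ _ _ => 1
  | seq c₁ c₂ => c₁.time + c₂.time
  | ite _ c₁ c₂ => c₁.time + c₂.time + 1
  | forTo _ k c => Polynomial.C k * Polynomial.X * (c.time + 2) + 2

/-! ### Frame rules, loop induction and running time of structured programs -/

@[simp] theorem exec_block_nil (n : ℕ) (s : Store) : (block []).exec n s = s := rfl

@[simp] theorem exec_block_cons (n : ℕ) (c : Cmd) (l : List Cmd) (s : Store) :
    (block (c :: l)).exec n s = (block l).exec n (c.exec n s) := rfl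

@[simp] theorem exec_setNat (n a : ℕ) (i j e : NExp) (s : Store) :
    (setNat a i j e).exec n s = setN s a (i.eval s) (j.eval s) (e.eval s) := rfl

@[simp] theorem exec_setReal (n a : ℕ) (i j : NExp) (e : RExp) (s : Store) :
    (setReal a i j e).exec n s = setR s a (i.eval s) (j.eval s) (e.eval s) := rfl

open scoped Classical in
theorem exec_ite (n : ℕ) (b : Test) (c₁ c₂ : Cmd) (s : Store) :
    (ite b c₁ c₂).exec n s = if b.holds s then c₁.exec n s else c₂.exec n s := rfl

@[simp] theorem exec_skip (n : ℕ) (s : Store) : skip.exec n s = s := rfl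

/-- Frame rule. Since `nwrites` computes, its hypothesis holds by `rfl` or `decide` for concrete
programs. -/
theorem exec_nat_eq {n : ℕ} {c : Cmd} {b : ℕ} (h : c.nwrites b = false) (s : Store) :
    (c.exec n s).nat b = s.nat b := by
  induction c generalizing s with
  | skip => rfl
  | setNat a i j e =>
    simp only [nwrites, beq_eq_false_iff_ne] at h
    exact setN_nat_ne s h.symm _ _ _
  | setReal => rfl
  | seq c₁ c₂ ih₁ ih₂ =>
    simp only [nwrites, Bool.or_eq_false_iff] at h
    exact (ih₂ h.2 _).trans (ih₁ h.1 _)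
  | ite t c₁ c₂ ih₁ ih₂ =>
    simp only [nwrites, Bool.or_eq_false_iff] at h
    rw [exec_ite]
    split_ifs
    · exact ih₁ h.1 s
    · exact ih₂ h.2 s
  | forTo a k c ih =>
    simp only [nwrites, Bool.or_eq_false_iff, beq_eq_false_iff_ne] at h
    rw [exec]
    generalize k * n = m
    rw [← setN_nat_ne s h.1.symm 0 0 0]
    generalize setN s a 0 0 0 = s
    induction m generalizing s with
    | zero => rfl
    | succ m ihm =>
      rw [Function.iterate_succ_apply, ihm, setN_nat_ne _ h.1.symm, ih h.2]

theorem exec_real_eq {n : ℕ} {c : Cmd} {b : ℕ} (h : c.rwrites b = false) (s : Store) :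
    (c.exec n s).real b = s.real b := by
  induction c generalizing s with
  | skip => rfl
  | setNat a i j e => rfl
  | setReal a i j e =>
    simp only [rwrites, beq_eq_false_iff_ne] at h
    exact setR_real_ne s h.symm _ _ _
  | seq c₁ c₂ ih₁ ih₂ =>
    simp only [rwrites, Bool.or_eq_false_iff] at h
    exact (ih₂ h.2 _).trans (ih₁ h.1 _)
  | ite t c₁ c₂ ih₁ ih₂ =>
    simp only [rwrites, Bool.or_eq_false_iff] at h
    rw [exec_ite]
    split_ifs
    · exact ih₁ h.1 s
    · exact ih₂ h.2 s
  | forTo a k c ih =>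
    simp only [rwrites] at h
    rw [exec]
    generalize k * n = m
    rw [← setN_real s a 0 0 0]
    generalize setN s a 0 0 0 = s
    induction m generalizing s with
    | zero => rfl
    | succ m ihm => rw [Function.iterate_succ_apply, ihm, setN_real, ih h]

/-- The induction principle for loops: besides the invariant `Q`, the arrays to which the loop does
not write may be assumed to have their original values. -/
theorem exec_forTo {n a k : ℕ} {c : Cmd} {s : Store} (Q : ℕ → Store → Prop)
    (hw : c.nwrites a = false) (h0 : Q 0 (setN s a 0 0 0))
    (hs : ∀ i < k * n, ∀ s' : Store, s'.nat a 0 0 = i →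
      (∀ b, b ≠ a → c.nwrites b = false → s'.nat b = s.nat b) →
      (∀ b, c.rwrites b = false → s'.real b = s.real b) →
      Q i s' → Q (i + 1) (setN (c.exec n s') a 0 0 (i + 1))) :
    Q (k * n) ((forTo a k c).exec n s) := by
  have key : ∀ m ≤ k * n,
      ((fun s => setN (c.exec n s) a 0 0 ((c.exec n s).nat a 0 0 + 1))^[m] (setN s a 0 0 0)).nat
        a 0 0 = m ∧
      (∀ b, b ≠ a → c.nwrites b = false →
        ((fun s => setN (c.exec n s) a 0 0 ((c.exec n s).nat a 0 0 + 1))^[m]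
          (setN s a 0 0 0)).nat b = s.nat b) ∧
      (∀ b, c.rwrites b = false →
        ((fun s => setN (c.exec n s) a 0 0 ((c.exec n s).nat a 0 0 + 1))^[m]
          (setN s a 0 0 0)).real b = s.real b) ∧
      Q m ((fun s => setN (c.exec n s) a 0 0 ((c.exec n s).nat a 0 0 + 1))^[m]
        (setN s a 0 0 0)) := by
    intro m
    induction m with
    | zero =>
      intro _
      exact ⟨by simp, fun b hb _ => setN_nat_ne s hb _ _ _, fun b _ => by simp, h0⟩
    | succ m ih =>
      intro hm
      obtain ⟨h1, h2, h3, h4⟩ := ih (by omega)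
      rw [Function.iterate_succ_apply']
      set s' := (fun s => setN (c.exec n s) a 0 0 ((c.exec n s).nat a 0 0 + 1))^[m]
        (setN s a 0 0 0)
      have e : (c.exec n s').nat a 0 0 = m := by rw [exec_nat_eq hw, h1]
      refine ⟨by simp [e], fun b hb hbw => ?_, fun b hb => ?_, ?_⟩
      · rw [setN_nat_ne _ hb, exec_nat_eq hbw, h2 b hb hbw]
      · rw [setN_real, exec_real_eq hb, h3 b hb]
      · rw [e]
        exact hs m (by omega) s' h1 h2 h3 h4
  exact (key (k * n) le_rfl).2.2.2

/-- As no loop touches its own counter or the cell holding n, the compiled loop makes exactly the k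
* n passes that `exec` prescribes. -/
theorem run_compile {n : ℕ} {c : Cmd} (hwf : c.wf = true) (h0 : c.nwrites 0 = false) (s : Store)
    (hs : s.nat 0 0 0 = n) : ∃ t ≤ c.time.eval n, Run c.compile s (c.exec n s) t := by
  induction c generalizing s with
  | skip => exact ⟨1, by simp [time], Run.skip s⟩
  | setNat a i j e => exact ⟨1, by simp [time], Run.setNat a i j e s⟩
  | setReal a i j e => exact ⟨1, by simp [time], Run.setReal a i j e s⟩
  | seq c₁ c₂ ih₁ ih₂ =>
    simp only [wf, Bool.and_eq_true] at hwf
    simp only [nwrites, Bool.or_eq_false_iff] at h0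
    obtain ⟨t₁, ht₁, h₁⟩ := ih₁ hwf.1 h0.1 s hs
    obtain ⟨t₂, ht₂, h₂⟩ := ih₂ hwf.2 h0.2 (c₁.exec n s) (by rw [exec_nat_eq h0.1, hs])
    exact ⟨t₁ + t₂, by simp only [time, Polynomial.eval_add]; omega, Run.seq h₁ h₂⟩
  | ite b c₁ c₂ ih₁ ih₂ =>
    simp only [wf, Bool.and_eq_true] at hwf
    simp only [nwrites, Bool.or_eq_false_iff] at h0
    rw [exec_ite]
    split_ifs with hb
    · obtain ⟨t, ht, h⟩ := ih₁ hwf.1 h0.1 s hs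
      exact ⟨t + 1, by simp only [time, Polynomial.eval_add, Polynomial.eval_one]; omega,
        Run.branchTrue hb h⟩
    · obtain ⟨t, ht, h⟩ := ih₂ hwf.2 h0.2 s hs
      exact ⟨t + 1, by simp only [time, Polynomial.eval_add, Polynomial.eval_one]; omega,
        Run.branchFalse hb h⟩
  | forTo a k c ih =>
    simp only [wf, Bool.and_eq_true, Bool.not_eq_true'] at hwf
    simp only [nwrites, Bool.or_eq_false_iff, beq_eq_false_iff_ne] at h0
    have loop : ∀ m i : ℕ, m + i = k * n → ∀ s : Store, s.nat 0 0 0 = n → s.nat a 0 0 = i →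
        ∃ t ≤ m * (c.time.eval n + 2) + 1,
          Run (.loop (.natLe (.plus (.var a) (.const 1)) (.bound k))
            (.seq c.compile (.setNat a (.const 0) (.const 0) (.plus (.var a) (.const 1))))) s
            ((fun s => setN (c.exec n s) a 0 0 ((c.exec n s).nat a 0 0 + 1))^[m] s) t := by
      intro m
      induction m with
      | zero =>
        intro i hi s hs hsi
        refine ⟨1, by omega, Run.loopFalse ?_⟩
        simp only [Test.holds, NExp.eval, NExp.eval_bound, hs, hsi]
        omega
      | succ m ihm =>
        intro i hi s hs hsi
        obtain ⟨t, ht, h⟩ := ih hwf.2 h0.2 s hs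
        obtain ⟨t', ht', h'⟩ := ihm (i + 1) (by omega)
          (setN (c.exec n s) a 0 0 ((c.exec n s).nat a 0 0 + 1))
          (by rw [setN_nat_ne _ h0.1.symm, exec_nat_eq h0.2, hs])
          (by rw [setN_nat_self, upd_self, exec_nat_eq hwf.1, hsi])
        refine ⟨(t + 1) + t' + 1, ?_, Run.loopTrue ?_ (Run.seq h ?_) h'⟩
        · rw [Nat.succ_mul]
          omega
        · simp only [Test.holds, NExp.eval, NExp.eval_bound, hs, hsi]
          omega
        · exact Run.setNat a (.const 0) (.const 0) (.plus (.var a) (.const 1)) (c.exec n s)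
    obtain ⟨t, ht, h⟩ := loop (k * n) 0 (by omega) (setN s a 0 0 0)
      (by rw [setN_nat_ne _ h0.1.symm, hs]) (by simp)
    refine ⟨1 + t, ?_, Run.seq (Run.setNat a (.const 0) (.const 0) (.const 0) s) h⟩
    simp only [time, Polynomial.eval_add, Polynomial.eval_mul, Polynomial.eval_C,
      Polynomial.eval_X, Polynomial.eval_ofNat]
    omega

end Cmd

end RAM

/-! ### Residual networks -/

namespace RAM

open scoped Classical in
/-- The capacity of the cut `S` in the network with nodes `0, …, N - 1`. -/
noncomputable def cutCap (N : ℕ) (c : ℕ → ℕ → ℕ) (S : Set ℕ) : ℕ :=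
  ∑ a ∈ range N, ∑ b ∈ range N, if a ∈ S ∧ b ∉ S then c a b else 0

open scoped Classical in
-- Pushing a unit along ab changes the capacity of S by [b ∈ S] - [a ∈ S], a quantity that
-- telescopes along a path. Flows need not be defined: the effect of residual updates on cuts is
-- enough.
theorem cutCap_push {N : ℕ} {c : ℕ → ℕ → ℕ} {a b : ℕ} (ha : a < N) (hb : b < N) (hab : a ≠ b)
    (hc : 1 ≤ c a b) (S : Set ℕ) :
    cutCap N (upd (upd c a b (c a b - 1)) b a (c b a + 1)) S + (if a ∈ S then 1 else 0) =
      cutCap N c S + (if b ∈ S then 1 else 0) := by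
  have ind : ∀ {x y : ℕ}, x < N → y < N → (if x ∈ S ∧ y ∉ S then 1 else 0) =
      ∑ a ∈ range N, ∑ b ∈ range N, if a ∈ S ∧ b ∉ S then (if a = x ∧ b = y then 1 else 0) else 0 := by
    intro x y hx hy
    rw [sum_eq_single x, sum_eq_single y]
    · simp
    · intro b _ hb
      simp [hb]
    · simp [hy]
    · intro a _ ha
      simp [ha]
    · simp [hx]
  have key : cutCap N (upd (upd c a b (c a b - 1)) b a (c b a + 1)) S +
      (if a ∈ S ∧ b ∉ S then 1 else 0) = cutCap N c S + (if b ∈ S ∧ a ∉ S then 1 else 0) := by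
    rw [ind ha hb, ind hb ha, cutCap, cutCap, ← sum_add_distrib, ← sum_add_distrib]
    refine sum_congr rfl fun x _ => ?_
    rw [← sum_add_distrib, ← sum_add_distrib]
    refine sum_congr rfl fun y _ => ?_
    by_cases h : x ∈ S ∧ y ∉ S
    · simp only [upd, if_pos h]
      grind
    · simp only [if_neg h]
  by_cases h1 : a ∈ S <;> by_cases h2 : b ∈ S <;> simp_all

theorem cutCap_eq_zero {N : ℕ} {c : ℕ → ℕ → ℕ} {S : Set ℕ} (h : cutCap N c S = 0) {a b : ℕ}
    (ha : a < N) (hb : b < N) (haS : a ∈ S) (hbS : b ∉ S) : c a b = 0 := by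
  rw [cutCap, sum_eq_zero_iff] at h
  have := sum_eq_zero_iff.1 (h a (mem_range.2 ha)) b (mem_range.2 hb)
  simpa [haS, hbS] using this

theorem cutCap_eq_zero_of {N : ℕ} {c : ℕ → ℕ → ℕ} {S : Set ℕ}
    (h : ∀ a < N, ∀ b < N, a ∈ S → b ∉ S → c a b = 0) : cutCap N c S = 0 := by
  rw [cutCap]
  refine sum_eq_zero fun a ha => sum_eq_zero fun b hb => ?_
  split_ifs with hab
  · exact h a (mem_range.1 ha) b (mem_range.1 hb) hab.1 hab.2
  · rfl

/-- A partial search tree rooted at `src`: `r x` is one more than the round in which `x` was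
reached, or `0`, and `p x` is the predecessor of `x`. -/
structure IsTree (N : ℕ) (c : ℕ → ℕ → ℕ) (src : ℕ) (k : ℕ) (r p : ℕ → ℕ) : Prop where
  root : r src = 1
  eq_root : ∀ x < N, r x = 1 → x = src
  le : ∀ x < N, r x ≤ k + 1
  pred : ∀ x < N, 2 ≤ r x → p x < N ∧ 1 ≤ r (p x) ∧ r (p x) < r x ∧ 1 ≤ c (p x) x

/-- No arc leaves the set of the reached nodes. -/
def IsClosed (N : ℕ) (c : ℕ → ℕ → ℕ) (r : ℕ → ℕ) : Prop :=
  ∀ a < N, ∀ b < N, 1 ≤ r a → r b = 0 → c a b = 0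

/-- A set that no residual arc leaves and that contains the source contains all reached nodes. This
makes the reached set the least minimum cut. -/
theorem IsTree.mem_of_cutCap_eq_zero {N : ℕ} {c : ℕ → ℕ → ℕ} {src k : ℕ} {r p : ℕ → ℕ}
    (h : IsTree N c src k r p) {S : Set ℕ} (hS : cutCap N c S = 0) (hsrc : src ∈ S) :
    ∀ x < N, 1 ≤ r x → x ∈ S := by
  intro x
  induction hm : r x using Nat.strong_induction_on generalizing x with
  | _ m ih =>
    intro hx h1
    by_cases h2 : m = 1
    · rw [h.eq_root x hx (by omega)]
      exact hsrc
    · obtain ⟨p1, p2, p3, p4⟩ := h.pred x hx (by omega)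
      have hp := ih _ (by omega) (p x) rfl p1 p2
      by_contra hxS
      have := cutCap_eq_zero hS p1 hx hp hxS
      omega

/-- One round of the search: from `r₀, p₀` to `r, p`. -/
structure IsRound (N : ℕ) (c : ℕ → ℕ → ℕ) (k : ℕ) (r₀ p₀ r p : ℕ → ℕ) (done : ℕ → ℕ → Prop) :
    Prop where
  old : ∀ x < N, 1 ≤ r₀ x → r x = r₀ x ∧ p x = p₀ x
  new : ∀ x < N, r₀ x = 0 → r x = 0 ∨
    (r x = k + 2 ∧ p x < N ∧ 1 ≤ r₀ (p x) ∧ 1 ≤ c (p x) x)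
  done : ∀ a b, done a b → 1 ≤ r₀ a → 1 ≤ c a b → 1 ≤ r b

/-- As long as the reached set is not closed, a round adds a node to it. This yields the
alternative: closed, or at least as many nodes as rounds. -/
theorem IsTree.round {N : ℕ} {c : ℕ → ℕ → ℕ} {src k : ℕ} {r₀ p₀ r p : ℕ → ℕ} (hsrc : src < N)
    (h : IsTree N c src k r₀ p₀) (hr : IsRound N c k r₀ p₀ r p fun a b => a < N ∧ b < N) :
    IsTree N c src (k + 1) r p ∧
      (IsClosed N c r₀ ∨ k + 1 ≤ #((range N).filter fun x => 1 ≤ r₀ x) →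
        IsClosed N c r ∨ k + 2 ≤ #((range N).filter fun x => 1 ≤ r x)) := by
  have hle := h.le
  refine ⟨⟨?_, ?_, ?_, ?_⟩, ?_⟩
  · rw [(hr.old src hsrc (by rw [h.root])).1, h.root]
  · intro x hxN hx
    by_cases h0 : 1 ≤ r₀ x
    · exact h.eq_root x hxN (by rw [← (hr.old x hxN h0).1, hx])
    · have := hr.new x hxN (by omega)
      omega
  · intro x hxN
    by_cases h0 : 1 ≤ r₀ x
    · have := hr.old x hxN h0
      have := hle x hxN
      omega
    · have := hr.new x hxN (by omega)
      omega
  · intro x hxN hx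
    by_cases h0 : 1 ≤ r₀ x
    · obtain ⟨e1, e2⟩ := hr.old x hxN h0
      obtain ⟨p1, p2, p3, p4⟩ := h.pred x hxN (by omega)
      rw [e2, e1, (hr.old _ p1 p2).1]
      exact ⟨p1, p2, p3, p4⟩
    · obtain hn | ⟨n1, n3, n4, n5⟩ := hr.new x hxN (by omega)
      · omega
      · have := hle (p x) n3
        rw [(hr.old _ n3 n4).1]
        exact ⟨n3, n4, by omega, n5⟩
  · have hsub : (range N).filter (fun x => 1 ≤ r₀ x) ⊆ (range N).filter (fun x => 1 ≤ r x) := by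
      intro x hx
      rw [mem_filter, mem_range] at hx ⊢
      exact ⟨hx.1, by rw [(hr.old x hx.1 hx.2).1]; exact hx.2⟩
    by_cases hcl : IsClosed N c r₀
    · intro _
      left
      have hsame : ∀ x < N, r₀ x = 0 → r x = 0 := by
        intro x hxN hx
        rcases hr.new x hxN hx with h' | ⟨-, h3, h4, h5⟩
        · exact h'
        · have := hcl _ h3 _ hxN h4 hx
          omega
      intro a ha b hb hra hrb
      have hb0 : r₀ b = 0 := by
        by_contra hne
        have := hr.old b hb (by omega)
        omega
      refine hcl a ha b hb ?_ hb0
      by_contra hne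
      have := hsame a ha (by omega)
      omega
    · rintro (h' | h')
      · exact absurd h' hcl
      · right
        unfold IsClosed at hcl
        push Not at hcl
        obtain ⟨a, ha, b, hb, h1, h2, h3⟩ := hcl
        have hb1 := hr.done a b ⟨ha, hb⟩ h1 (by omega)
        have := card_lt_card (Finset.ssubset_iff_subset_ne.2 ⟨hsub, fun he => by
          have : b ∈ (range N).filter (fun x => 1 ≤ r x) := by simp [hb, hb1]
          rw [← he] at this
          simp [h2] at this⟩)
        omega

/-! ### The search program -/

open Cmd NExp

namespace Cmd

/-- Reached nodes in array `9`, predecessors in array `10`, capacities in array `8`, the source in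
array `20`. -/
def search : Cmd := block
  [ forTo 30 2 (setNat 9 (var 30) (const 0) (const 0)),
    setNat 9 (var 20) (const 0) (const 1),
    forTo 31 2 (forTo 32 2 (forTo 33 2 (ite
      (.conj (.natLe (const 1) (list 9 (var 32)))
        (.conj (.natLe (list 9 (var 32)) (plus (var 31) (const 1)))
          (.conj (.natLe (list 9 (var 33)) (const 0)) (.natLe (const 1) (get 8 (var 32) (var 33))))))
      (block [setNat 9 (var 33) (const 0) (plus (var 31) (const 2)),
        setNat 10 (var 33) (const 0) (var 32)]) skip))) ]

/-- The state of the search. -/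
def SearchInv (n : ℕ) (s₀ : Store) (k : ℕ) (r p : ℕ → ℕ) : Prop :=
  IsTree (2 * n) (s₀.nat 8) (s₀.nat 20 0 0) k r p ∧
    (IsClosed (2 * n) (s₀.nat 8) r ∨ k + 1 ≤ #((range (2 * n)).filter fun x => 1 ≤ r x))

theorem exec_search {n : ℕ} {s : Store} (hsrc : s.nat 20 0 0 < 2 * n) :
    IsTree (2 * n) (s.nat 8) (s.nat 20 0 0) (2 * n) (fun x => (search.exec n s).nat 9 x 0)
      (fun x => (search.exec n s).nat 10 x 0) ∧
    IsClosed (2 * n) (s.nat 8) fun x => (search.exec n s).nat 9 x 0 := by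
  suffices h : SearchInv n s (2 * n) (fun x => (search.exec n s).nat 9 x 0)
      (fun x => (search.exec n s).nat 10 x 0) by
    -- After 2n rounds the second alternative would require 2n + 1 reached nodes among 2n.
    refine ⟨h.1, h.2.resolve_right fun hlt => ?_⟩
    have := hlt.trans (card_filter_le _ _)
    rw [card_range] at this
    omega
  rw [search, exec_block_cons, exec_block_cons, exec_block_cons, exec_block_nil]
  have h1 : ∀ x < 2 * n, ((forTo 30 2 (setNat 9 (var 30) (const 0) (const 0))).exec n s).nat 9 x 0
      = 0 := by
    refine exec_forTo (fun i s' => ∀ x < i, s'.nat 9 x 0 = 0) rfl (by simp) ?_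
    intro i _ s' hi _ _ hQ x hx
    rw [setN_nat_ne _ (by decide)]
    simp only [exec_setNat, NExp.eval, setN_nat_self, upd, hi]
    have := hQ x
    grind
  have f20 := exec_nat_eq (n := n)
    (c := forTo 30 2 (setNat 9 (var 30) (const 0) (const 0))) (b := 20) rfl s
  have f8 := exec_nat_eq (n := n)
    (c := forTo 30 2 (setNat 9 (var 30) (const 0) (const 0))) (b := 8) rfl s
  set s₁ := (forTo 30 2 (setNat 9 (var 30) (const 0) (const 0))).exec n s
  have h2 : ∀ x < 2 * n, ((setNat 9 (var 20) (const 0) (const 1)).exec n s₁).nat 9 x 0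
      = if x = s.nat 20 0 0 then 1 else 0 := by
    intro x hx
    simp only [exec_setNat, NExp.eval, setN_nat_self, upd, f20, and_true]
    rw [h1 x hx]
  have g20 := exec_nat_eq (n := n)
    (c := setNat 9 (var 20) (const 0) (const 1)) (b := 20) rfl s₁
  have g8 := exec_nat_eq (n := n)
    (c := setNat 9 (var 20) (const 0) (const 1)) (b := 8) rfl s₁
  set s₂ := (setNat 9 (var 20) (const 0) (const 1)).exec n s₁
  refine exec_forTo (fun k s' => SearchInv n s k (fun x => s'.nat 9 x 0) fun x => s'.nat 10 x 0)
    rfl ?_ ?_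
  · simp only [setN_nat_ne _ (show 9 ≠ 31 by decide), setN_nat_ne _ (show 10 ≠ 31 by decide)]
    refine ⟨⟨?_, ?_, ?_, ?_⟩, Or.inr ?_⟩
    · rw [h2 _ hsrc, if_pos rfl]
    · intro x hx
      rw [h2 x hx]
      split_ifs with he <;> simp [he]
    · intro x hx
      rw [h2 x hx]
      split_ifs <;> simp
    · intro x hx
      rw [h2 x hx]
      split_ifs <;> simp
    · refine card_pos.2 ⟨s.nat 20 0 0, ?_⟩
      rw [mem_filter, mem_range]
      exact ⟨hsrc, by beta_reduce; rw [h2 _ hsrc, if_pos rfl]⟩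
  · intro k hk s' hk' fN _ hQ
    have c8 : s'.nat 8 = s.nat 8 := by rw [fN 8 (by decide) rfl, g8, f8]
    simp only [setN_nat_ne _ (show 9 ≠ 31 by decide), setN_nat_ne _ (show 10 ≠ 31 by decide)]
    suffices hr : IsRound (2 * n) (s.nat 8) k (fun x => s'.nat 9 x 0) (fun x => s'.nat 10 x 0)
        (fun x => ((forTo 32 2 (forTo 33 2 (ite
      (.conj (.natLe (const 1) (list 9 (var 32)))
        (.conj (.natLe (list 9 (var 32)) (plus (var 31) (const 1)))
          (.conj (.natLe (list 9 (var 33)) (const 0)) (.natLe (const 1) (get 8 (var 32) (var 33))))))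
      (block [setNat 9 (var 33) (const 0) (plus (var 31) (const 2)),
        setNat 10 (var 33) (const 0) (var 32)]) skip))).exec n s').nat 9 x 0)
        (fun x => ((forTo 32 2 (forTo 33 2 (ite
      (.conj (.natLe (const 1) (list 9 (var 32)))
        (.conj (.natLe (list 9 (var 32)) (plus (var 31) (const 1)))
          (.conj (.natLe (list 9 (var 33)) (const 0)) (.natLe (const 1) (get 8 (var 32) (var 33))))))
      (block [setNat 9 (var 33) (const 0) (plus (var 31) (const 2)),
        setNat 10 (var 33) (const 0) (var 32)]) skip))).exec n s').nat 10 x 0)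
        (fun a b => a < 2 * n ∧ b < 2 * n) from
      ⟨(hQ.1.round hsrc hr).1, (hQ.1.round hsrc hr).2 hQ.2⟩
    refine exec_forTo (fun i t => IsRound (2 * n) (s.nat 8) k (fun x => s'.nat 9 x 0)
      (fun x => s'.nat 10 x 0) (fun x => t.nat 9 x 0) (fun x => t.nat 10 x 0)
      fun a b => a < i ∧ b < 2 * n) rfl ?_ ?_
    · simp only [setN_nat_ne _ (show 9 ≠ 32 by decide), setN_nat_ne _ (show 10 ≠ 32 by decide)]
      exact ⟨fun x _ _ => ⟨rfl, rfl⟩, fun x _ h => Or.inl h, fun a b h => absurd h.1 (by omega)⟩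
    · intro i hi t hti fN' _ hR
      simp only [setN_nat_ne _ (show 9 ≠ 32 by decide), setN_nat_ne _ (show 10 ≠ 32 by decide)]
      have := exec_forTo (n := n) (a := 33) (k := 2) (c := (ite
      (.conj (.natLe (const 1) (list 9 (var 32)))
        (.conj (.natLe (list 9 (var 32)) (plus (var 31) (const 1)))
          (.conj (.natLe (list 9 (var 33)) (const 0)) (.natLe (const 1) (get 8 (var 32) (var 33))))))
      (block [setNat 9 (var 33) (const 0) (plus (var 31) (const 2)),
        setNat 10 (var 33) (const 0) (var 32)]) skip)) (s := t) (fun j t' =>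
        IsRound (2 * n) (s.nat 8) k (fun x => s'.nat 9 x 0)
        (fun x => s'.nat 10 x 0) (fun x => t'.nat 9 x 0) (fun x => t'.nat 10 x 0)
        fun a b => (a < i ∧ b < 2 * n) ∨ (a = i ∧ b < j)) rfl ?_ ?_
      · refine ⟨this.old, this.new, fun a b hab => this.done a b ?_⟩
        rcases Nat.lt_or_ge a i with h | h
        · exact Or.inl ⟨h, hab.2⟩
        · exact Or.inr ⟨by omega, hab.2⟩
      · simp only [setN_nat_ne _ (show 9 ≠ 33 by decide), setN_nat_ne _ (show 10 ≠ 33 by decide)]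
        refine ⟨hR.old, hR.new, fun a b hab => hR.done a b ?_⟩
        rcases hab with h | h
        · exact h
        · omega
      · intro j hj t' htj fN'' _ hR'
        simp only [setN_nat_ne _ (show 9 ≠ 33 by decide), setN_nat_ne _ (show 10 ≠ 33 by decide)]
        have e31 : t'.nat 31 0 0 = k := by
          rw [fN'' 31 (by decide) rfl, fN' 31 (by decide) rfl, hk']
        have e32 : t'.nat 32 0 0 = i := by rw [fN'' 32 (by decide) rfl, hti]
        have e8 : t'.nat 8 = s.nat 8 := by
          rw [fN'' 8 (by decide) rfl, fN' 8 (by decide) rfl, c8]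
        rw [exec_ite]
        simp only [Test.holds, NExp.eval, exec_block_cons, exec_block_nil, exec_setNat, exec_skip,
          e31, e32, e8, htj]
        have hle := hQ.1.le
        have old := hR'.old
        have new := hR'.new
        have done := hR'.done
        split_ifs with hT
        · obtain ⟨t1, t2, t3, t4⟩ := hT
          -- A node found in the present round carries k + 2 and fails the test, so i was reached in
          -- an earlier round.
          have hi0 : 1 ≤ s'.nat 9 i 0 := by
            by_contra h0
            have := new i hi (by omega)
            omega
          have hj0 : s'.nat 9 j 0 = 0 := by
            by_contra h0
            have := (old j hj (by omega)).1
            omega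
          simp only [setN_nat_self, setN_nat_ne _ (show 9 ≠ 10 by decide),
            setN_nat_ne _ (show 32 ≠ 9 by decide), setN_nat_ne _ (show 33 ≠ 9 by decide),
            setN_nat_ne _ (show 10 ≠ 9 by decide), e32, htj]
          refine ⟨fun x hx h0 => ?_, fun x hx h0 => ?_, fun a b hab h1 h2 => ?_⟩
          · have hxj : x ≠ j := by
              rintro rfl
              omega
            simp only [upd, hxj, false_and, if_false]
            exact old x hx h0
          · by_cases hxj : x = j
            · subst hxj
              simp only [upd_self]
              exact Or.inr ⟨by simp, by simpa using hi, by simpa using hi0, by simpa using t4⟩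
            · simp only [upd, hxj, false_and, if_false]
              exact new x hx h0
          · by_cases hbj : b = j
            · subst hbj
              simp only [upd_self]
              omega
            · simp only [upd, hbj, false_and, if_false]
              refine done a b ?_ h1 h2
              omega
        · refine ⟨old, new, fun a b hab h1 h2 => ?_⟩
          by_cases hbj : a = i ∧ b = j
          · obtain ⟨rfl, rfl⟩ := hbj
            by_contra h0
            have := (old a hi h1).1
            have := hle a hi
            exact hT ⟨by omega, by omega, by omega, h2⟩
          · refine done a b ?_ h1 h2
            omega

end Cmd

end RAM

/-! ### The flow program -/

namespace RAM

open Cmd NExp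

/-- Equality of natural numbers. -/
def Test.natEq (e₁ e₂ : NExp) : Test := .conj (.natLe e₁ e₂) (.natLe e₂ e₁)

theorem Test.holds_natEq (s : Store) (e₁ e₂ : NExp) :
    (Test.natEq e₁ e₂).holds s ↔ e₁.eval s = e₂.eval s := by
  simp only [Test.natEq, Test.holds]
  omega

namespace Cmd

/-- Augment along the path of the search tree to the sink, which is in array `21`. -/
def augment : Cmd := block
  [ setVar 12 (var 21),
    forTo 34 2 (ite (.neg (Test.natEq (var 12) (var 20)))
      (block [setVar 13 (list 10 (var 12)),
        setNat 8 (var 13) (var 12) (minus (get 8 (var 13) (var 12)) (const 1)),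
        setNat 8 (var 12) (var 13) (plus (get 8 (var 12) (var 13)) (const 1)),
        setVar 12 (var 13)]) skip) ]

open scoped Classical in
-- The path is followed from the sink back to the source. Labels strictly decrease, so 2n passes
-- reach the root. The arcs still to be used start at nodes of smaller label and have kept their
-- capacities, which is why every push is legal.
theorem exec_augment {n k : ℕ} {s : Store} (hsnk : s.nat 21 0 0 < 2 * n)
    (ht : IsTree (2 * n) (s.nat 8) (s.nat 20 0 0) k (fun x => s.nat 9 x 0) fun x => s.nat 10 x 0)
    (h1 : 1 ≤ s.nat 9 (s.nat 21 0 0) 0) (hk : s.nat 9 (s.nat 21 0 0) 0 ≤ 2 * n + 1) (S : Set ℕ) :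
    cutCap (2 * n) ((augment.exec n s).nat 8) S + (if s.nat 20 0 0 ∈ S then 1 else 0) =
      cutCap (2 * n) (s.nat 8) S + (if s.nat 21 0 0 ∈ S then 1 else 0) := by
  rw [augment, exec_block_cons, exec_block_cons, exec_block_nil]
  set s₁ := (setVar 12 (var 21)).exec n s with hs₁
  have e12 : s₁.nat 12 0 0 = s.nat 21 0 0 := by simp [hs₁, NExp.eval]
  have e : ∀ b, b ≠ 12 → s₁.nat b = s.nat b := fun b hb => setN_nat_ne s hb _ _ _
  have key := exec_forTo (n := n) (a := 34) (k := 2) (s := s₁)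
    (c := ite (.neg (Test.natEq (var 12) (var 20)))
      (block [setVar 13 (list 10 (var 12)),
        setNat 8 (var 13) (var 12) (minus (get 8 (var 13) (var 12)) (const 1)),
        setNat 8 (var 12) (var 13) (plus (get 8 (var 12) (var 13)) (const 1)),
        setVar 12 (var 13)]) skip)
    (fun i t => t.nat 12 0 0 < 2 * n ∧ 1 ≤ s.nat 9 (t.nat 12 0 0) 0 ∧
      (s.nat 9 (t.nat 12 0 0) 0 = 1 ∨ s.nat 9 (t.nat 12 0 0) 0 + i ≤ 2 * n + 1) ∧
      (∀ a b, s.nat 9 a 0 < s.nat 9 (t.nat 12 0 0) 0 → t.nat 8 a b = s.nat 8 a b) ∧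
      cutCap (2 * n) (t.nat 8) S + (if t.nat 12 0 0 ∈ S then 1 else 0) =
        cutCap (2 * n) (s.nat 8) S + (if s.nat 21 0 0 ∈ S then 1 else 0)) rfl ?_ ?_
  · obtain ⟨k1, k2, k3, -, k5⟩ := key
    have := ht.eq_root _ k1 (by omega)
    rw [this] at k5
    exact k5
  · rw [setN_nat_ne _ (show 12 ≠ 34 by decide), setN_nat_ne _ (show 8 ≠ 34 by decide), e12,
      e 8 (by decide)]
    exact ⟨hsnk, h1, Or.inr (by omega), fun _ _ _ => rfl, rfl⟩
  · intro i hi t hti fN _ hQ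
    rw [setN_nat_ne _ (show 12 ≠ 34 by decide), setN_nat_ne _ (show 8 ≠ 34 by decide)]
    obtain ⟨q1, q2, q3, q4, q5⟩ := hQ
    have e20 : t.nat 20 = s.nat 20 := by rw [fN 20 (by decide) rfl, e 20 (by decide)]
    have e10 : t.nat 10 = s.nat 10 := by rw [fN 10 (by decide) rfl, e 10 (by decide)]
    rw [exec_ite]
    simp only [Test.holds, Test.holds_natEq, NExp.eval, e20]
    set x := t.nat 12 0 0 with hx
    by_cases hT : x ≠ s.nat 20 0 0
    · rw [if_pos hT]
      have hx1 : s.nat 9 x 0 ≠ 1 := by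
        intro h
        have := ht.eq_root x q1 h
        omega
      obtain ⟨p1, p2, p3, p4⟩ := ht.pred x q1 (by omega)
      set p := s.nat 10 x 0 with hp
      have hpx : p ≠ x := by
        intro h
        rw [h] at p3
        omega
      have hc : 1 ≤ t.nat 8 p x := by rw [q4 p x p3]; exact p4
      have push := cutCap_push p1 q1 hpx hc S
      have r12 : ((block [setVar 13 (list 10 (var 12)),
          setNat 8 (var 13) (var 12) (minus (get 8 (var 13) (var 12)) (const 1)),
          setNat 8 (var 12) (var 13) (plus (get 8 (var 12) (var 13)) (const 1)),
          setVar 12 (var 13)]).exec n t).nat 12 0 0 = p := by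
        simp [NExp.eval, setN_nat_ne, e10, ← hx, ← hp]
      have r8 : ((block [setVar 13 (list 10 (var 12)),
          setNat 8 (var 13) (var 12) (minus (get 8 (var 13) (var 12)) (const 1)),
          setNat 8 (var 12) (var 13) (plus (get 8 (var 12) (var 13)) (const 1)),
          setVar 12 (var 13)]).exec n t).nat 8 =
          upd (upd (t.nat 8) p x (t.nat 8 p x - 1)) x p (t.nat 8 x p + 1) := by
        have : upd (t.nat 8) p x (t.nat 8 p x - 1) x p = t.nat 8 x p := by
          simp [upd, hpx]
        simp [NExp.eval, setN_nat_ne, e10, ← hx, ← hp, this]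
      rw [r12, r8]
      refine ⟨p1, p2, ?_, fun a b hab => ?_, by omega⟩
      · omega
      · have hap : a ≠ p := by
          rintro rfl
          omega
        have hax : a ≠ x := by
          rintro rfl
          omega
        simp only [upd, hap, hax, false_and, if_false]
        exact q4 a b (lt_trans hab p3)
    · rw [if_neg hT, exec_skip, ← hx]
      refine ⟨q1, q2, Or.inl ?_, q4, q5⟩
      rw [not_not] at hT
      rw [hT]
      exact ht.root

/-- The capacities of the arcs between the copies of two nodes: `v` is the entry and `n + v` the
exit of node `v`. -/
structure IsNetwork (n ℓ : ℕ) (R A : ℕ → ℕ) (adj c : ℕ → ℕ → ℕ) (u v : ℕ) : Prop where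
  entry_entry : c u v = 0
  exit_exit : c (n + u) (n + v) = 0
  entry_exit : c u (n + v) = if u = v then (if 1 ≤ R u then ℓ else 1) else 0
  -- By truncated subtraction the last term is 1 exactly for an edge between selected nodes and 0
  -- otherwise. The capacities ℓ cannot be afforded by a cut below ℓ.
  exit_entry : c (n + u) v = if u = v then ℓ else adj u v + A u + A v - 2

/-- Set up the network for the set of nodes in array `5`. -/
def network : Cmd :=
  forTo 35 1 (forTo 36 1 (block
    [ setNat 8 (var 35) (var 36) (const 0),
      setNat 8 (plus (var 0) (var 35)) (plus (var 0) (var 36)) (const 0),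
      setNat 8 (var 35) (plus (var 0) (var 36)) (const 0),
      setNat 8 (plus (var 0) (var 35)) (var 36) (minus (plus (plus (get 1 (var 35) (var 36))
        (list 5 (var 35))) (list 5 (var 36))) (const 2)),
      ite (Test.natEq (var 35) (var 36)) (block
        [ setNat 8 (var 35) (plus (var 0) (var 36)) (const 1),
          setNat 8 (plus (var 0) (var 35)) (var 36) (get 0 (const 0) (const 1)),
          ite (.natLe (const 1) (list 2 (var 35)))
            (setNat 8 (var 35) (plus (var 0) (var 36)) (get 0 (const 0) (const 1))) skip ]) skip ]))

theorem exec_network {n : ℕ} {s : Store} (hn : s.nat 0 0 0 = n) {u v : ℕ} (hu : u < n)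
    (hv : v < n) : IsNetwork n (s.nat 0 0 1) (fun x => s.nat 2 x 0) (fun x => s.nat 5 x 0)
      (s.nat 1) ((network.exec n s).nat 8) u v := by
  suffices ∀ u < 1 * n, ∀ v < n, IsNetwork n (s.nat 0 0 1) (fun x => s.nat 2 x 0)
      (fun x => s.nat 5 x 0) (s.nat 1) ((network.exec n s).nat 8) u v from
    this u (by omega) v hv
  refine exec_forTo (fun i t => ∀ u < i, ∀ v < n, IsNetwork n (s.nat 0 0 1) (fun x => s.nat 2 x 0)
      (fun x => s.nat 5 x 0) (s.nat 1) (t.nat 8) u v) rfl (fun u hu => absurd hu (by omega)) ?_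
  intro i hi t hti fN _ hQ
  rw [setN_nat_ne _ (by decide)]
  suffices ∀ u v, u < n → v < n → (u < i ∨ (u = i ∧ v < 1 * n)) → IsNetwork n (s.nat 0 0 1)
      (fun x => s.nat 2 x 0) (fun x => s.nat 5 x 0) (s.nat 1) _ u v from
    fun u hu v hv => this u v (by omega) hv (by omega)
  refine exec_forTo (s := t) (fun j t' => ∀ u v, u < n → v < n → (u < i ∨ (u = i ∧ v < j)) →
    IsNetwork n (s.nat 0 0 1) (fun x => s.nat 2 x 0) (fun x => s.nat 5 x 0) (s.nat 1)
      (t'.nat 8) u v) rfl ?_ ?_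
  · intro u v hu hv h
    rw [setN_nat_ne _ (by decide)]
    exact hQ u (by omega) v hv
  · intro j hj t' htj fN' _ hQ' u v hu hv h
    rw [setN_nat_ne _ (by decide)]
    have e : ∀ b, b ≠ 35 → b ≠ 36 → b ≠ 8 → t'.nat b = s.nat b := by
      intro b h1 h2 h3
      rw [fN' b h2 (by simp [nwrites, block, Ne.symm h3]), fN b h1 (by
        simp [nwrites, block, Ne.symm h3, Ne.symm h2])]
    have e35 : t'.nat 35 0 0 = i := by rw [fN' 35 (by decide) rfl, hti]
    have old := hQ' u v hu hv
    have hi' : i < n := by omega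
    have hj' : j < n := by omega
    have huv : u = i ∧ v = j ∨ ¬ (u = i ∧ v = j) ∧ (u < i ∨ (u = i ∧ v < j)) := by omega
    simp only [exec_block_cons, exec_block_nil, exec_setNat, NExp.eval, exec_ite,
      Test.holds_natEq, Test.holds, exec_skip]
    simp only [setN_nat_ne _ (show 0 ≠ 8 by decide), setN_nat_ne _ (show 35 ≠ 8 by decide),
      setN_nat_ne _ (show 36 ≠ 8 by decide), setN_nat_ne _ (show 1 ≠ 8 by decide),
      setN_nat_ne _ (show 5 ≠ 8 by decide), setN_nat_ne _ (show 2 ≠ 8 by decide), e35, htj,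
      e 0 (by decide) (by decide) (by decide), e 1 (by decide) (by decide) (by decide),
      e 5 (by decide) (by decide) (by decide), e 2 (by decide) (by decide) (by decide), hn]
    rcases huv with ⟨rfl, rfl⟩ | ⟨hne, hold⟩
    · by_cases huv : u = v
      · subst huv
        by_cases hR : 1 ≤ s.nat 2 u 0
        · constructor <;> simp only [if_pos hR, if_true, setN_nat_self, upd] <;> grind
        · constructor <;> simp only [if_neg hR, if_true, setN_nat_self, upd] <;> grind
      · constructor <;> simp [upd, huv] <;> omega
    · obtain ⟨o1, o2, o3, o4⟩ := old hold
      split_ifs <;> constructor <;> simp only [setN_nat_self, upd] <;> grind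

/-- Compute in array `9` the least minimum cut between the source and the sink, and its capacity in
array `11`. -/
def flow : Cmd := block
  [ network, setVar 11 (const 0),
    forTo 37 1 (block [search,
      ite (.natLe (const 1) (list 9 (var 21)))
        (block [augment, setVar 11 (plus (var 11) (const 1))]) skip]) ]

/-- The nodes found by the search. -/
def reached (n : ℕ) (s : Store) : Set ℕ := {x | x < 2 * n ∧ 1 ≤ s.nat 9 x 0}

/-- Throughout, residual capacity plus current value equals the original capacity, for every cut
between source and sink. A cut of capacity below n rules out n augmentations, so n passes end with a
search that misses the sink. The reached set then has residual capacity 0, hence is a minimum cut,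
and it lies in every other one. -/
theorem exec_flow {n : ℕ} {s : Store} (hsrc : s.nat 20 0 0 < 2 * n) (hsnk : s.nat 21 0 0 < 2 * n)
    {S₀ : Set ℕ} (h₁ : s.nat 20 0 0 ∈ S₀) (h₂ : s.nat 21 0 0 ∉ S₀)
    (h₃ : cutCap (2 * n) ((network.exec n s).nat 8) S₀ < n) :
    s.nat 20 0 0 ∈ reached n (flow.exec n s) ∧ s.nat 21 0 0 ∉ reached n (flow.exec n s) ∧
    cutCap (2 * n) ((network.exec n s).nat 8) (reached n (flow.exec n s)) =
      (flow.exec n s).nat 11 0 0 ∧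
    ∀ S : Set ℕ, s.nat 20 0 0 ∈ S → s.nat 21 0 0 ∉ S →
      (flow.exec n s).nat 11 0 0 ≤ cutCap (2 * n) ((network.exec n s).nat 8) S ∧
      (cutCap (2 * n) ((network.exec n s).nat 8) S = (flow.exec n s).nat 11 0 0 →
        reached n (flow.exec n s) ⊆ S) := by
  rw [flow, exec_block_cons, exec_block_cons, exec_block_cons, exec_block_nil]
  have e20 : (network.exec n s).nat 20 = s.nat 20 := exec_nat_eq rfl s
  have e21 : (network.exec n s).nat 21 = s.nat 21 := exec_nat_eq rfl s
  set s₁ := network.exec n s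
  set s₂ := (setVar 11 (const 0)).exec n s₁ with hs₂
  have f : ∀ b, b ≠ 11 → s₂.nat b = s₁.nat b := fun b hb => setN_nat_ne s₁ hb _ _ _
  set src := s.nat 20 0 0 with hsrc'
  set snk := s.nat 21 0 0 with hsnk'
  let Final : Store → Prop := fun t =>
    IsTree (2 * n) (t.nat 8) src (2 * n) (fun x => t.nat 9 x 0) (fun x => t.nat 10 x 0) ∧
    IsClosed (2 * n) (t.nat 8) (fun x => t.nat 9 x 0) ∧ t.nat 9 snk 0 = 0
  have closed_cut : ∀ (c : ℕ → ℕ → ℕ) (t : Store), IsClosed (2 * n) c (fun x => t.nat 9 x 0) →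
      cutCap (2 * n) c (reached n t) = 0 := by
    intro c t h
    refine cutCap_eq_zero_of fun a ha b hb haS hbS => h a ha b hb haS.2 ?_
    by_contra h0
    exact hbS ⟨hb, Nat.one_le_iff_ne_zero.2 h0⟩
  have key := exec_forTo (n := n) (a := 37) (k := 1) (s := s₂)
    (c := block [search, ite (.natLe (const 1) (list 9 (var 21)))
        (block [augment, setVar 11 (plus (var 11) (const 1))]) skip])
    (fun q t => (∀ S : Set ℕ, src ∈ S → snk ∉ S →
      cutCap (2 * n) (t.nat 8) S + t.nat 11 0 0 = cutCap (2 * n) (s₁.nat 8) S) ∧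
      (t.nat 11 0 0 = q ∨ Final t)) rfl ?_ ?_
  · set s₃ := (forTo 37 1 (block [search, ite (.natLe (const 1) (list 9 (var 21)))
        (block [augment, setVar 11 (plus (var 11) (const 1))]) skip])).exec n s₂
    obtain ⟨k1, k2⟩ := key
    obtain ⟨f1, f2, f3⟩ : Final s₃ := by
      refine k2.resolve_left fun h => ?_
      have := k1 S₀ h₁ h₂
      omega
    have hr1 : src ∈ reached n s₃ := ⟨hsrc, by rw [f1.root]⟩
    have hr2 : snk ∉ reached n s₃ := fun h => by
      have := h.2
      omega
    have hr3 := closed_cut _ _ f2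
    refine ⟨hr1, hr2, ?_, fun S hS1 hS2 => ?_⟩
    · have := k1 _ hr1 hr2
      omega
    · have := k1 S hS1 hS2
      refine ⟨by omega, fun he x hx => ?_⟩
      exact f1.mem_of_cutCap_eq_zero (by omega) hS1 x hx.1 hx.2
  · simp only [Final, setN_nat_ne _ (show 8 ≠ 37 by decide), setN_nat_ne _ (show 11 ≠ 37 by decide),
      f 8 (by decide)]
    have : s₂.nat 11 0 0 = 0 := by simp [hs₂, NExp.eval]
    exact ⟨fun S _ _ => by rw [this]; rfl, Or.inl this⟩
  · intro q hq t htq fN _ ⟨hQ1, hQ2⟩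
    simp only [Final, setN_nat_ne _ (show 8 ≠ 37 by decide), setN_nat_ne _ (show 11 ≠ 37 by decide),
      setN_nat_ne _ (show 9 ≠ 37 by decide), setN_nat_ne _ (show 10 ≠ 37 by decide)]
    have g20 : t.nat 20 0 0 = src := by rw [fN 20 (by decide) rfl, f 20 (by decide), e20]
    have g21 : t.nat 21 0 0 = snk := by rw [fN 21 (by decide) rfl, f 21 (by decide), e21]
    obtain ⟨t1, t2⟩ := exec_search (n := n) (s := t) (by rw [g20]; exact hsrc)
    rw [g20] at t1
    rw [exec_block_cons, exec_block_cons, exec_block_nil, exec_ite]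
    have a8 : (search.exec n t).nat 8 = t.nat 8 := exec_nat_eq rfl t
    have a11 : (search.exec n t).nat 11 = t.nat 11 := exec_nat_eq rfl t
    have a20 : (search.exec n t).nat 20 = t.nat 20 := exec_nat_eq rfl t
    have a21 : (search.exec n t).nat 21 = t.nat 21 := exec_nat_eq rfl t
    set t' := search.exec n t
    simp only [Test.holds, NExp.eval, a21, g21]
    split_ifs with hT
    · have haug := exec_augment (n := n) (s := t') (k := 2 * n)
        (by rw [a21, g21]; exact hsnk) (by rw [a8, a20, g20]; exact t1)
        (by rw [a21, g21]; exact hT) (by rw [a21, g21]; exact t1.le _ hsnk)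
      have b11 : (augment.exec n t').nat 11 = t'.nat 11 := exec_nat_eq rfl t'
      have r11 : ((block [augment, setVar 11 (plus (var 11) (const 1))]).exec n t').nat 11 0 0 =
          t.nat 11 0 0 + 1 := by
        simp [NExp.eval, b11, a11]
      have r8 : ((block [augment, setVar 11 (plus (var 11) (const 1))]).exec n t').nat 8 =
          (augment.exec n t').nat 8 := by
        simp [setN_nat_ne]
      rw [r11, r8]
      refine ⟨fun S hS1 hS2 => ?_, Or.inl ?_⟩
      · have h1 := haug S
        rw [a20, a21, g20, g21, if_pos hS1, if_neg hS2, a8] at h1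
        have := hQ1 S hS1 hS2
        omega
      · rcases hQ2 with h | ⟨f1, f2, f3⟩
        · rw [h]
        · exfalso
          have h0 := closed_cut _ _ f2
          have := t1.mem_of_cutCap_eq_zero h0 ⟨hsrc, by rw [f1.root]⟩ snk hsnk hT
          have := this.2
          omega
    · rw [exec_skip, a8, a11]
      exact ⟨hQ1, Or.inr ⟨t1, t2, by omega⟩⟩

end Cmd

end RAM

/-! ### Cuts of the network and bisets -/

namespace RAM

open Cmd

/-- The set `S` of network nodes consists of the entries of the nodes of the outer part of `D` and
the exits of the nodes of its inner part. -/
def Encodes {n : ℕ} (S : Set ℕ) (D : Biset (Fin n)) : Prop :=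
  ∀ v : Fin n, ((v : ℕ) ∈ S ↔ v ∈ D.outer) ∧ (n + (v : ℕ) ∈ S ↔ v ∈ D.inner)

theorem le_cutCap {N : ℕ} {c : ℕ → ℕ → ℕ} {S : Set ℕ} {a b : ℕ} (ha : a < N) (hb : b < N)
    (haS : a ∈ S) (hbS : b ∉ S) : c a b ≤ cutCap N c S := by
  classical
  rw [cutCap]
  refine le_trans ?_ (single_le_sum (f := fun a => ∑ b ∈ range N, if a ∈ S ∧ b ∉ S then c a b else 0)
    (fun _ _ => Nat.zero_le _) (mem_range.2 ha))
  refine le_trans ?_ (single_le_sum (f := fun b => if a ∈ S ∧ b ∉ S then c a b else 0)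
    (fun _ _ => Nat.zero_le _) (mem_range.2 hb))
  simp only [if_pos (And.intro haS hbS), le_refl]

open scoped Classical in
theorem cutCap_two_mul (n : ℕ) (c : ℕ → ℕ → ℕ) (S : Set ℕ) :
    cutCap (2 * n) c S = ∑ u : Fin n, ∑ v : Fin n,
      ((if (u : ℕ) ∈ S ∧ (v : ℕ) ∉ S then c u v else 0) +
       (if (u : ℕ) ∈ S ∧ n + (v : ℕ) ∉ S then c u (n + v) else 0) +
       (if n + (u : ℕ) ∈ S ∧ (v : ℕ) ∉ S then c (n + u) v else 0) +
       (if n + (u : ℕ) ∈ S ∧ n + (v : ℕ) ∉ S then c (n + u) (n + v) else 0)) := by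
  rw [cutCap, two_mul, sum_range_add, sum_range, sum_range, ← sum_add_distrib]
  refine sum_congr rfl fun u _ => ?_
  rw [sum_range_add, sum_range_add, sum_range, sum_range, sum_range, sum_range, ← sum_add_distrib,
    ← sum_add_distrib, ← sum_add_distrib]
  exact sum_congr rfl fun v _ => by ring

section

variable {n : ℕ} {I : Phase (Fin n)} {P : Finset (Fin n)} {c : ℕ → ℕ → ℕ} {R A : ℕ → ℕ}
  {adj : ℕ → ℕ → ℕ} {S : Set ℕ} {D : Biset (Fin n)}

open scoped Classical in
/-- The tables `R`, `A`, `adj` describe the phase `I` and the set `P`, and `c` is its network. -/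
structure IsPhaseNetwork (I : Phase (Fin n)) (P : Finset (Fin n)) (R A : ℕ → ℕ)
    (adj c : ℕ → ℕ → ℕ) : Prop where
  network : ∀ u v : Fin n, IsNetwork n I.ℓ R A adj c u v
  reliable : ∀ u : Fin n, R u = if u ∈ I.R then 1 else 0
  selected : ∀ u : Fin n, A u = if u ∈ P then 1 else 0
  adjacent : ∀ u v : Fin n, adj u v = if I.G.Adj u v then 1 else 0

/-- Boundary nodes are cut at their entry-exit arc, at cost 1 since they are not reliable. Crossing
edges of G[P] are cut at an exit-entry arc. -/
theorem IsPhaseNetwork.cutCap_eq (h : IsPhaseNetwork I P R A adj c) (hD : D ∈ I.family)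
    (hS : Encodes S D) :
    cutCap (2 * n) c S = #D.bd + #(D.cut (edgesWithin I.G P)) := by
  classical
  rw [cutCap_two_mul, Biset.card_bd_eq, Biset.card_cut_eq, Fintype.sum_prod_type, ← sum_add_distrib]
  refine sum_congr rfl fun u _ => ?_
  have hu : (if u ∈ D.outer ∧ u ∉ D.inner then 1 else 0) =
      ∑ v : Fin n, if v = u then (if u ∈ D.outer ∧ u ∉ D.inner then 1 else 0) else 0 := by simp
  rw [hu, ← sum_add_distrib]
  refine sum_congr rfl fun v _ => ?_
  obtain ⟨h1, h2, h3, h4⟩ := h.network u v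
  rw [h1, h2, h3, h4, h.reliable, h.selected, h.selected, h.adjacent, (hS u).1, (hS u).2, (hS v).1,
    (hS v).2]
  rw [Phase.mem_family] at hD
  have hDu := hD u
  have hsub := @D.sub u
  simp only [edgesWithin]
  by_cases huv : u = v
  · subst huv
    by_cases a : u ∈ D.inner <;> by_cases b : u ∈ D.outer <;> simp_all
  · have huv' : (u : ℕ) ≠ v := fun h => huv (Fin.ext h)
    have hvu : ¬ v = u := fun h => huv h.symm
    simp only [huv', hvu, if_false]
    by_cases a : u ∈ D.inner <;> by_cases b : v ∈ D.outer <;> by_cases d : I.G.Adj u v <;>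
      by_cases e : u ∈ P <;> by_cases g : v ∈ P <;> simp_all

/-- Below ℓ no arc of capacity ℓ is cut. The arc from the exit of a node to its entry forces inner ⊆
outer, and the arc through a reliable node keeps it off the boundary. -/
theorem IsPhaseNetwork.exists_encodes (h : IsPhaseNetwork I P R A adj c)
    (hS : cutCap (2 * n) c S < I.ℓ) : ∃ D ∈ I.family, Encodes S D := by
  classical
  have h1 : ∀ v : Fin n, n + (v : ℕ) ∈ S → (v : ℕ) ∈ S := by
    intro v hv
    by_contra hv'
    have := le_cutCap (N := 2 * n) (c := c) (by omega) (by omega) hv hv'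
    rw [(h.network v v).exit_entry, if_pos rfl] at this
    omega
  refine ⟨⟨univ.filter fun v : Fin n => n + (v : ℕ) ∈ S, univ.filter fun v : Fin n => (v : ℕ) ∈ S,
    fun v hv => ?_⟩, ?_, fun v => by simp⟩
  · simp only [mem_filter, mem_univ, true_and] at hv ⊢
    exact h1 v hv
  · rw [Phase.mem_family]
    intro v hv hv' hR
    simp only [mem_filter, mem_univ, true_and] at hv hv'
    have := le_cutCap (N := 2 * n) (c := c) (by omega) (by omega) hv hv'
    rw [(h.network v v).entry_exit, if_pos rfl, h.reliable, if_pos hR, if_pos le_rfl] at this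
    omega

/-- A deficient biset that separates `v` from `u`. -/
def Separates (I : Phase (Fin n)) (P : Finset (Fin n)) (u v : Fin n) (D : Biset (Fin n)) : Prop :=
  D ∈ I.family ∧ u ∈ D.inner ∧ v ∉ D.outer ∧ #D.bd + #(D.cut (edgesWithin I.G P)) < I.ℓ

theorem Separates.deficient {u v : Fin n} (hI : I.Valid) (h : Separates I P u v D)
    (hr : I.ℓ ≤ I.r u v) : I.Deficient P D :=
  ⟨h.1, (Phase.le_rElem_iff hI.one_le).2 ⟨u, h.2.1, v, h.2.2.1, hr⟩, h.2.2.2⟩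

/-- The cut around u alone consists of at most n - 1 unit arcs. This is the bound on the number of
augmentations. -/
theorem IsPhaseNetwork.exists_cut (h : IsPhaseNetwork I P R A adj c) {u v : Fin n} (huv : u ≠ v) :
    ∃ S : Set ℕ, n + (u : ℕ) ∈ S ∧ (v : ℕ) ∉ S ∧ cutCap (2 * n) c S < n := by
  classical
  refine ⟨{(u : ℕ), n + (u : ℕ)}, by simp, ?_, ?_⟩
  · have := v.isLt
    have : (v : ℕ) ≠ u := fun h => huv (Fin.ext h.symm)
    simp only [Set.mem_insert_iff, Set.mem_singleton_iff]
    omega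
  · rw [h.cutCap_eq (D := ⟨{u}, {u}, subset_rfl⟩) (by simp [Phase.mem_family])]
    · have h1 : #((⟨{u}, {u}, subset_rfl⟩ : Biset (Fin n)).bd) = 0 := by simp [Biset.bd]
      have h2 : (⟨{u}, {u}, subset_rfl⟩ : Biset (Fin n)).cut (edgesWithin I.G P) ⊆
          ((univ : Finset (Fin n)).erase u).image fun v => (u, v) := by
        intro e he
        rw [Biset.mem_cut] at he
        simp only [mem_singleton] at he
        simp only [mem_image, mem_erase, mem_univ, and_true]
        exact ⟨e.2, he.2.1, Prod.ext he.1.symm rfl⟩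
      have h3 := (card_le_card h2).trans card_image_le
      rw [card_erase_of_mem (mem_univ _), card_univ, Fintype.card_fin] at h3
      have := u.isLt
      omega
    · intro w
      have h1 := w.isLt
      have h2 := u.isLt
      simp only [Set.mem_insert_iff, Set.mem_singleton_iff, mem_singleton, Fin.ext_iff]
      omega

end

/-! ### Representatives of the minimal violated bisets -/

section

variable {n : ℕ} {I : Phase (Fin n)} {P : Finset (Fin n)}

/-- For each node `u` with `p u`, the biset `D u` is deficient, and each minimal violated biset is
among them. -/
structure Candidates (I : Phase (Fin n)) (P : Finset (Fin n)) (p : Fin n → Prop)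
    (D : Fin n → Biset (Fin n)) : Prop where
  deficient : ∀ u, p u → I.Deficient P (D u)
  exists_eq : ∀ C ∈ I.violatedBisets P, ∃ u, p u ∧ D u = C

/-- The first of the nodes whose biset is a given minimal one. -/
def IsFirst {n : ℕ} (p : Fin n → Prop) (D : Fin n → Biset (Fin n)) (u : Fin n) : Prop :=
  p u ∧ ∀ v, p v → D v ≤ D u → D u ≤ D v ∧ u ≤ v

theorem IsFirst.inj {p : Fin n → Prop} {D : Fin n → Biset (Fin n)} {u v : Fin n}
    (hu : IsFirst p D u) (hv : IsFirst p D v) (h : D u = D v) : u = v :=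
  le_antisymm (hu.2 v hv.1 h.ge).2 (hv.2 u hu.1 h.le).2

/-- All candidates are deficient and the minimal violated bisets are among them, so minimality may
be tested among candidates only. The smallest index selects one representative of each. -/
theorem Candidates.mem_violatedBisets_iff (hI : I.Valid) (hX : I.X ⊆ P) {p : Fin n → Prop}
    {D : Fin n → Biset (Fin n)} (h : Candidates I P p D) (C : Biset (Fin n)) :
    C ∈ I.violatedBisets P ↔ ∃ u, IsFirst p D u ∧ D u = C := by
  classical
  constructor
  · intro hC
    have hmin := (Phase.mem_violatedBisets hI hX).1 hC
    obtain ⟨w, hw, hwC⟩ := h.exists_eq C hC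
    have hne : (univ.filter fun u => p u ∧ D u = C).Nonempty := ⟨w, by simp [hw, hwC]⟩
    have hmem := (univ.filter fun u => p u ∧ D u = C).min'_mem hne
    set u := (univ.filter fun u => p u ∧ D u = C).min' hne with hu
    simp only [mem_filter, mem_univ, true_and] at hmem
    refine ⟨u, ⟨hmem.1, fun v hv hvu => ?_⟩, hmem.2⟩
    rw [hmem.2] at hvu ⊢
    have hle := hmin.2 (h.deficient v hv) hvu
    refine ⟨hle, min'_le _ _ ?_⟩
    simp only [mem_filter, mem_univ, true_and]
    exact ⟨hv, le_antisymm hvu hle⟩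
  · rintro ⟨u, hu, rfl⟩
    obtain ⟨C, hC, hCu⟩ := (h.deficient u hu.1).exists_minimal hI hX
    obtain ⟨w, hw, rfl⟩ := h.exists_eq C hC
    rwa [le_antisymm (hu.2 w hw hCu).1 hCu]

/-- `D u`, for `u` with `p u`, is the smallest biset that separates some other node from `u`. -/
structure IsSmallest (I : Phase (Fin n)) (P : Finset (Fin n)) (p : Fin n → Prop)
    (D : Fin n → Biset (Fin n)) : Prop where
  separates : ∀ u, p u → ∃ v, I.ℓ ≤ I.r u v ∧ Separates I P u v (D u)
  size_le : ∀ u v, I.ℓ ≤ I.r u v → ∀ C, Separates I P u v C → p u ∧ (D u).size ≤ C.size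

/-- Let a minimal violated C separate a demand pair u, v. The smallest biset for u is deficient and
shares u with C, so C lies below it. Since it is no larger than C, they coincide. -/
theorem IsSmallest.candidates (hI : I.Valid) (hX : I.X ⊆ P) {p : Fin n → Prop}
    {D : Fin n → Biset (Fin n)} (h : IsSmallest I P p D) : Candidates I P p D := by
  refine ⟨fun u hu => ?_, fun C hC => ?_⟩
  · obtain ⟨v, hr, hv⟩ := h.separates u hu
    exact hv.deficient hI hr
  · have hd := ((Phase.mem_violatedBisets hI hX).1 hC).1
    obtain ⟨u, hu, v, hv, hr⟩ := hd.exists_pair hI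
    obtain ⟨hp, hs⟩ := h.size_le u v hr C ⟨hd.1, hu, hv, hd.2.2⟩
    obtain ⟨v', hr', hv'⟩ := h.separates u hp
    refine ⟨u, hp, (Biset.eq_of_le_of_size_le ?_ hs).symm⟩
    refine (Phase.violated_le_or_avoids hI hX hC (hv'.deficient hI hr')).resolve_right fun ha => ?_
    exact disjoint_left.1 ha.1 hu ((D u).sub hv'.2.1)

end

end RAM

/-! ### The program that finds small deficient bisets -/

namespace RAM

open Cmd NExp

/-- The input of the algorithm is intact. -/
structure Loaded {n : ℕ} (I : Phase (Fin n)) (s : Store) : Prop where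
  nat : ∀ b < 5, s.nat b = (input I).nat b
  real : s.real 0 = (input I).real 0

/-- The set `P` is stored in array `5`. -/
def Selects {n : ℕ} (P : Finset (Fin n)) (s : Store) : Prop :=
  ∀ v : Fin n, s.nat 5 v 0 = if v ∈ P then 1 else 0

/-- The list `row` is the characteristic function of a set that encodes `D`. -/
def IsRow {n : ℕ} (row : ℕ → ℕ) (D : Biset (Fin n)) : Prop :=
  ∀ v : Fin n, (row v = if v ∈ D.outer then 1 else 0) ∧ (row (n + v) = if v ∈ D.inner then 1 else 0)

section

variable {n : ℕ} {I : Phase (Fin n)} {P : Finset (Fin n)} {s : Store}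

theorem Loaded.size (h : Loaded I s) : s.nat 0 0 0 = n := by
  rw [h.nat 0 (by decide)]
  simp [input]

theorem Loaded.level (h : Loaded I s) : s.nat 0 0 1 = I.ℓ := by
  rw [h.nat 0 (by decide)]
  simp [input]

open scoped Classical in
theorem Loaded.adj (h : Loaded I s) (u v : Fin n) :
    s.nat 1 u v = if I.G.Adj u v then 1 else 0 := by
  rw [h.nat 1 (by decide)]
  simp [input, table]

theorem Loaded.reliable (h : Loaded I s) (u : Fin n) : s.nat 2 u 0 = if u ∈ I.R then 1 else 0 := by
  rw [h.nat 2 (by decide)]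
  simp [input, column]

theorem Loaded.req (h : Loaded I s) (u v : Fin n) : s.nat 3 u v = I.r u v := by
  rw [h.nat 3 (by decide)]
  simp [input, table]

theorem Loaded.mem_X (h : Loaded I s) (u : Fin n) : s.nat 4 u 0 = if u ∈ I.X then 1 else 0 := by
  rw [h.nat 4 (by decide)]
  simp [input, column]

theorem Loaded.weight (h : Loaded I s) (u : Fin n) : s.real 0 u 0 = I.w u := by
  rw [h.real]
  simp [input, column]

theorem Loaded.exec {c : Cmd} (h : Loaded I s) (hn : ∀ b < 5, c.nwrites b = false)
    (hr : c.rwrites 0 = false) : Loaded I (c.exec n s) :=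
  ⟨fun b hb => (exec_nat_eq (hn b hb) s).trans (h.nat b hb), (exec_real_eq hr s).trans h.real⟩

theorem Loaded.of_eq {s' : Store} (h : Loaded I s) (hn : ∀ b < 5, s'.nat b = s.nat b)
    (hr : s'.real 0 = s.real 0) : Loaded I s' :=
  ⟨fun b hb => (hn b hb).trans (h.nat b hb), hr.trans h.real⟩

theorem isPhaseNetwork (h : Loaded I s) (hP : Selects P s) :
    IsPhaseNetwork I P (fun x => s.nat 2 x 0) (fun x => s.nat 5 x 0) (s.nat 1)
      ((network.exec n s).nat 8) :=
  ⟨fun u v => by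
    have := exec_network h.size u.isLt v.isLt
    rwa [h.level] at this, h.reliable, hP, h.adj⟩

theorem exists_encodes (D : Biset (Fin n)) : ∃ S : Set ℕ, Encodes S D := by
  refine ⟨{x | (∃ v ∈ D.outer, x = v) ∨ ∃ v ∈ D.inner, x = n + v}, fun v => ⟨?_, ?_⟩⟩
  · constructor
    · rintro (⟨w, hw, h⟩ | ⟨w, hw, h⟩)
      · rwa [Fin.ext h]
      · omega
    · exact fun h => Or.inl ⟨v, h, rfl⟩
  · constructor
    · rintro (⟨w, hw, h⟩ | ⟨w, hw, h⟩)
      · omega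
      · rwa [Fin.ext (Nat.add_left_cancel h)]
    · exact fun h => Or.inr ⟨v, h, rfl⟩

/-- The source is the exit of u, the sink the entry of v. All separating bisets of value below ℓ
have value exactly ℓ-1 and are thus minimum cuts, so the least minimum cut lies inside each of them.
-/
theorem exec_flow_separates (hI : I.Valid) (hX : I.X ⊆ P) (h : Loaded I s) (hP : Selects P s)
    {u v : Fin n} (huv : u ≠ v) (hr : I.ℓ ≤ I.r u v) (h20 : s.nat 20 0 0 = n + u)
    (h21 : s.nat 21 0 0 = v) :
    ((flow.exec n s).nat 11 0 0 < I.ℓ ∧ ∃ D, Separates I P u v D ∧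
      Encodes (reached n (flow.exec n s)) D ∧ ∀ C, Separates I P u v C → D.size ≤ C.size) ∨
    (¬ (flow.exec n s).nat 11 0 0 < I.ℓ ∧ ∀ C, ¬ Separates I P u v C) := by
  have hN := isPhaseNetwork h hP
  obtain ⟨S₀, hS1, hS2, hS3⟩ := hN.exists_cut huv
  obtain ⟨f1, f2, f3, f4⟩ := exec_flow (n := n) (s := s) (S₀ := S₀) (by omega) (by omega)
    (by rwa [h20]) (by rwa [h21]) hS3
  rw [h20] at f1 f4
  rw [h21] at f2 f4
  by_cases hval : (flow.exec n s).nat 11 0 0 < I.ℓ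
  · refine Or.inl ⟨hval, ?_⟩
    obtain ⟨D, hD, hDe⟩ := hN.exists_encodes (by rwa [f3])
    have hDc := hN.cutCap_eq hD hDe
    have hsep : Separates I P u v D :=
      ⟨hD, (hDe u).2.1 f1, fun h => f2 ((hDe v).1.2 h), by omega⟩
    refine ⟨D, hsep, hDe, fun C hC => Biset.size_mono ?_⟩
    obtain ⟨S, hS⟩ := exists_encodes C
    have hSc := hN.cutCap_eq hC.1 hS
    obtain ⟨g1, g2⟩ := f4 S ((hS u).2.2 hC.2.1) fun h => hC.2.2.1 ((hS v).1.1 h)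
    have e1 := hI.le_card hX hD (hsep.deficient hI hr).2.1
    have e2 := hsep.2.2.2
    have e3 := hC.2.2.2
    have hsub := g2 (by omega)
    exact ⟨fun w hw => (hS w).2.1 (hsub ((hDe w).2.2 hw)),
      fun w hw => (hS w).1.1 (hsub ((hDe w).1.2 hw))⟩
  · refine Or.inr ⟨hval, fun C hC => hval ?_⟩
    obtain ⟨S, hS⟩ := exists_encodes C
    have hSc := hN.cutCap_eq hC.1 hS
    obtain ⟨g1, -⟩ := f4 S ((hS u).2.2 hC.2.1) fun h => hC.2.2.1 ((hS v).1.1 h)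
    have e3 := hC.2.2.2
    omega

theorem IsRow.sum_eq {row : ℕ → ℕ} {D : Biset (Fin n)} (h : IsRow row D) :
    ∑ x ∈ range (2 * n), row x = D.size := by
  rw [two_mul, sum_range_add, sum_range, sum_range, Biset.size, add_comm]
  congr 1
  · rw [sum_congr rfl fun v _ => (h v).2]
    simp
  · rw [sum_congr rfl fun v _ => (h v).1]
    simp

/-- The expression 1 - (1 - x) turns a positive label into 1. -/
theorem Encodes.isRow {D : Biset (Fin n)} (h : Encodes (reached n s) D) :
    IsRow (fun x => 1 - (1 - s.nat 9 x 0)) D := by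
  intro v
  obtain ⟨h1, h2⟩ := h v
  have hv := v.isLt
  simp only [reached, Set.mem_ofPred_eq] at h1 h2
  constructor <;> beta_reduce
  · split_ifs with h
    · have := h1.2 h
      omega
    · have := mt h1.1 h
      omega
  · split_ifs with h
    · have := h2.2 h
      omega
    · have := mt h2.1 h
      omega

theorem size_le (D : Biset (Fin n)) : D.size ≤ 2 * n := by
  have h1 := card_le_univ D.inner
  have h2 := card_le_univ D.outer
  rw [Fintype.card_fin] at h1 h2
  unfold Biset.size
  omega

end

namespace Cmd

/-- Sum up an expression in the variable `r`, the loop counter being `a`. -/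
def sum (a k r : ℕ) (e : NExp) : Cmd :=
  block [setVar r (const 0), forTo a k (setVar r (plus (var r) e))]

theorem exec_sum {n a k r : ℕ} {e : NExp} {s : Store} (f : ℕ → ℕ) (hra : r ≠ a)
    (hf : ∀ i < k * n, ∀ s' : Store, s'.nat a 0 0 = i →
      (∀ b, b ≠ a → b ≠ r → s'.nat b = s.nat b) → e.eval s' = f i) :
    ((sum a k r e).exec n s).nat r 0 0 = ∑ i ∈ range (k * n), f i := by
  rw [sum, exec_block_cons, exec_block_cons, exec_block_nil]
  refine exec_forTo (fun i t => t.nat r 0 0 = ∑ i ∈ range i, f i) (by simp [nwrites, hra]) ?_ ?_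
  · rw [setN_nat_ne _ hra]
    simp [NExp.eval]
  · intro i hi t hti fN _ hQ
    rw [setN_nat_ne _ hra, sum_range_succ, ← hQ]
    simp only [exec_setNat, NExp.eval, setN_nat_self, upd_self]
    rw [hf i hi t hti fun b hba hbr => ?_]
    rw [fN b hba (by simp [nwrites, hbr.symm])]
    exact setN_nat_ne s hbr _ _ _

/-- Search for a smallest deficient biset that separates node `39` from node `38`, and if it is
smaller than `16`, store it in row `38` of array `14`. -/
def separate : Cmd :=
  ite (.conj (.neg (Test.natEq (var 38) (var 39)))
      (.natLe (get 0 (const 0) (const 1)) (get 3 (var 38) (var 39))))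
    (block [setVar 20 (plus (var 0) (var 38)), setVar 21 (var 39), flow,
      ite (.natLe (plus (var 11) (const 1)) (get 0 (const 0) (const 1)))
        (block [sum 40 2 22 (minus (const 1) (minus (const 1) (list 9 (var 40)))),
          ite (.natLe (plus (var 22) (const 1)) (var 16))
            (block [setNat 15 (var 38) (const 0) (const 1), setVar 16 (var 22),
              forTo 41 2 (setNat 14 (var 38) (var 41)
                (minus (const 1) (minus (const 1) (list 9 (var 41)))))]) skip]) skip]) skip

theorem exec_separate {n : ℕ} {I : Phase (Fin n)} {P : Finset (Fin n)} {s : Store} (hI : I.Valid)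
    (hX : I.X ⊆ P) (h : Loaded I s) (hP : Selects P s) {u v : Fin n} (hu : s.nat 38 0 0 = u)
    (hv : s.nat 39 0 0 = v) :
    ((separate.exec n s).nat 14 = s.nat 14 ∧ (separate.exec n s).nat 15 = s.nat 15 ∧
      (separate.exec n s).nat 16 = s.nat 16 ∧
      (I.ℓ ≤ I.r u v → ∀ C, Separates I P u v C → s.nat 16 0 0 ≤ C.size)) ∨
    ((∀ w, w ≠ (u : ℕ) → (separate.exec n s).nat 14 w = s.nat 14 w) ∧
      (separate.exec n s).nat 15 = upd (s.nat 15) u 0 1 ∧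
      I.ℓ ≤ I.r u v ∧ ∃ D, Separates I P u v D ∧ (∀ C, Separates I P u v C → D.size ≤ C.size) ∧
        D.size < s.nat 16 0 0 ∧ (separate.exec n s).nat 16 0 0 = D.size ∧
        IsRow ((separate.exec n s).nat 14 u) D) := by
  rw [separate, exec_ite]
  simp only [Test.holds, Test.holds_natEq, NExp.eval, hu, hv, h.level, h.req]
  by_cases hT : ¬ (u : ℕ) = v ∧ I.ℓ ≤ I.r u v
  · rw [if_pos hT]
    have huv : u ≠ v := fun h => hT.1 (congrArg _ h)
    rw [exec_block_cons, exec_block_cons, exec_block_cons, exec_block_cons, exec_block_nil]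
    set s₁ := (setVar 21 (var 39)).exec n ((setVar 20 (plus (var 0) (var 38))).exec n s) with hs₁
    have e : ∀ b, b ≠ 20 → b ≠ 21 → s₁.nat b = s.nat b := by
      intro b h1 h2
      simp only [hs₁, exec_setNat]
      rw [setN_nat_ne _ h2, setN_nat_ne _ h1]
    have e20 : s₁.nat 20 0 0 = n + u := by
      simp [hs₁, NExp.eval, setN_nat_ne, hu, h.size]
    have e21 : s₁.nat 21 0 0 = v := by
      simp [hs₁, NExp.eval, setN_nat_ne, hv]
    have hL₁ : Loaded I s₁ := h.of_eq (fun b hb => e b (by omega) (by omega)) rfl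
    have hP₁ : Selects P s₁ := by
      intro w
      rw [e 5 (by decide) (by decide)]
      exact hP w
    have hflow := exec_flow_separates hI hX hL₁ hP₁ huv hT.2 e20 e21
    have hL₂ : Loaded I (flow.exec n s₁) := hL₁.exec (by decide) (by decide)
    have f14 : (flow.exec n s₁).nat 14 = s.nat 14 :=
      (exec_nat_eq rfl s₁).trans (e 14 (by decide) (by decide))
    have f15 : (flow.exec n s₁).nat 15 = s.nat 15 :=
      (exec_nat_eq rfl s₁).trans (e 15 (by decide) (by decide))
    have f16 : (flow.exec n s₁).nat 16 = s.nat 16 :=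
      (exec_nat_eq rfl s₁).trans (e 16 (by decide) (by decide))
    have f38 : (flow.exec n s₁).nat 38 = s.nat 38 :=
      (exec_nat_eq rfl s₁).trans (e 38 (by decide) (by decide))
    set s₂ := flow.exec n s₁
    rw [exec_ite]
    simp only [Test.holds, NExp.eval, hL₂.level]
    rcases hflow with ⟨hval, D, hD, hDe, hmin⟩ | ⟨hval, hno⟩
    · rw [if_pos (by exact hval), exec_block_cons, exec_block_cons, exec_block_nil]
      have hrow := hDe.isRow
      have hsum := exec_sum (n := n) (a := 40) (k := 2) (r := 22) (s := s₂)
        (e := minus (const 1) (minus (const 1) (list 9 (var 40))))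
        (fun x => 1 - (1 - s₂.nat 9 x 0)) (by decide) (by
          intro i _ s' hi hs'
          simp only [NExp.eval, hi, hs' 9 (by decide) (by decide)])
      rw [hrow.sum_eq] at hsum
      have g : ∀ b, b ≠ 22 → b ≠ 40 → ((sum 40 2 22 (minus (const 1) (minus (const 1)
          (list 9 (var 40))))).exec n s₂).nat b = s₂.nat b := fun b h1 h2 =>
        exec_nat_eq (by simp [sum, nwrites, block, h1.symm, h2.symm]) s₂
      set s₃ := (sum 40 2 22 (minus (const 1) (minus (const 1) (list 9 (var 40))))).exec n s₂
      rw [exec_ite]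
      simp only [Test.holds, NExp.eval, hsum, g 16 (by decide) (by decide), f16]
      by_cases hlt : D.size + 1 ≤ s.nat 16 0 0
      · right
        rw [if_pos hlt, exec_block_cons, exec_block_cons, exec_block_cons, exec_block_nil]
        set s₄ := (setVar 16 (var 22)).exec n
          ((setNat 15 (var 38) (const 0) (const 1)).exec n s₃) with hs₄
        have g38 : s₃.nat 38 0 0 = u := by rw [g 38 (by decide) (by decide), f38, hu]
        have k38 : s₄.nat 38 0 0 = u := by
          rw [← g38]
          simp [hs₄, setN_nat_ne]
        have k9 : s₄.nat 9 = s₂.nat 9 := by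
          rw [← g 9 (by decide) (by decide)]
          simp [hs₄, setN_nat_ne]
        have k14 : s₄.nat 14 = s.nat 14 := by
          rw [← f14, ← g 14 (by decide) (by decide)]
          simp [hs₄, setN_nat_ne]
        have k15 : s₄.nat 15 = upd (s.nat 15) u 0 1 := by
          rw [← f15, ← g 15 (by decide) (by decide)]
          simp [hs₄, setN_nat_ne, NExp.eval, g38]
        have k16 : s₄.nat 16 0 0 = D.size := by
          rw [← hsum]
          simp [hs₄, setN_nat_ne, NExp.eval]
        have key := exec_forTo (n := n) (a := 41) (k := 2) (s := s₄)
          (c := setNat 14 (var 38) (var 41) (minus (const 1) (minus (const 1) (list 9 (var 41)))))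
          (fun i t => (∀ w, w ≠ (u : ℕ) → t.nat 14 w = s.nat 14 w) ∧
            ∀ x < i, t.nat 14 u x = 1 - (1 - s₂.nat 9 x 0)) rfl ?_ ?_
        · rw [exec_nat_eq (b := 15) rfl, exec_nat_eq (b := 16) rfl]
          refine ⟨key.1, k15, hT.2, D, hD, hmin, by omega, k16, fun w => ?_⟩
          have := w.isLt
          rw [key.2 w (by omega), key.2 (n + w) (by omega)]
          exact hrow w
        · rw [setN_nat_ne _ (by decide), k14]
          exact ⟨fun _ _ => rfl, fun x hx => absurd hx (by omega)⟩
        · intro i hi t hti fN _ ⟨q1, q2⟩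
          rw [setN_nat_ne _ (by decide)]
          simp only [exec_setNat, NExp.eval, setN_nat_self, hti, fN 38 (by decide) rfl,
            fN 9 (by decide) rfl, k38, k9]
          constructor
          · intro w hw
            rw [← q1 w hw]
            funext x
            simp [upd, hw]
          · intro x hx
            by_cases hxi : x = i
            · rw [hxi, upd_self]
            · simp only [upd, hxi, and_false, if_false]
              exact q2 x (by omega)
      · left
        rw [if_neg hlt, exec_skip, g 14 (by decide) (by decide), g 15 (by decide) (by decide),
          g 16 (by decide) (by decide)]
        exact ⟨f14, f15, f16, fun _ C hC => by
          have := hmin C hC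
          omega⟩
    · rw [if_neg (by exact hval), exec_skip]
      exact Or.inl ⟨f14, f15, f16, fun _ C hC => absurd hC (hno C)⟩
  · rw [if_neg hT, exec_skip]
    refine Or.inl ⟨rfl, rfl, rfl, fun hr C hC => absurd ⟨?_, hr⟩ hT⟩
    intro huv
    have := hC.2.2.1
    rw [← Fin.ext huv] at this
    exact absurd (C.sub hC.2.1) this

/-- For each node, search for a smallest deficient biset that separates another node from it. -/
def candidates : Cmd :=
  forTo 38 1 (block [setNat 15 (var 38) (const 0) (const 0),
    setVar 16 (plus (plus (var 0) (var 0)) (const 1)), forTo 39 1 separate])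

/-- The result of the search for the node `u`. -/
def RowSpec {n : ℕ} (I : Phase (Fin n)) (P : Finset (Fin n)) (s : Store) (u : Fin n) : Prop :=
  (s.nat 15 u 0 = 0 ∧ ∀ v, I.ℓ ≤ I.r u v → ∀ C, ¬ Separates I P u v C) ∨
  (s.nat 15 u 0 = 1 ∧ ∃ D, IsRow (s.nat 14 u) D ∧ (∃ v, I.ℓ ≤ I.r u v ∧ Separates I P u v D) ∧
    ∀ v, I.ℓ ≤ I.r u v → ∀ C, Separates I P u v C → D.size ≤ C.size)

theorem exec_candidates {n : ℕ} {I : Phase (Fin n)} {P : Finset (Fin n)} {s : Store} (hI : I.Valid)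
    (hX : I.X ⊆ P) (h : Loaded I s) (hP : Selects P s) :
    ∀ u, RowSpec I P (candidates.exec n s) u := by
  suffices ∀ u : Fin n, (u : ℕ) < 1 * n → RowSpec I P (candidates.exec n s) u from
    fun u => this u (by omega)
  rw [candidates]
  refine exec_forTo (fun i t => ∀ u : Fin n, (u : ℕ) < i → RowSpec I P t u) rfl
    (fun u hu => absurd hu (by omega)) ?_
  intro i hi t hti fN fR hQ
  have hL : Loaded I t := h.of_eq (fun b hb => fN b (by omega) (by
    have : ∀ b < 5, (block [setNat 15 (var 38) (const 0) (const 0),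
      setVar 16 (plus (plus (var 0) (var 0)) (const 1)), forTo 39 1 separate]).nwrites b = false := by
      decide
    exact this b hb)) (fR 0 rfl)
  have hPt : Selects P t := by
    intro w
    rw [fN 5 (by decide) rfl]
    exact hP w
  rw [exec_block_cons, exec_block_cons, exec_block_cons, exec_block_nil]
  set t₁ := (setVar 16 (plus (plus (var 0) (var 0)) (const 1))).exec n
    ((setNat 15 (var 38) (const 0) (const 0)).exec n t) with ht₁
  have e : ∀ b, b ≠ 15 → b ≠ 16 → t₁.nat b = t.nat b := by
    intro b h1 h2
    simp only [ht₁, exec_setNat]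
    rw [setN_nat_ne _ h2, setN_nat_ne _ h1]
  have e15 : t₁.nat 15 = upd (t.nat 15) i 0 0 := by
    simp [ht₁, NExp.eval, setN_nat_ne, hti]
  -- Sentinel above every possible size 2n: the first biset found is always accepted.
  have e16 : t₁.nat 16 0 0 = 2 * n + 1 := by
    simp [ht₁, NExp.eval, setN_nat_ne, hL.size, two_mul]
  set u₀ : Fin n := ⟨i, by omega⟩ with hu₀
  have key := exec_forTo (n := n) (a := 39) (k := 1) (s := t₁) (c := separate)
    (fun j t' => (∀ w, w ≠ i → t'.nat 14 w = t.nat 14 w ∧ t'.nat 15 w = t.nat 15 w) ∧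
      ((t'.nat 15 i 0 = 0 ∧ t'.nat 16 0 0 = 2 * n + 1) ∨
        (t'.nat 15 i 0 = 1 ∧ ∃ D, IsRow (t'.nat 14 i) D ∧
          (∃ v, I.ℓ ≤ I.r u₀ v ∧ Separates I P u₀ v D) ∧ t'.nat 16 0 0 = D.size)) ∧
      ∀ v : Fin n, (v : ℕ) < j → I.ℓ ≤ I.r u₀ v → ∀ C, Separates I P u₀ v C →
        t'.nat 16 0 0 ≤ C.size) rfl ?_ ?_
  · set t₂ := (forTo 39 1 separate).exec n t₁
    intro u hu
    rw [RowSpec]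
    simp only [setN_nat_ne _ (show 15 ≠ 38 by decide), setN_nat_ne _ (show 14 ≠ 38 by decide)]
    obtain ⟨k1, k2, k3⟩ := key
    by_cases hui : u = u₀
    · subst hui
      simp only [hu₀]
      rcases k2 with ⟨k4, k5⟩ | ⟨k4, D, k5, k6, k7⟩
      · refine Or.inl ⟨k4, fun v hr C hC => ?_⟩
        have := k3 v (by omega) hr C hC
        have := size_le C
        omega
      · exact Or.inr ⟨k4, D, k5, k6, fun v hr C hC => k7 ▸ k3 v (by omega) hr C hC⟩
    · have hui' : (u : ℕ) ≠ i := fun h => hui (Fin.ext h)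
      rw [(k1 u hui').1, (k1 u hui').2]
      exact hQ u (by omega)
  · simp only [setN_nat_ne _ (show 15 ≠ 39 by decide), setN_nat_ne _ (show 14 ≠ 39 by decide),
      setN_nat_ne _ (show 16 ≠ 39 by decide), e 14 (by decide) (by decide), e15]
    refine ⟨fun w hw => ⟨trivial, ?_⟩, Or.inl ⟨by simp, e16⟩, fun v hv => absurd hv (by omega)⟩
    funext x
    simp [upd, hw]
  · intro j hj t' htj fN' fR' ⟨q1, q2, q3⟩
    simp only [setN_nat_ne _ (show 15 ≠ 39 by decide), setN_nat_ne _ (show 14 ≠ 39 by decide),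
      setN_nat_ne _ (show 16 ≠ 39 by decide)]
    have hw : ∀ b < 6, separate.nwrites b = false := by decide
    have hL' : Loaded I t' := hL.of_eq (fun b hb => by
      rw [fN' b (by omega) (hw b (by omega)), e b (by omega) (by omega)]) (by rw [fR' 0 rfl]; rfl)
    have hP' : Selects P t' := by
      intro w
      rw [fN' 5 (by decide) rfl, e 5 (by decide) (by decide)]
      exact hPt w
    have h38 : t'.nat 38 0 0 = (u₀ : ℕ) := by
      rw [fN' 38 (by decide) rfl, e 38 (by decide) (by decide), hti]
    have hcase : ∀ v : Fin n, (v : ℕ) < j + 1 → (v : ℕ) < j ∨ v = ⟨j, by omega⟩ := by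
      intro v hv
      rw [Fin.ext_iff]
      simp only
      omega
    rcases exec_separate hI hX hL' hP' (u := u₀) (v := ⟨j, by omega⟩) h38 htj with
      ⟨s1, s2, s3, s4⟩ | ⟨s1, s2, s3, D, s4, s5, s6, s7, s8⟩
    · rw [s1, s2, s3]
      refine ⟨q1, q2, fun v hv hr C hC => ?_⟩
      rcases hcase v hv with h | rfl
      · exact q3 v h hr C hC
      · exact s4 hr C hC
    · rw [s2, s7]
      refine ⟨fun w hw => ⟨(s1 w hw).trans (q1 w hw).1, ?_⟩, Or.inr ⟨by simp [hu₀], D, s8,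
        ⟨_, s3, s4⟩, rfl⟩, fun v hv hr C hC => ?_⟩
      · rw [← (q1 w hw).2]
        funext x
        simp [upd, hw, hu₀]
      · rcases hcase v hv with h | rfl
        · exact s6.le.trans (q3 v h hr C hC)
        · exact s5 C hC

end Cmd

end RAM

/-! ### The program that finds the minimal violated bisets and counts them at each node -/

namespace RAM

open Cmd NExp

/-- Inclusion test by truncated subtraction: a term is nonzero exactly where the first set has an
element that the second lacks. -/
theorem IsRow.sum_sub_eq_zero {n : ℕ} {row row' : ℕ → ℕ} {D D' : Biset (Fin n)} (h : IsRow row D)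
    (h' : IsRow row' D') : ∑ x ∈ range (2 * n), (row x - row' x) = 0 ↔ D ≤ D' := by
  rw [two_mul, sum_range_add, sum_range, sum_range, Nat.add_eq_zero_iff, sum_eq_zero_iff,
    sum_eq_zero_iff, Biset.le_iff, and_comm]
  refine and_congr ⟨fun hz v hv => ?_, fun hz v _ => ?_⟩ ⟨fun hz v hv => ?_, fun hz v _ => ?_⟩
  · have := hz v (mem_univ v)
    rw [(h v).2, (h' v).2, if_pos hv] at this
    by_contra hv'
    simp [hv'] at this
  · rw [(h v).2, (h' v).2]
    have := @hz v
    split_ifs <;> simp_all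
  · have := hz v (mem_univ v)
    rw [(h v).1, (h' v).1, if_pos hv] at this
    by_contra hv'
    simp [hv'] at this
  · rw [(h v).1, (h' v).1]
    have := @hz v
    split_ifs <;> simp_all

open scoped Classical in
/-- The minimal violated bisets with respect to `P` are stored in the rows of array `14` marked in
array `17`. -/
def ListsViolated {n : ℕ} (I : Phase (Fin n)) (P : Finset (Fin n)) (s : Store) : Prop :=
  ∃ (D : Fin n → Biset (Fin n)) (K : Finset (Fin n)),
    (∀ u : Fin n, s.nat 17 u 0 = if u ∈ K then 1 else 0) ∧ (∀ u ∈ K, IsRow (s.nat 14 u) (D u)) ∧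
    Set.InjOn D K ∧ I.violatedBisets P = K.image D

namespace Cmd

theorem upd_upd {α : Type*} (f : ℕ → ℕ → α) (i j : ℕ) (x y : α) :
    upd (upd f i j x) i j y = upd f i j y := by
  funext i' j'
  simp only [upd]
  split_ifs <;> rfl

/-- Unmark row `42` if row `43` is below it, or equal to it and earlier. -/
def dominate : Cmd := block
  [ sum 44 2 23 (minus (get 14 (var 43) (var 44)) (get 14 (var 42) (var 44))),
    sum 44 2 24 (minus (get 14 (var 42) (var 44)) (get 14 (var 43) (var 44))),
    ite (.conj (.natLe (var 23) (const 0))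
        (.neg (.conj (.natLe (var 24) (const 0)) (.natLe (var 42) (var 43)))))
      (setNat 17 (var 42) (const 0) (const 0)) skip ]

open scoped Classical in
theorem exec_dominate {n i j : ℕ} {s : Store} (hi : s.nat 42 0 0 = i) (hj : s.nat 43 0 0 = j) :
    (dominate.exec n s).nat 17 =
      if ∑ x ∈ range (2 * n), (s.nat 14 j x - s.nat 14 i x) = 0 ∧
        ¬ (∑ x ∈ range (2 * n), (s.nat 14 i x - s.nat 14 j x) = 0 ∧ i ≤ j)
      then upd (s.nat 17) i 0 0 else s.nat 17 := by
  rw [dominate, exec_block_cons, exec_block_cons, exec_block_cons, exec_block_nil]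
  have s1 := exec_sum (n := n) (a := 44) (k := 2) (r := 23) (s := s)
    (e := minus (get 14 (var 43) (var 44)) (get 14 (var 42) (var 44)))
    (fun x => s.nat 14 j x - s.nat 14 i x) (by decide) (by
      intro x _ r hx hr
      simp only [NExp.eval, hx, hr 14 (by decide) (by decide), hr 43 (by decide) (by decide),
        hr 42 (by decide) (by decide), hi, hj])
  have g : ∀ b, b ≠ 23 → b ≠ 44 → ((sum 44 2 23 (minus (get 14 (var 43) (var 44))
      (get 14 (var 42) (var 44)))).exec n s).nat b = s.nat b := fun b h1 h2 =>
    exec_nat_eq (by simp [sum, nwrites, block, h1.symm, h2.symm]) s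
  set t₂ := (sum 44 2 23 (minus (get 14 (var 43) (var 44)) (get 14 (var 42) (var 44)))).exec n s
  have s2 := exec_sum (n := n) (a := 44) (k := 2) (r := 24) (s := t₂)
    (e := minus (get 14 (var 42) (var 44)) (get 14 (var 43) (var 44)))
    (fun x => s.nat 14 i x - s.nat 14 j x) (by decide) (by
      intro x _ r hx hr
      simp only [NExp.eval, hx, hr 14 (by decide) (by decide), hr 43 (by decide) (by decide),
        hr 42 (by decide) (by decide), g 14 (by decide) (by decide),
        g 43 (by decide) (by decide), g 42 (by decide) (by decide), hi, hj])
  have g' : ∀ b, b ≠ 24 → b ≠ 44 → ((sum 44 2 24 (minus (get 14 (var 42) (var 44))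
      (get 14 (var 43) (var 44)))).exec n t₂).nat b = t₂.nat b := fun b h1 h2 =>
    exec_nat_eq (by simp [sum, nwrites, block, h1.symm, h2.symm]) t₂
  set t₃ := (sum 44 2 24 (minus (get 14 (var 42) (var 44)) (get 14 (var 43) (var 44)))).exec n t₂
  have f17 : t₃.nat 17 = s.nat 17 := by
    rw [g' 17 (by decide) (by decide), g 17 (by decide) (by decide)]
  have f42 : t₃.nat 42 0 0 = i := by
    rw [g' 42 (by decide) (by decide), g 42 (by decide) (by decide), hi]
  rw [exec_ite]
  simp only [Test.holds, NExp.eval, s2, g' 23 (by decide) (by decide), s1, f42,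
    g' 43 (by decide) (by decide), g 43 (by decide) (by decide), hj, Nat.le_zero]
  split_ifs
  · simp only [exec_setNat, NExp.eval, setN_nat_self, f42, f17]
  · rw [exec_skip, f17]

/-- Mark in array `17` the rows of array `14` marked in array `15` that are minimal and do not repeat
earlier ones. -/
def activate : Cmd :=
  forTo 42 1 (block [setNat 17 (var 42) (const 0) (list 15 (var 42)),
    forTo 43 1 (ite (.natLe (const 1) (list 15 (var 43))) dominate skip)])

open scoped Classical in
theorem exec_activate {n : ℕ} {s : Store} {p : Fin n → Prop} {D : Fin n → Biset (Fin n)}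
    (hp : ∀ u : Fin n, s.nat 15 u 0 = if p u then 1 else 0)
    (hD : ∀ u : Fin n, p u → IsRow (s.nat 14 u) (D u)) (u : Fin n) :
    (activate.exec n s).nat 17 u 0 = if IsFirst p D u then 1 else 0 := by
  suffices ∀ u : Fin n, (u : ℕ) < 1 * n →
      (activate.exec n s).nat 17 u 0 = if IsFirst p D u then 1 else 0 from this u (by omega)
  rw [activate]
  refine exec_forTo (fun i t => ∀ u : Fin n, (u : ℕ) < i →
    t.nat 17 u 0 = if IsFirst p D u then 1 else 0) rfl (fun u hu => absurd hu (by omega)) ?_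
  intro i hi t hti fN _ hQ
  rw [exec_block_cons, exec_block_cons, exec_block_nil, setN_nat_ne _ (by decide)]
  have e15 : t.nat 15 = s.nat 15 := fN 15 (by decide) rfl
  have e14 : t.nat 14 = s.nat 14 := fN 14 (by decide) rfl
  set t₁ := (setNat 17 (var 42) (const 0) (list 15 (var 42))).exec n t with ht₁
  have e : ∀ b, b ≠ 17 → t₁.nat b = t.nat b := fun b h => setN_nat_ne _ h _ _ _
  set u₀ : Fin n := ⟨i, by omega⟩ with hu₀
  have e17 : t₁.nat 17 = upd (t.nat 17) i 0 (if p u₀ then 1 else 0) := by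
    rw [← hp]
    simp [ht₁, NExp.eval, hti, e15, hu₀]
  -- The part of `IsFirst` that has been verified against the candidates below j.
  let Q : ℕ → Prop := fun j => p u₀ ∧ ∀ v : Fin n, (v : ℕ) < j → p v → D v ≤ D u₀ →
    D u₀ ≤ D v ∧ u₀ ≤ v
  have key := exec_forTo (n := n) (a := 43) (k := 1) (s := t₁)
    (c := ite (.natLe (const 1) (list 15 (var 43))) dominate skip)
    (fun j t' => t'.nat 17 = upd (t.nat 17) i 0 (if Q j then 1 else 0)) rfl ?_ ?_
  · intro u hu
    rw [key]
    by_cases hui : u = u₀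
    · have : Q (1 * n) ↔ IsFirst p D u₀ := by
        exact and_congr_right fun _ => forall_congr' fun v => by simp
      simp only [this, hui, hu₀, upd_self]
    · have hui' : (u : ℕ) ≠ i := fun h => hui (Fin.ext h)
      simp only [upd, hui', false_and, if_false]
      exact hQ u (by omega)
  · rw [setN_nat_ne _ (by decide), e17]
    simp [Q]
  · intro j hj t' htj fN' _ hQ'
    rw [setN_nat_ne _ (by decide)]
    set v₀ : Fin n := ⟨j, by omega⟩ with hv₀
    have f15 : t'.nat 15 j 0 = if p v₀ then 1 else 0 := by
      rw [fN' 15 (by decide) rfl, e 15 (by decide), e15, ← hp]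
    have f14 : t'.nat 14 = s.nat 14 := by rw [fN' 14 (by decide) rfl, e 14 (by decide), e14]
    have f42 : t'.nat 42 0 0 = i := by rw [fN' 42 (by decide) rfl, e 42 (by decide), hti]
    have hcase : ∀ v : Fin n, (v : ℕ) < j + 1 ↔ (v : ℕ) < j ∨ v = v₀ := by
      intro v
      rw [Fin.ext_iff]
      simp only [hv₀]
      omega
    have hall : Q (j + 1) ↔ Q j ∧ (p u₀ → p v₀ → D v₀ ≤ D u₀ → D u₀ ≤ D v₀ ∧ u₀ ≤ v₀) := by
      constructor
      · rintro ⟨h1, h2⟩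
        exact ⟨⟨h1, fun v hv => h2 v ((hcase v).2 (Or.inl hv))⟩,
          fun _ => h2 v₀ ((hcase v₀).2 (Or.inr rfl))⟩
      · rintro ⟨⟨h1, h2⟩, h3⟩
        refine ⟨h1, fun v hv => ?_⟩
        rcases (hcase v).1 hv with hv | rfl
        · exact h2 v hv
        · exact h3 h1
    rw [exec_ite]
    simp only [Test.holds, NExp.eval, htj, f15]
    by_cases hpv : p v₀
    · rw [if_pos (by simp [hpv]), exec_dominate f42 htj, f14, hQ', upd_upd]
      by_cases hpu : p u₀
      · have k1 : _ ↔ D v₀ ≤ D u₀ := (hD v₀ hpv).sum_sub_eq_zero (hD u₀ hpu)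
        have k2 : _ ↔ D u₀ ≤ D v₀ := (hD u₀ hpu).sum_sub_eq_zero (hD v₀ hpv)
        have hT := and_congr k1 (not_congr (and_congr_left' (c := i ≤ j) k2))
        by_cases hbad : D v₀ ≤ D u₀ ∧ ¬ (D u₀ ≤ D v₀ ∧ i ≤ j)
        · rw [if_pos (hT.2 hbad), if_neg fun h => hbad.2 ((hall.1 h).2 hpu hpv hbad.1)]
        · have : Q (j + 1) ↔ Q j := by
            rw [hall]
            refine ⟨fun h => h.1, fun h => ⟨h, fun _ _ h' => ?_⟩⟩
            by_contra h''
            exact hbad ⟨h', h''⟩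
          rw [if_neg (mt hT.1 hbad)]
          simp only [this]
      · rw [if_neg fun h : Q j => hpu h.1, if_neg fun h : Q (j + 1) => hpu h.1]
        split_ifs <;> rfl
    · have : Q (j + 1) ↔ Q j := by
        rw [hall]
        exact ⟨fun h => h.1, fun h => ⟨h, fun _ h' => absurd h' hpv⟩⟩
      rw [if_neg (by simp [hpv]), exec_skip, hQ']
      simp only [this]

/-- Find the minimal violated bisets. -/
def violated : Cmd := block [candidates, activate]

theorem exec_violated {n : ℕ} {I : Phase (Fin n)} {P : Finset (Fin n)} {s : Store} (hI : I.Valid)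
    (hX : I.X ⊆ P) (h : Loaded I s) (hP : Selects P s) :
    ListsViolated I P (violated.exec n s) := by
  classical
  rw [violated, exec_block_cons, exec_block_cons, exec_block_nil]
  have hrow := exec_candidates hI hX h hP
  set t := candidates.exec n s
  have hex : ∀ u : Fin n, ∃ D, t.nat 15 u 0 = 1 → IsRow (t.nat 14 u) D ∧
      (∃ v, I.ℓ ≤ I.r u v ∧ Separates I P u v D) ∧
      ∀ v, I.ℓ ≤ I.r u v → ∀ C, Separates I P u v C → D.size ≤ C.size := by
    intro u
    rcases hrow u with ⟨h0, -⟩ | ⟨h1, D, hD⟩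
    · exact ⟨⟨∅, ∅, subset_rfl⟩, fun h1 => by omega⟩
    · exact ⟨D, fun _ => hD⟩
  choose D hD using hex
  have hsm : IsSmallest I P (fun u => t.nat 15 u 0 = 1) D := by
    refine ⟨fun u hu => (hD u hu).2.1, fun u v hr C hC => ?_⟩
    rcases hrow u with ⟨-, h0⟩ | ⟨h1, -⟩
    · exact absurd hC (h0 v hr C)
    · exact ⟨h1, (hD u h1).2.2 v hr C hC⟩
  have hmem := (hsm.candidates hI hX).mem_violatedBisets_iff hI hX
  have hact := exec_activate (s := t) (p := fun u => t.nat 15 u 0 = 1) (D := D) (fun u => by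
    rcases hrow u with ⟨h0, -⟩ | ⟨h1, -⟩ <;> simp [*]) fun u hu => (hD u hu).1
  refine ⟨D, univ.filter fun u => IsFirst (fun u => t.nat 15 u 0 = 1) D u, fun u => ?_,
    fun u hu => ?_, fun u hu v hv huv => ?_, ?_⟩
  · rw [hact]
    simp only [mem_filter, mem_univ, true_and]
  · rw [mem_filter] at hu
    rw [exec_nat_eq (b := 14) rfl]
    exact (hD u hu.2.1).1
  · simp only [coe_filter, mem_univ, true_and, Set.mem_ofPred_eq] at hu hv
    exact hu.inj hv huv
  · ext C
    rw [hmem, mem_image]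
    simp only [mem_filter, mem_univ, true_and]

/-- Store in `25` the number of minimal violated bisets. -/
def countViolated : Cmd := sum 48 1 25 (list 17 (var 48))

theorem exec_countViolated {n : ℕ} {I : Phase (Fin n)} {P : Finset (Fin n)} {s : Store}
    (h : ListsViolated I P s) :
    (countViolated.exec n s).nat 25 0 0 = #(I.violatedBisets P) := by
  classical
  obtain ⟨D, K, h1, -, h3, h4⟩ := h
  rw [countViolated, exec_sum (fun x => s.nat 17 x 0) (by decide) (by
    intro i _ s' hi hs'
    simp only [NExp.eval, hi, hs' 17 (by decide) (by decide)]), one_mul, sum_range,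
    sum_congr rfl fun u _ => h1 u, h4, card_image_of_injOn h3]
  simp

/-- Count in array `19` the minimal violated bisets with a given neighbour outside array `5`. -/
def countNbr : Cmd :=
  forTo 45 1 (block [setNat 19 (var 45) (const 0) (const 0),
    forTo 46 1 (block [
      sum 47 1 28 (minus (plus (get 14 (var 46) (plus (var 0) (var 47))) (get 1 (var 47) (var 45)))
        (const 1)),
      ite (.conj (.natLe (const 1) (list 17 (var 46)))
          (.conj (.natLe (get 14 (var 46) (var 45)) (const 0))
            (.conj (.natLe (list 5 (var 45)) (const 0)) (.natLe (const 1) (var 28)))))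
        (setNat 19 (var 45) (const 0) (plus (list 19 (var 45)) (const 1))) skip])])

open scoped Classical in
theorem exec_countNbr {n : ℕ} {I : Phase (Fin n)} {P : Finset (Fin n)} {s : Store} (hI : I.Valid)
    (hX : I.X ⊆ P) (h : Loaded I s) (hP : Selects P s) (hC : ListsViolated I P s) (v : Fin n) :
    (countNbr.exec n s).nat 19 v 0 = #((I.violatedBisets P).filter fun C => v ∈ C.nbr I.Gℓ) := by
  obtain ⟨D, K, h1, h2, h3, h4⟩ := hC
  have hcard : #((I.violatedBisets P).filter fun C => v ∈ C.nbr I.Gℓ) =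
      ∑ u : Fin n, if u ∈ K ∧ v ∈ (D u).nbr I.Gℓ then 1 else 0 := by
    rw [h4, filter_image, card_image_of_injOn (h3.mono (filter_subset _ _)), ← card_filter]
    congr 1
    ext u
    simp
  -- An edge with an end outside P ⊇ X is not in `I.H`, so the program can work with adjacency in G
  -- and never builds `I.Gℓ`.
  have hnbr : ∀ u ∈ K, (v ∈ (D u).nbr I.Gℓ ↔
      v ∉ (D u).outer ∧ v ∉ P ∧ ∃ w ∈ (D u).inner, I.G.Adj w v) := by
    intro u hu
    have hu' : D u ∈ I.violatedBisets P := by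
      rw [h4]
      exact mem_image_of_mem D hu
    constructor
    · intro hv
      refine ⟨(Biset.mem_nbr.1 hv).1, Phase.notMem_of_mem_nbr hI hX hu' hv, ?_⟩
      obtain ⟨w, hw, hwv⟩ := (Biset.mem_nbr.1 hv).2
      exact ⟨w, hw, hwv.1⟩
    · rintro ⟨hv, hvP, w, hw, hwv⟩
      exact Biset.mem_nbr.2 ⟨hv, w, hw, hwv, fun h => hvP (hX h.2.2)⟩
  rw [hcard]
  clear hcard
  suffices ∀ v : Fin n, (∀ u ∈ K, (v ∈ (D u).nbr I.Gℓ ↔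
      v ∉ (D u).outer ∧ v ∉ P ∧ ∃ w ∈ (D u).inner, I.G.Adj w v)) → (v : ℕ) < 1 * n →
      (countNbr.exec n s).nat 19 v 0 = ∑ u : Fin n, if u ∈ K ∧ v ∈ (D u).nbr I.Gℓ then 1 else 0 from
    this v hnbr (by omega)
  clear hnbr v
  rw [countNbr]
  refine exec_forTo (fun i t => ∀ v : Fin n, (∀ u ∈ K, (v ∈ (D u).nbr I.Gℓ ↔
      v ∉ (D u).outer ∧ v ∉ P ∧ ∃ w ∈ (D u).inner, I.G.Adj w v)) → (v : ℕ) < i →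
      t.nat 19 v 0 = ∑ u : Fin n, if u ∈ K ∧ v ∈ (D u).nbr I.Gℓ then 1 else 0) rfl
    (fun v _ hv => absurd hv (by omega)) ?_
  intro i hi t hti fN _ hQ
  have eN : ∀ b, b ≠ 45 → b ≠ 19 → b ≠ 46 → b ≠ 28 → b ≠ 47 → t.nat b = s.nat b :=
    fun b h1 h2 h3 h4 h5 => fN b h1 (by
      simp [sum, nwrites, block, h2.symm, h3.symm, h4.symm, h5.symm])
  rw [exec_block_cons, exec_block_cons, exec_block_nil, setN_nat_ne _ (by decide)]
  set t₁ := (setNat 19 (var 45) (const 0) (const 0)).exec n t with ht₁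
  have e : ∀ b, b ≠ 19 → t₁.nat b = t.nat b := fun b h => setN_nat_ne _ h _ _ _
  have e19 : t₁.nat 19 = upd (t.nat 19) i 0 0 := by
    simp [ht₁, NExp.eval, hti]
  set v₀ : Fin n := ⟨i, by omega⟩ with hv₀
  intro v hnbr hv
  let g : ℕ → ℕ := fun j => if hj : j < n then
    (if (⟨j, hj⟩ : Fin n) ∈ K ∧ v₀ ∈ (D ⟨j, hj⟩).nbr I.Gℓ then 1 else 0) else 0
  by_cases hvi : v = v₀
  · subst hvi
    have key := exec_forTo (n := n) (a := 46) (k := 1) (s := t₁)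
      (c := block [
        sum 47 1 28 (minus (plus (get 14 (var 46) (plus (var 0) (var 47)))
          (get 1 (var 47) (var 45))) (const 1)),
        ite (.conj (.natLe (const 1) (list 17 (var 46)))
          (.conj (.natLe (get 14 (var 46) (var 45)) (const 0))
            (.conj (.natLe (list 5 (var 45)) (const 0)) (.natLe (const 1) (var 28)))))
        (setNat 19 (var 45) (const 0) (plus (list 19 (var 45)) (const 1))) skip])
      (fun j t' => t'.nat 19 i 0 = ∑ x ∈ range j, g x) rfl ?_ ?_
    · rw [one_mul, sum_range] at key
      refine key.trans (sum_congr rfl fun u _ => ?_)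
      simp only [g, u.isLt, dif_pos]
    · rw [setN_nat_ne _ (by decide), e19]
      simp
    · intro j hj t' htj fN' _ hQ'
      rw [setN_nat_ne _ (by decide), exec_block_cons, exec_block_cons, exec_block_nil,
        sum_range_succ, ← hQ']
      have e' : ∀ b, b ≠ 46 → b ≠ 19 → b ≠ 28 → b ≠ 47 → b ≠ 45 → t'.nat b = s.nat b := by
        intro b h1 h2 h3 h4 h5
        rw [fN' b h1 (by simp [sum, nwrites, block, h2.symm, h3.symm, h4.symm]), e b h2,
          eN b h5 h2 h1 h3 h4]
      have f45 : t'.nat 45 0 0 = i := by rw [fN' 45 (by decide) rfl, e 45 (by decide), hti]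
      set u₀ : Fin n := ⟨j, by omega⟩ with hu₀
      -- A sum of two bits minus 1, truncated, is their conjunction; the total counts inner nodes
      -- adjacent to the node i.
      have s1 := exec_sum (n := n) (a := 47) (k := 1) (r := 28) (s := t')
        (e := minus (plus (get 14 (var 46) (plus (var 0) (var 47)))
          (get 1 (var 47) (var 45))) (const 1))
        (fun x => s.nat 14 j (n + x) + s.nat 1 x i - 1) (by decide) (by
          intro x _ r hx hr
          simp only [NExp.eval, hx, hr 14 (by decide) (by decide), hr 46 (by decide) (by decide),
            hr 45 (by decide) (by decide), hr 1 (by decide) (by decide),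
            hr 0 (by decide) (by decide), htj, f45,
            e' 14 (by decide) (by decide) (by decide) (by decide) (by decide),
            e' 1 (by decide) (by decide) (by decide) (by decide) (by decide),
            e' 0 (by decide) (by decide) (by decide) (by decide) (by decide), h.size])
      rw [one_mul, sum_range] at s1
      have g' : ∀ b, b ≠ 28 → b ≠ 47 → ((sum 47 1 28 (minus (plus (get 14 (var 46)
          (plus (var 0) (var 47))) (get 1 (var 47) (var 45))) (const 1))).exec n t').nat b =
          t'.nat b := fun b h1 h2 =>
        exec_nat_eq (by simp [sum, nwrites, block, h1.symm, h2.symm]) t'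
      set t₂ := (sum 47 1 28 (minus (plus (get 14 (var 46)
          (plus (var 0) (var 47))) (get 1 (var 47) (var 45))) (const 1))).exec n t'
      rw [exec_ite]
      have hsP := hP v₀
      have hsK := h1 u₀
      simp only [Test.holds, NExp.eval, s1, g' 17 (by decide) (by decide),
        g' 14 (by decide) (by decide), g' 5 (by decide) (by decide), g' 46 (by decide) (by decide),
        g' 45 (by decide) (by decide), htj, f45,
        e' 14 (by decide) (by decide) (by decide) (by decide) (by decide),
        e' 17 (by decide) (by decide) (by decide) (by decide) (by decide),
        e' 5 (by decide) (by decide) (by decide) (by decide) (by decide)]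
      have hT : (1 ≤ s.nat 17 j 0 ∧ s.nat 14 j i ≤ 0 ∧ s.nat 5 i 0 ≤ 0 ∧
          1 ≤ ∑ w : Fin n, (s.nat 14 j (n + w) + s.nat 1 w i - 1)) ↔
          u₀ ∈ K ∧ v₀ ∈ (D u₀).nbr I.Gℓ := by
        have hK : 1 ≤ s.nat 17 j 0 ↔ u₀ ∈ K := by
          rw [show s.nat 17 j 0 = _ from hsK]
          split_ifs with hh <;> simp [hh]
        rw [hK]
        refine and_congr_right fun huK => ?_
        rw [hnbr u₀ huK]
        have hrow := h2 u₀ huK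
        refine and_congr ?_ (and_congr ?_ ?_)
        · rw [show s.nat 14 j i = _ from (hrow v₀).1]
          split_ifs with hh <;> simp [hh]
        · rw [show s.nat 5 i 0 = _ from hsP]
          split_ifs with hh <;> simp [hh]
        · rw [Nat.one_le_iff_ne_zero, Ne, sum_eq_zero_iff, not_forall]
          refine exists_congr fun w => ?_
          rw [show s.nat 14 j (n + w) = _ from (hrow w).2, show s.nat 1 w i = _ from h.adj w v₀]
          by_cases a : w ∈ (D u₀).inner <;> by_cases b : I.G.Adj w v₀ <;> simp [a, b]
      have hg : g j = if u₀ ∈ K ∧ v₀ ∈ (D u₀).nbr I.Gℓ then 1 else 0 := dif_pos u₀.isLt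
      rw [hg]
      by_cases hh : u₀ ∈ K ∧ v₀ ∈ (D u₀).nbr I.Gℓ
      · rw [if_pos (hT.2 hh), if_pos hh]
        simp only [exec_setNat, NExp.eval, setN_nat_self, g' 45 (by decide) (by decide),
          g' 19 (by decide) (by decide), f45, upd_self]
      · rw [if_neg (fun h => hh (hT.1 h)), if_neg hh, exec_skip, g' 19 (by decide) (by decide),
          add_zero]
  · have hvi' : (v : ℕ) ≠ i := fun h => hvi (Fin.ext h)
    have key := exec_forTo (n := n) (a := 46) (k := 1) (s := t₁)
      (c := block [
        sum 47 1 28 (minus (plus (get 14 (var 46) (plus (var 0) (var 47)))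
          (get 1 (var 47) (var 45))) (const 1)),
        ite (.conj (.natLe (const 1) (list 17 (var 46)))
          (.conj (.natLe (get 14 (var 46) (var 45)) (const 0))
            (.conj (.natLe (list 5 (var 45)) (const 0)) (.natLe (const 1) (var 28)))))
        (setNat 19 (var 45) (const 0) (plus (list 19 (var 45)) (const 1))) skip])
      (fun j t' => t'.nat 19 v 0 = t.nat 19 v 0) rfl ?_ ?_
    · rw [key]
      exact hQ v hnbr (by omega)
    · rw [setN_nat_ne _ (by decide), e19]
      simp [upd, hvi']
    · intro j hj t' htj fN' _ hQ'
      rw [setN_nat_ne _ (by decide), exec_block_cons, exec_block_cons, exec_block_nil]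
      have f45 : t'.nat 45 0 0 = i := by rw [fN' 45 (by decide) rfl, e 45 (by decide), hti]
      have g' : ∀ b, b ≠ 28 → b ≠ 47 → ((sum 47 1 28 (minus (plus (get 14 (var 46)
          (plus (var 0) (var 47))) (get 1 (var 47) (var 45))) (const 1))).exec n t').nat b =
          t'.nat b := fun b h1 h2 =>
        exec_nat_eq (by simp [sum, nwrites, block, h1.symm, h2.symm]) t'
      set t₂ := (sum 47 1 28 (minus (plus (get 14 (var 46)
          (plus (var 0) (var 47))) (get 1 (var 47) (var 45))) (const 1))).exec n t'
      rw [exec_ite]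
      split_ifs
      · simp only [exec_setNat, NExp.eval, setN_nat_self, g' 45 (by decide) (by decide),
          g' 19 (by decide) (by decide), f45]
        simp only [upd, hvi', false_and, if_false]
        exact hQ'
      · rw [exec_skip, g' 19 (by decide) (by decide), hQ']

end Cmd

end RAM

/-! ### The program for the primal-dual algorithm -/

namespace RAM

open Cmd NExp

/-- The memory represents the state `st` of the first stage: slacks of the dual constraints in the
real array `1`, the number of added nodes in `7`, the nodes in array `6`. -/
structure Represents {n : ℕ} (I : Phase (Fin n)) (st : Phase.State (Fin n)) (s : Store) :
    Prop where
  loaded : Loaded I s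
  selects : Selects (st.P I.zeroSet) s
  slack : ∀ v : Fin n, s.real 1 v 0 = I.wt v - I.load st.y v
  length : s.nat 7 0 0 = st.added.length
  added : ∀ (k : ℕ) (h : k < st.added.length),
    s.nat 6 (st.added.length - 1 - k) 0 = (st.added[k] : ℕ)

theorem Selects.set {n : ℕ} {P Q : Finset (Fin n)} {s t : Store} {v : Fin n} {x : ℕ}
    (h : Selects P s) (ht : t.nat 5 = upd (s.nat 5) v 0 x)
    (hv : x = if v ∈ Q then 1 else 0) (hne : ∀ u, u ≠ v → (u ∈ Q ↔ u ∈ P)) : Selects Q t := by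
  intro u
  rw [ht]
  by_cases huv : u = v
  · rw [huv, upd_self, hv]
  · have huv' : (u : ℕ) ≠ v := fun h => huv (Fin.ext h)
    simp only [upd, huv', false_and, if_false, hne u huv]
    exact h u

theorem Phase.X_subset_zeroSet {n : ℕ} (I : Phase (Fin n)) : I.X ⊆ I.zeroSet := by
  intro v hv
  simp [Phase.zeroSet, Phase.wt, hv]

theorem ListsViolated.card_le {n : ℕ} {I : Phase (Fin n)} {P : Finset (Fin n)} {s : Store}
    (h : ListsViolated I P s) : #(I.violatedBisets P) ≤ n := by
  classical
  obtain ⟨D, K, -, -, -, h4⟩ := h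
  rw [h4]
  refine card_image_le.trans ((card_le_univ K).trans ?_)
  rw [Fintype.card_fin]

namespace Cmd

/-- Compute the slacks and select the nodes of weight zero. -/
def setUp : Cmd :=
  forTo 49 1 (block [
    setReal 1 (var 49) (const 0) (.get 0 (var 49) (const 0)),
    ite (.natLe (const 1) (list 4 (var 49))) (setReal 1 (var 49) (const 0) .zero) skip,
    ite (.realLe (.get 1 (var 49) (const 0)) .zero) (setNat 5 (var 49) (const 0) (const 1)) skip])

theorem exec_setUp {n : ℕ} (I : Phase (Fin n)) :
    Represents I Phase.State.init (setUp.exec n (input I)) := by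
  have hL : Loaded I (input I) := ⟨fun _ _ => rfl, rfl⟩
  have key : ∀ u : Fin n, (u : ℕ) < 1 * n →
      (setUp.exec n (input I)).real 1 u 0 = I.wt u ∧
      (setUp.exec n (input I)).nat 5 u 0 = if u ∈ I.zeroSet then 1 else 0 := by
    rw [setUp]
    -- The program writes only the ones of array 5. The second clause records that the entries not
    -- yet treated are still 0.
    suffices H : (∀ u : Fin n, (u : ℕ) < 1 * n →
      ((setUp.exec n (input I)).real 1 u 0 = I.wt u ∧
      (setUp.exec n (input I)).nat 5 u 0 = if u ∈ I.zeroSet then 1 else 0)) ∧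
      ∀ u : Fin n, 1 * n ≤ (u : ℕ) → (setUp.exec n (input I)).nat 5 u 0 = 0 from H.1
    rw [setUp]
    refine exec_forTo (fun i t => (∀ u : Fin n, (u : ℕ) < i → t.real 1 u 0 = I.wt u ∧
      t.nat 5 u 0 = if u ∈ I.zeroSet then 1 else 0) ∧
      ∀ u : Fin n, i ≤ (u : ℕ) → t.nat 5 u 0 = 0) rfl ?_ ?_
    · refine ⟨fun u hu => absurd hu (by omega), fun u _ => ?_⟩
      rw [setN_nat_ne _ (by decide)]
      rfl
    · intro i hi t hti fN fR ⟨q1, q2⟩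
      have hLt : Loaded I t := hL.of_eq (fun b hb => fN b (by omega) (by
        simp [nwrites, block]
        omega)) (fR 0 rfl)
      rw [exec_block_cons, exec_block_cons, exec_block_cons, exec_block_nil]
      set u₀ : Fin n := ⟨i, by omega⟩ with hu₀
      set t₁ := (setReal 1 (var 49) (const 0) (.get 0 (var 49) (const 0))).exec n t with ht₁
      have a1 : t₁.real 1 = upd (t.real 1) i 0 (I.w u₀) := by
        rw [← hLt.weight]
        simp [ht₁, NExp.eval, RExp.eval, hti, hu₀]
      have a2 : t₁.nat = t.nat := rfl
      set t₂ := (ite (.natLe (const 1) (list 4 (var 49)))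
        (setReal 1 (var 49) (const 0) .zero) skip).exec n t₁ with ht₂
      have hX := hLt.mem_X u₀
      have b1 : t₂.real 1 = upd (t.real 1) i 0 (I.wt u₀) := by
        rw [ht₂, exec_ite]
        simp only [Test.holds, NExp.eval, a2, hti, show t.nat 4 i 0 = _ from hX]
        by_cases hx : u₀ ∈ I.X
        · simp [hx, Phase.wt, a1, a2, NExp.eval, RExp.eval, hti, upd_upd]
        · simp [hx, Phase.wt, a1]
      have b2 : t₂.nat = t.nat := by
        rw [ht₂, exec_ite]
        split_ifs <;> rfl
      rw [exec_ite]
      simp only [Test.holds, NExp.eval, RExp.eval, b2, hti, b1, upd_self]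
      have hz : I.wt u₀ ≤ 0 ↔ u₀ ∈ I.zeroSet := by
        simp only [Phase.zeroSet, mem_filter, mem_univ, true_and]
        exact ⟨fun h => le_antisymm h (I.wt_nonneg u₀), fun h => h.le⟩
      have hcase : ∀ u : Fin n, u = u₀ ∨ (u : ℕ) ≠ i := by
        intro u
        by_cases h : u = u₀
        · exact Or.inl h
        · exact Or.inr fun h' => h (Fin.ext h')
      have hfin : ∀ t' : Store, t'.real 1 = upd (t.real 1) i 0 (I.wt u₀) →
          t'.nat 5 = upd (t.nat 5) i 0 (if u₀ ∈ I.zeroSet then 1 else 0) →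
          (∀ u : Fin n, (u : ℕ) < i + 1 → t'.real 1 u 0 = I.wt u ∧
            t'.nat 5 u 0 = if u ∈ I.zeroSet then 1 else 0) ∧
          ∀ u : Fin n, i + 1 ≤ (u : ℕ) → t'.nat 5 u 0 = 0 := by
        intro t' h1 h2
        rw [h1, h2]
        refine ⟨fun u hu => ?_, fun u hu => ?_⟩
        · rcases hcase u with h | h
          · rw [h]
            exact ⟨upd_self _ _ _ _, upd_self _ _ _ _⟩
          · simp only [upd, h, false_and, if_false]
            exact q1 u (by omega)
        · have h : (u : ℕ) ≠ i := by omega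
          simp only [upd, h, false_and, if_false]
          exact q2 u (by omega)
      refine hfin _ ?_ ?_
      · rw [setN_real]
        split_ifs
        · exact b1
        · exact b1
      · rw [setN_nat_ne _ (by decide)]
        by_cases h : u₀ ∈ I.zeroSet
        · rw [if_pos (hz.2 h), if_pos h]
          simp [NExp.eval, b2, hti]
        · rw [if_neg (mt hz.1 h), if_neg h, exec_skip, b2]
          funext x y
          simp only [upd]
          split_ifs with hxy
          · rw [hxy.1, hxy.2]
            exact q2 u₀ le_rfl
          · rfl
  refine ⟨hL.exec (by decide) (by decide), fun v => ?_, fun v => ?_, ?_, fun k h => ?_⟩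
  · simpa [Phase.State.P, Phase.State.init] using (key v (by omega)).2
  · simpa [Phase.State.init, Phase.load] using (key v (by omega)).1
  · rw [exec_nat_eq (b := 7) rfl]
    rfl
  · simp [Phase.State.init] at h

/-- Find a node `26` whose slack divided by its number in array `19` is minimum; store the quotient
in the real variable `2`. -/
def findTight : Cmd := block
  [ setVar 25 (const 0),
    forTo 50 1 (ite (.natLe (const 1) (list 19 (var 50)))
      (ite (.conj (.natLe (const 1) (var 25)) (.realLe (.get 2 (const 0) (const 0))
          (.divNat (.get 1 (var 50) (const 0)) (list 19 (var 50))))) skip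
        (block [setVar 25 (const 1), setVar 26 (var 50), setReal 2 (const 0) (const 0)
          (.divNat (.get 1 (var 50) (const 0)) (list 19 (var 50)))])) skip) ]

/-- Cell 25 records whether any node has a positive count, and cell 26 and the real variable 2 hold
the minimiser and minimum of the ratio test. -/
theorem exec_findTight (n : ℕ) (s : Store) :
    ((findTight.exec n s).nat 25 0 0 = 0 ∧ ∀ v < n, s.nat 19 v 0 = 0) ∨
    ((findTight.exec n s).nat 25 0 0 = 1 ∧ ∃ v < n, (findTight.exec n s).nat 26 0 0 = v ∧
      1 ≤ s.nat 19 v 0 ∧ (findTight.exec n s).real 2 0 0 = s.real 1 v 0 / (s.nat 19 v 0 : ℝ) ∧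
      ∀ u < n, 1 ≤ s.nat 19 u 0 →
        s.real 1 v 0 / (s.nat 19 v 0 : ℝ) ≤ s.real 1 u 0 / (s.nat 19 u 0 : ℝ)) := by
  rw [findTight, exec_block_cons, exec_block_cons, exec_block_nil]
  set s₁ := (setVar 25 (const 0)).exec n s with hs₁
  have e : ∀ b, b ≠ 25 → s₁.nat b = s.nat b := fun b h => setN_nat_ne _ h _ _ _
  have e25 : s₁.nat 25 0 0 = 0 := by simp [hs₁, NExp.eval]
  have key := exec_forTo (n := n) (a := 50) (k := 1) (s := s₁)
    (c := ite (.natLe (const 1) (list 19 (var 50)))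
      (ite (.conj (.natLe (const 1) (var 25)) (.realLe (.get 2 (const 0) (const 0))
          (.divNat (.get 1 (var 50) (const 0)) (list 19 (var 50))))) skip
        (block [setVar 25 (const 1), setVar 26 (var 50), setReal 2 (const 0) (const 0)
          (.divNat (.get 1 (var 50) (const 0)) (list 19 (var 50)))])) skip)
    (fun i t => (t.nat 25 0 0 = 0 ∧ ∀ v < i, s.nat 19 v 0 = 0) ∨
      (t.nat 25 0 0 = 1 ∧ ∃ v < i, t.nat 26 0 0 = v ∧
        1 ≤ s.nat 19 v 0 ∧ t.real 2 0 0 = s.real 1 v 0 / (s.nat 19 v 0 : ℝ) ∧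
        ∀ u < i, 1 ≤ s.nat 19 u 0 →
          s.real 1 v 0 / (s.nat 19 v 0 : ℝ) ≤ s.real 1 u 0 / (s.nat 19 u 0 : ℝ))) rfl ?_ ?_
  · rwa [one_mul] at key
  · rw [setN_nat_ne _ (by decide)]
    exact Or.inl ⟨e25, fun v hv => absurd hv (by omega)⟩
  · intro i hi t hti fN fR hQ
    simp only [setN_nat_ne _ (show 25 ≠ 50 by decide), setN_nat_ne _ (show 26 ≠ 50 by decide),
      setN_real]
    have e19 : t.nat 19 = s.nat 19 := by rw [fN 19 (by decide) rfl, e 19 (by decide)]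
    have e1 : t.real 1 = s.real 1 := fR 1 rfl
    rw [exec_ite]
    simp only [Test.holds, NExp.eval, hti, e19]
    by_cases h1 : 1 ≤ s.nat 19 i 0
    · rw [if_pos h1, exec_ite]
      simp only [Test.holds, NExp.eval, RExp.eval, hti, e19, e1]
      have hnew : (∀ u < i, 1 ≤ s.nat 19 u 0 →
          s.real 1 i 0 / (s.nat 19 i 0 : ℝ) ≤ s.real 1 u 0 / (s.nat 19 u 0 : ℝ)) →
          ∀ u < i + 1, 1 ≤ s.nat 19 u 0 →
          s.real 1 i 0 / (s.nat 19 i 0 : ℝ) ≤ s.real 1 u 0 / (s.nat 19 u 0 : ℝ) := by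
        intro h u hu
        rcases Nat.lt_succ_iff_lt_or_eq.1 hu with hu | rfl
        · exact h u hu
        · exact fun _ => le_rfl
      have hT : ∀ t' : Store, t' = (block [setVar 25 (const 1), setVar 26 (var 50),
          setReal 2 (const 0) (const 0)
          (.divNat (.get 1 (var 50) (const 0)) (list 19 (var 50)))]).exec n t →
          t'.nat 25 0 0 = 1 ∧ t'.nat 26 0 0 = i ∧
          t'.real 2 0 0 = s.real 1 i 0 / (s.nat 19 i 0 : ℝ) := by
        rintro t' rfl
        simp [NExp.eval, RExp.eval, setN_nat_ne, hti, e19, e1]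
      obtain ⟨T1, T2, T3⟩ := hT _ rfl
      rcases hQ with ⟨q1, q2⟩ | ⟨q1, v, q2, q3, q4, q5, q6⟩
      · rw [if_neg (by omega)]
        refine Or.inr ⟨T1, i, by omega, T2, h1, T3, hnew fun u hu hu1 => ?_⟩
        have := q2 u hu
        omega
      · by_cases h2 : t.real 2 0 0 ≤ s.real 1 i 0 / (s.nat 19 i 0 : ℝ)
        · rw [if_pos ⟨by omega, h2⟩, exec_skip]
          refine Or.inr ⟨q1, v, by omega, q3, q4, q5, fun u hu => ?_⟩
          rcases Nat.lt_succ_iff_lt_or_eq.1 hu with hu | rfl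
          · exact q6 u hu
          · exact fun _ => q5 ▸ h2
        · rw [if_neg fun h => h2 h.2]
          refine Or.inr ⟨T1, i, by omega, T2, h1, T3, hnew fun u hu hu1 => ?_⟩
          rw [q5] at h2
          exact (not_le.1 h2).le.trans (q6 u hu hu1)
    · rw [if_neg h1, exec_skip]
      rcases hQ with ⟨q1, q2⟩ | ⟨q1, v, q2, q3, q4, q5, q6⟩
      · refine Or.inl ⟨q1, fun u hu => ?_⟩
        rcases Nat.lt_succ_iff_lt_or_eq.1 hu with hu | rfl
        · exact q2 u hu
        · omega
      · refine Or.inr ⟨q1, v, by omega, q3, q4, q5, fun u hu => ?_⟩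
        rcases Nat.lt_succ_iff_lt_or_eq.1 hu with hu | rfl
        · exact q6 u hu
        · exact fun h => absurd h h1

/-- Raise the dual variables of all minimal violated bisets by the real variable `2`. -/
def raise : Cmd :=
  forTo 51 1 (forTo 52 1 (ite (.natLe (plus (var 52) (const 1)) (list 19 (var 51)))
    (setReal 1 (var 51) (const 0)
      (.minus (.get 1 (var 51) (const 0)) (.get 2 (const 0) (const 0)))) skip))

/-- The product of ε and the count is formed by repeated subtraction. Passes beyond the count do
nothing, and n passes suffice because counts are at most n. -/
theorem exec_raise {n : ℕ} {s : Store} (hs : ∀ v < n, s.nat 19 v 0 ≤ n) (v : ℕ) (hv : v < n) :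
    (raise.exec n s).real 1 v 0 = s.real 1 v 0 - s.real 2 0 0 * (s.nat 19 v 0 : ℝ) := by
  suffices (∀ v < 1 * n, (raise.exec n s).real 1 v 0 =
      s.real 1 v 0 - s.real 2 0 0 * (s.nat 19 v 0 : ℝ)) ∧
      ∀ v, 1 * n ≤ v → (raise.exec n s).real 1 v 0 = s.real 1 v 0 from this.1 v (by omega)
  rw [raise]
  refine exec_forTo (fun i t => (∀ v < i, t.real 1 v 0 =
      s.real 1 v 0 - s.real 2 0 0 * (s.nat 19 v 0 : ℝ)) ∧
      ∀ v, i ≤ v → t.real 1 v 0 = s.real 1 v 0) rfl ⟨fun v hv => absurd hv (by omega),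
      fun v _ => rfl⟩ ?_
  intro i hi t hti fN fR ⟨q1, q2⟩
  rw [setN_real]
  have key := exec_forTo (n := n) (a := 52) (k := 1) (s := t)
    (c := ite (.natLe (plus (var 52) (const 1)) (list 19 (var 51)))
    (setReal 1 (var 51) (const 0)
      (.minus (.get 1 (var 51) (const 0)) (.get 2 (const 0) (const 0)))) skip)
    (fun j t' => t'.real 1 =
      upd (t.real 1) i 0 (s.real 1 i 0 - s.real 2 0 0 * ((min j (s.nat 19 i 0) : ℕ) : ℝ))) rfl ?_ ?_
  · have hmin : min (1 * n) (s.nat 19 i 0) = s.nat 19 i 0 := by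
      rw [one_mul]
      exact min_eq_right (hs i (by omega))
    rw [hmin] at key
    rw [key]
    refine ⟨fun v hv => ?_, fun v hv => ?_⟩
    · by_cases h : v = i
      · rw [h, upd_self]
      · simp only [upd, h, false_and, if_false]
        exact q1 v (by omega)
    · have h : v ≠ i := by omega
      simp only [upd, h, false_and, if_false]
      exact q2 v (by omega)
  · rw [setN_real]
    funext x y
    simp only [upd]
    split_ifs with h
    · rw [h.1, h.2, q2 i le_rfl]
      simp
    · rfl
  · intro j hj t' htj fN' fR' hQ'
    rw [setN_real]
    have e19 : t'.nat 19 = s.nat 19 := by rw [fN' 19 (by decide) rfl, fN 19 (by decide) rfl]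
    have e51 : t'.nat 51 0 0 = i := by rw [fN' 51 (by decide) rfl, hti]
    have e2 : t'.real 2 = s.real 2 := by rw [fR' 2 rfl, fR 2 rfl]
    rw [exec_ite]
    simp only [Test.holds, NExp.eval, htj, e51, e19]
    split_ifs with h
    · simp only [exec_setReal, setR_real_self, NExp.eval, RExp.eval, e51, e2, hQ', upd_upd,
        upd_self]
      rw [min_eq_left (by omega), min_eq_left h]
      push_cast
      congr 1
      ring
    · rw [exec_skip, hQ', min_eq_right (by omega), min_eq_right (by omega)]

/-- One iteration of the first stage. -/
def iterate : Cmd := block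
  [ violated, countNbr, findTight,
    ite (.natLe (const 1) (var 25)) (block [raise, setNat 5 (var 26) (const 0) (const 1),
      setNat 6 (var 7) (const 0) (var 26), setVar 7 (plus (var 7) (const 1))]) skip ]

/-- Every minimal violated biset has a neighbour, so the absence of positive counts means that the
first stage is over. Otherwise the ratio test provides a legal step. -/
theorem exec_iterate {n : ℕ} {I : Phase (Fin n)} {st : Phase.State (Fin n)} {s : Store}
    (hI : I.Valid) (hr : I.Reachable I.zeroSet st) (h : Represents I st s) :
    (I.violatedBisets (st.P I.zeroSet) = ∅ ∧ Represents I st (iterate.exec n s)) ∨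
    ∃ st', I.Step I.zeroSet st st' ∧ Represents I st' (iterate.exec n s) := by
  classical
  have hX : I.X ⊆ st.P I.zeroSet := (Phase.X_subset_zeroSet I).trans (Phase.subset_P st)
  have inv := hr.invariant hI (Phase.X_subset_zeroSet I)
  rw [iterate, exec_block_cons, exec_block_cons, exec_block_cons, exec_block_cons, exec_block_nil]
  have hV := exec_violated hI hX h.loaded h.selects
  have a5 : (violated.exec n s).nat 5 = s.nat 5 := exec_nat_eq rfl s
  have a6 : (violated.exec n s).nat 6 = s.nat 6 := exec_nat_eq rfl s
  have a7 : (violated.exec n s).nat 7 = s.nat 7 := exec_nat_eq rfl s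
  have r1 : (violated.exec n s).real 1 = s.real 1 := exec_real_eq rfl s
  have hL₁ : Loaded I (violated.exec n s) := h.loaded.exec (by decide) (by decide)
  set s₁ := violated.exec n s
  have hP₁ : Selects (st.P I.zeroSet) s₁ := by
    intro v
    rw [a5]
    exact h.selects v
  have hcnt := exec_countNbr hI hX hL₁ hP₁ hV
  have b5 : (countNbr.exec n s₁).nat 5 = s.nat 5 := (exec_nat_eq rfl s₁).trans a5
  have b6 : (countNbr.exec n s₁).nat 6 = s.nat 6 := (exec_nat_eq rfl s₁).trans a6
  have b7 : (countNbr.exec n s₁).nat 7 = s.nat 7 := (exec_nat_eq rfl s₁).trans a7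
  have r1' : (countNbr.exec n s₁).real 1 = s.real 1 := (exec_real_eq rfl s₁).trans r1
  have hL₂ : Loaded I (countNbr.exec n s₁) := hL₁.exec (by decide) (by decide)
  set s₂ := countNbr.exec n s₁
  have hft := exec_findTight n s₂
  have c5 : (findTight.exec n s₂).nat 5 = s.nat 5 := (exec_nat_eq rfl s₂).trans b5
  have c6 : (findTight.exec n s₂).nat 6 = s.nat 6 := (exec_nat_eq rfl s₂).trans b6
  have c7 : (findTight.exec n s₂).nat 7 = s.nat 7 := (exec_nat_eq rfl s₂).trans b7
  have c19 : (findTight.exec n s₂).nat 19 = s₂.nat 19 := exec_nat_eq rfl s₂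
  have r1'' : (findTight.exec n s₂).real 1 = s.real 1 := (exec_real_eq rfl s₂).trans r1'
  have hL₃ : Loaded I (findTight.exec n s₂) := hL₂.exec (by decide) (by decide)
  set s₃ := findTight.exec n s₂
  have hT : (Test.natLe (const 1) (var 25)).holds s₃ ↔ 1 ≤ s₃.nat 25 0 0 := Iff.rfl
  rw [exec_ite]
  rcases hft with ⟨f1, f2⟩ | ⟨f1, v, hv, f2, f3, f4, f5⟩
  · left
    rw [if_neg (mt hT.1 (by omega)), exec_skip]
    refine ⟨?_, hL₃, fun v => ?_, fun v => ?_, ?_, fun k hk => ?_⟩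
    · rw [Finset.eq_empty_iff_forall_notMem]
      intro C hC
      obtain ⟨v, hv⟩ := Phase.nbr_nonempty_of_mem_violatedBisets hI hX hC
      have h1 := hcnt v
      rw [f2 v v.isLt] at h1
      have h2 := card_eq_zero.1 h1.symm
      have : C ∈ (I.violatedBisets (st.P I.zeroSet)).filter fun C => v ∈ C.nbr I.Gℓ :=
        mem_filter.2 ⟨hC, hv⟩
      rw [h2] at this
      simp at this
    · rw [c5]
      exact h.selects v
    · rw [r1'']
      exact h.slack v
    · rw [c7]
      exact h.length
    · rw [c6]
      exact h.added k hk
  · right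
    rw [if_pos (hT.2 (by omega)), exec_block_cons, exec_block_cons, exec_block_cons, exec_block_cons,
      exec_block_nil]
    set v₀ : Fin n := ⟨v, hv⟩ with hv₀
    let cnt : Fin n → ℕ := fun u => #((I.violatedBisets (st.P I.zeroSet)).filter
      fun C => u ∈ C.nbr I.Gℓ)
    have hcnt' : ∀ u : Fin n, s₂.nat 19 u 0 = cnt u := hcnt
    have hsl : ∀ u : Fin n, s₂.real 1 u 0 = I.wt u - I.load st.y u := fun u => by
      rw [r1']
      exact h.slack u
    set ε : ℝ := (I.wt v₀ - I.load st.y v₀) / cnt v₀ with hε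
    have hεs : s₃.real 2 0 0 = ε := by
      rw [f4, show s₂.nat 19 v 0 = _ from hcnt' v₀, show s₂.real 1 v 0 = _ from hsl v₀]
    have hpos : 1 ≤ cnt v₀ := by
      rw [← hcnt' v₀]
      exact f3
    have hposR : (0 : ℝ) < cnt v₀ := by exact_mod_cast hpos
    have hraise := exec_raise (n := n) (s := s₃) fun w hw => by
      rw [c19, show s₂.nat 19 w 0 = _ from hcnt' ⟨w, hw⟩]
      exact (card_filter_le _ _).trans hV.card_le
    have hload : ∀ u, I.load (fun S => if S ∈ I.violatedBisets (st.P I.zeroSet) then st.y S + ε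
        else st.y S) u = I.load st.y u + ε * cnt u := fun u => Phase.load_add hI hX st.y ε u
    refine ⟨⟨v₀ :: st.added, fun S => if S ∈ I.violatedBisets (st.P I.zeroSet) then st.y S + ε
      else st.y S⟩, ⟨ε, v₀, div_nonneg (sub_nonneg.2 (inv.load_le v₀)) hposR.le, ?_, rfl,
      fun u => ?_, ?_, rfl⟩, ?_⟩
    · obtain ⟨C, hC⟩ := card_pos.1 (show 0 < cnt v₀ from hpos)
      rw [mem_filter] at hC
      exact ⟨Phase.notMem_of_mem_nbr hI hX hC.1 hC.2, C, hC.1, hC.2⟩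
    · rw [hload]
      by_cases hu : 1 ≤ cnt u
      · have h1 := f5 u u.isLt (by rw [hcnt']; exact hu)
        rw [show s₂.nat 19 v 0 = _ from hcnt' v₀, show s₂.real 1 v 0 = _ from hsl v₀, hcnt', hsl,
          le_div_iff₀ (by exact_mod_cast hu)] at h1
        change ε * cnt u ≤ _ at h1
        linarith
      · have : cnt u = 0 := by omega
        rw [this]
        simpa using inv.load_le u
    · rw [hload, hε, div_mul_cancel₀ _ hposR.ne']
      ring
    · have d5 : (raise.exec n s₃).nat 5 = s.nat 5 := (exec_nat_eq rfl s₃).trans c5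
      have d6 : (raise.exec n s₃).nat 6 = s.nat 6 := (exec_nat_eq rfl s₃).trans c6
      have d7 : (raise.exec n s₃).nat 7 = s.nat 7 := (exec_nat_eq rfl s₃).trans c7
      have d26 : (raise.exec n s₃).nat 26 = s₃.nat 26 := exec_nat_eq rfl s₃
      have hL₄ : Loaded I (raise.exec n s₃) := hL₃.exec (by decide) (by decide)
      set s₄ := raise.exec n s₃
      have hlen := h.length
      set s₅ := (setVar 7 (plus (var 7) (const 1))).exec n
        ((setNat 6 (var 7) (const 0) (var 26)).exec n
          ((setNat 5 (var 26) (const 0) (const 1)).exec n s₄)) with hs₅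
      have e : ∀ b < 5, s₅.nat b = s₄.nat b := by
        intro b hb
        simp only [hs₅, exec_setNat]
        rw [setN_nat_ne _ (by omega), setN_nat_ne _ (by omega), setN_nat_ne _ (by omega)]
      have er : s₅.real = s₄.real := rfl
      have e5 : s₅.nat 5 = upd (s.nat 5) v 0 1 := by
        simp [hs₅, NExp.eval, setN_nat_ne, d26, f2, d5]
      have e6 : s₅.nat 6 = upd (s.nat 6) st.added.length 0 v := by
        simp [hs₅, NExp.eval, setN_nat_ne, d26, f2, d6, d7, hlen]
      have e7 : s₅.nat 7 0 0 = st.added.length + 1 := by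
        simp [hs₅, NExp.eval, setN_nat_ne, d7, hlen]
      refine ⟨hL₄.of_eq e (by rw [er]), h.selects.set (v := v₀) e5 ?_ fun u hu => ?_, fun u => ?_,
        e7, fun k hk => ?_⟩
      · simp [Phase.State.P]
      · simp [Phase.State.P, hu]
      · rw [er, hraise u u.isLt, r1'', hεs, c19, hcnt', h.slack, hload]
        ring
      · rw [e6]
        rcases k with - | k
        · simp [hv₀]
        · simp only [List.length_cons, List.getElem_cons_succ] at hk ⊢
          have h1 : k < st.added.length := by omega
          have h2 : st.added.length + 1 - 1 - (k + 1) = st.added.length - 1 - k := by omega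
          have h3 : st.added.length - 1 - k ≠ st.added.length := by omega
          simp only [h2, upd, h3, false_and, if_false]
          exact h.added k h1

/-- The first stage. -/
def firstStage : Cmd := forTo 53 1 iterate

theorem exec_firstStage {n : ℕ} {I : Phase (Fin n)} {s : Store} (hI : I.Valid)
    (h : Represents I Phase.State.init s) :
    ∃ st, I.Reachable I.zeroSet st ∧ I.violatedBisets (st.P I.zeroSet) = ∅ ∧
      Represents I st (firstStage.exec n s) := by
  have hX := Phase.X_subset_zeroSet I
  have setN_repr : ∀ {st : Phase.State (Fin n)} {t : Store} {x : ℕ}, Represents I st t →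
      Represents I st (setN t 53 0 0 x) := by
    intro st t x ht
    have e : ∀ b, b ≠ 53 → (setN t 53 0 0 x).nat b = t.nat b := fun b hb => setN_nat_ne t hb _ _ _
    refine ⟨ht.loaded.of_eq (fun b hb => e b (by omega)) rfl, fun v => ?_, ht.slack, ?_, ?_⟩
    · rw [e 5 (by decide)]
      exact ht.selects v
    · rw [e 7 (by decide)]
      exact ht.length
    · rw [e 6 (by decide)]
      exact ht.added
  have key := exec_forTo (n := n) (a := 53) (k := 1) (s := s) (c := iterate)
    (fun i t => ∃ st, I.Reachable I.zeroSet st ∧ Represents I st t ∧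
      (I.violatedBisets (st.P I.zeroSet) = ∅ ∨ st.added.length = i)) rfl ?_ ?_
  · obtain ⟨st, k1, k2, k3⟩ := key
    refine ⟨st, k1, ?_, k2⟩
    -- If violated bisets remained after n passes, all passes would have added nodes, and one more
    -- step would make n + 1 distinct ones.
    by_contra hne
    obtain ⟨st', hst'⟩ := Phase.exists_step hI hX (k1.invariant hI hX).load_le hne
    have h1 := Phase.Reachable.length_le hI hX (k1.tail hst')
    obtain ⟨_, _, -, -, -, -, -, h2⟩ := hst'
    have h3 := k3.resolve_left hne
    rw [h2, List.length_cons, Fintype.card_fin] at h1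
    omega
  · exact ⟨Phase.State.init, .refl, setN_repr h, Or.inr rfl⟩
  · intro i hi t hti _ _ ⟨st, q1, q2, q3⟩
    rcases exec_iterate hI q1 q2 with ⟨h1, h2⟩ | ⟨st', h1, h2⟩
    · exact ⟨st, q1, setN_repr h2, Or.inl h1⟩
    · refine ⟨st', q1.tail h1, setN_repr h2, Or.inr ?_⟩
      obtain ⟨_, _, -, ⟨-, C, hC, -⟩, -, -, -, h3⟩ := h1
      rw [h3, List.length_cons, q3.resolve_left (ne_empty_of_mem hC)]

/-- The second stage. -/
def secondStage : Cmd :=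
  forTo 54 1 (ite (.natLe (plus (var 54) (const 1)) (var 7))
    (block [setVar 27 (list 6 (minus (var 7) (plus (var 54) (const 1)))),
      setNat 5 (var 27) (const 0) (const 0), violated, countViolated,
      ite (.natLe (const 1) (var 25)) (setNat 5 (var 27) (const 0) (const 1)) skip]) skip)

/-- Array 6 holds the nodes in order of addition and is read from the end, which matches the list
with the most recent node first. After i passes, reverse delete of the remaining list from the
current Q gives the final result. -/
theorem exec_secondStage {n : ℕ} {I : Phase (Fin n)} {st : Phase.State (Fin n)} {s : Store}
    (hI : I.Valid) (hr : I.Reachable I.zeroSet st) (h : Represents I st s) :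
    Selects (I.reverseDelete st.added (st.P I.zeroSet)) (secondStage.exec n s) := by
  classical
  have hX := Phase.X_subset_zeroSet I
  have inv := hr.invariant hI hX
  have hlen : st.added.length ≤ n := by simpa using hr.length_le hI hX
  rw [secondStage]
  have key := exec_forTo (n := n) (a := 54) (k := 1) (s := s)
    (c := ite (.natLe (plus (var 54) (const 1)) (var 7))
    (block [setVar 27 (list 6 (minus (var 7) (plus (var 54) (const 1)))),
      setNat 5 (var 27) (const 0) (const 0), violated, countViolated,
      ite (.natLe (const 1) (var 25)) (setNat 5 (var 27) (const 0) (const 1)) skip]) skip)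
    (fun i t => ∃ Q, Selects Q t ∧ I.zeroSet ⊆ Q ∧ (∀ v ∈ st.added.drop i, v ∈ Q) ∧
      I.reverseDelete st.added (st.P I.zeroSet) = I.reverseDelete (st.added.drop i) Q) rfl ?_ ?_
  · obtain ⟨Q, k1, -, -, k4⟩ := key
    rw [k4, List.drop_of_length_le (by omega), Phase.reverseDelete]
    exact k1
  · refine ⟨st.P I.zeroSet, fun v => ?_, Phase.subset_P st, fun v hv => ?_, rfl⟩
    · rw [setN_nat_ne _ (by decide)]
      exact h.selects v
    · simp only [List.drop_zero] at hv
      simp [Phase.State.P, hv]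
  · intro i hi t hti fN fR ⟨Q, q1, q2, q3, q4⟩
    have hLt : Loaded I t := h.loaded.of_eq (fun b hb => by
      have : ∀ b < 5, (ite (.natLe (plus (var 54) (const 1)) (var 7))
        (block [setVar 27 (list 6 (minus (var 7) (plus (var 54) (const 1)))),
        setNat 5 (var 27) (const 0) (const 0), violated, countViolated,
        ite (.natLe (const 1) (var 25)) (setNat 5 (var 27) (const 0) (const 1)) skip])
        skip).nwrites b = false := by decide
      exact fN b (by omega) (this b hb)) (fR 0 rfl)
    have e7 : t.nat 7 0 0 = st.added.length := by rw [fN 7 (by decide) rfl, h.length]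
    have e6 : t.nat 6 = s.nat 6 := fN 6 (by decide) rfl
    have hsel : ∀ {Q' : Finset (Fin n)} {t' : Store} {x : ℕ}, Selects Q' t' →
        Selects Q' (setN t' 54 0 0 x) := by
      intro Q' t' x h' v
      rw [setN_nat_ne _ (by decide)]
      exact h' v
    rw [exec_ite]
    simp only [Test.holds, NExp.eval, hti, e7]
    by_cases hT : i + 1 ≤ st.added.length
    · rw [if_pos hT, exec_block_cons, exec_block_cons, exec_block_cons, exec_block_cons,
        exec_block_cons, exec_block_nil]
      have hdrop : st.added.drop i = st.added[i] :: st.added.drop (i + 1) :=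
        List.drop_eq_getElem_cons hT
      have hadd := h.added i hT
      set v := st.added[i] with hv
      have hvmem : v ∈ st.added := List.getElem_mem hT
      rw [hdrop, Phase.reverseDelete] at q4
      have hnd : v ∉ st.added.drop (i + 1) := by
        have := inv.nodup.sublist (List.drop_sublist i st.added)
        rw [hdrop, List.nodup_cons] at this
        exact this.1
      rw [hdrop] at q3
      have hvQ : v ∈ Q := q3 v (by simp)
      have hZ : I.zeroSet ⊆ Q.erase v := fun u hu => mem_erase.2
        ⟨fun huv => inv.notMem v hvmem (huv ▸ hu), q2 hu⟩
      have hQ' : ∀ u ∈ st.added.drop (i + 1), u ∈ Q.erase v := fun u hu => mem_erase.2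
        ⟨fun huv => hnd (huv ▸ hu), q3 u (List.mem_cons_of_mem _ hu)⟩
      set t₁ := (setNat 5 (var 27) (const 0) (const 0)).exec n
        ((setVar 27 (list 6 (minus (var 7) (plus (var 54) (const 1))))).exec n t) with ht₁
      have hidx : st.added.length - (i + 1) = st.added.length - 1 - i := by omega
      have f27 : t₁.nat 27 0 0 = v := by
        simp [ht₁, NExp.eval, setN_nat_ne, hti, e7, e6, hidx, hadd]
      have f5 : t₁.nat 5 = upd (t.nat 5) v 0 0 := by
        simp [ht₁, NExp.eval, setN_nat_ne, hti, e7, e6, hidx, hadd]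
      have hL₁ : Loaded I t₁ := hLt.of_eq (fun b hb => by
        simp only [ht₁, exec_setNat]
        rw [setN_nat_ne _ (by omega), setN_nat_ne _ (by omega)]) rfl
      have hs₁ : Selects (Q.erase v) t₁ := q1.set f5 (by simp) fun u hu => by simp [hu]
      have hcount := exec_countViolated (exec_violated hI (hX.trans hZ) hL₁ hs₁)
      have g5 : (countViolated.exec n (violated.exec n t₁)).nat 5 = t₁.nat 5 :=
        (exec_nat_eq rfl _).trans (exec_nat_eq rfl t₁)
      have g27 : (countViolated.exec n (violated.exec n t₁)).nat 27 = t₁.nat 27 :=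
        (exec_nat_eq rfl _).trans (exec_nat_eq rfl t₁)
      set t₂ := countViolated.exec n (violated.exec n t₁)
      have hs₂ : Selects (Q.erase v) t₂ := by
        intro u
        rw [g5]
        exact hs₁ u
      rw [exec_ite]
      simp only [Test.holds, NExp.eval, hcount]
      by_cases hviol : I.violatedBisets (Q.erase v) = ∅
      · rw [if_neg (by rw [hviol]; simp), exec_skip]
        rw [if_pos hviol] at q4
        exact ⟨Q.erase v, hsel hs₂, hZ, hQ', q4⟩
      · rw [if_pos (show 1 ≤ _ from card_pos.2 (nonempty_iff_ne_empty.2 hviol))]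
        rw [if_neg hviol] at q4
        refine ⟨Q, hsel (hs₂.set (v := v) ?_ (by rw [if_pos hvQ]) fun u hu => by simp [hu]), q2,
          fun u hu => (mem_erase.1 (hQ' u hu)).2, q4⟩
        simp [NExp.eval, g27, f27]
    · rw [if_neg hT, exec_skip]
      rw [List.drop_of_length_le (by omega)] at q4
      refine ⟨Q, hsel q1, q2, fun u hu => ?_, ?_⟩
      · rw [List.drop_of_length_le (by omega)] at hu
        simp at hu
      · rw [List.drop_of_length_le (by omega)]
        exact q4

/-- The primal-dual algorithm with reverse delete. -/
def primalDual : Cmd := block [setUp, firstStage, secondStage]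

end Cmd

theorem exists_run_primalDual {n : ℕ} (I : Phase (Fin n)) (hI : I.Valid) :
    ∃ (m : Store) (t : ℕ), Run primalDual.compile (input I) m t ∧ t ≤ primalDual.time.eval n ∧
      I.IsOutput I.zeroSet (output n m) := by
  have hn : (input I).nat 0 0 0 = n := by simp [input]
  obtain ⟨t, ht, hrun⟩ := run_compile (n := n) (c := primalDual) (by decide) (by decide) (input I) hn
  refine ⟨_, t, hrun, ht, ?_⟩
  obtain ⟨st, h1, h2, h3⟩ := exec_firstStage hI (exec_setUp I)
  refine ⟨st, h1, h2, ?_⟩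
  have h4 := exec_secondStage hI h1 h3
  ext v
  have h5 := h4 v
  simp only [output, mem_filter, mem_univ, true_and]
  change (secondStage.exec n (firstStage.exec n (setUp.exec n (input I)))).nat 5 v 0 = 1 ↔ _
  rw [h5]
  split_ifs with h <;> simp [h]

end RAM

/-! ### The main theorem -/

theorem mainTheorem4 :
    -- the phase function is a `{0,1}`-valued biuncrossable function on a crossing bifamily
    (∀ (n : ℕ) (I : Phase (Fin n)), I.Valid →
      Biset.IsCrossing I.family ∧ (∀ S ∈ I.family, I.h S = 0 ∨ I.h S = 1) ∧
      Biset.IsBiuncrossable I.family I.h) ∧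
    -- the primal-dual algorithm never gets stuck and makes at most `n` iterations
    (∀ (n : ℕ) (I : Phase (Fin n)), I.Valid →
      ∀ P₀ : Finset (Fin n), I.X ⊆ P₀ → (∀ v ∈ P₀, I.wt v = 0) →
      ∀ s : Phase.State (Fin n), I.Reachable P₀ s →
        s.added.length ≤ n ∧
        (I.violatedBisets (s.P P₀) ≠ ∅ → ∃ s' : Phase.State (Fin n), I.Step P₀ s s')) ∧
    -- its output is a cover of weight at most a constant times the LP optimum (and hence the optimum)
    (∀ 𝒢 : GraphFamily, 𝒢.MinorClosed → 𝒢.Proper →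
      ∃ c : ℝ, ∀ (n : ℕ) (I : Phase (Fin n)), I.Valid → I.G ∈ 𝒢 n →
        ∀ P₀ : Finset (Fin n), I.X ⊆ P₀ → (∀ v ∈ P₀, I.wt v = 0) →
        ∀ Q : Finset (Fin n), I.IsOutput P₀ Q →
          I.X ⊆ Q ∧ I.Covers Q ∧
          (∀ x : Fin n → ℝ, I.LPFeasible x → I.weight Q ≤ c * I.lpValue x) ∧
          (∀ A : Finset (Fin n), I.Covers (I.X ∪ A) → I.weight Q ≤ c * I.weight A)) ∧
    -- it can be implemented so as to run in polynomial time
    (∃ (prog : RAM.Program) (p : Polynomial ℕ),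
      ∀ (n : ℕ) (I : Phase (Fin n)), I.Valid →
        ∃ (m : RAM.Store) (t : ℕ), RAM.Run prog (RAM.input I) m t ∧ t ≤ p.eval n ∧
          I.IsOutput I.zeroSet (RAM.output n m)) := by
  refine ⟨fun n I hI => ⟨I.family_isCrossing, fun S hS => ?_, Phase.h_isBiuncrossable hI⟩,
    fun n I hI P₀ hX hw s hs => ⟨?_, ?_⟩, fun 𝒢 hc hp => ?_, ?_⟩
  · have h1 := Phase.h_le_one hI hS
    have h2 := Phase.h_nonneg (I := I) (S := S)
    omega
  · simpa using hs.length_le hI hX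
  · exact Phase.exists_step hI hX (hs.invariant hI hX).load_le
  · obtain ⟨c, h⟩ := hc.exists_card_adjPairs_le hp
    refine ⟨5 * c, fun n I hI hG P₀ hX hw Q hQ => ?_⟩
    exact hQ.approx hI hX hw (by positivity) (Phase.chargeable hI fun W _ K hK => h n I.G hG W K hK)
  · exact ⟨_, _, fun n I hI => RAM.exists_run_primalDual I hI⟩
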